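/- **Setting.** A well-labeled tree $(T,l)$ is a locally finite rooted plane tree with integer vertex labels that differ by at most $1$ between neighbours. For $x\in\mathbb Z$, let $\mathrm{GW}_x$ be the law of the Galton–Watson tree with offspring law $P(j)=2^{-(j+1)}$, $j\ge 0$, whose root has label $x$ and whose label increments along the edges are independent and uniform in $\{-1,0,1\}$; for $x\ge 1$, let $\mathrm{GW}_x^+$ be $\mathrm{GW}_x$ conditioned on all labels being positive. Let $w(x)=\frac{x(x+3)}{(x+1)(x+2)}$. The uniform infinite labeled tree $\theta_\infty=(T_\infty,l_\infty)$ has one infinite spine; its spine labels $(S_i)_{i\ge0}$ form a random walk started from $0$ with independent uniform steps in $\{-1,0,1\}$, and, given these, the subtrees on the left and on the right of the $i$-th spine vertex, $i \geq 0$, are independent with law $\mathrm{GW}_{S_i}$. For a finite family $(x_i)_{i\in J}$ of integers, $\mu_{(x_i)}$ is the law of the forest obtained by choosing $I$ uniform in $J$ and, given $I$, taking independent trees: the tree of index $I$ is distributed as $(T_\infty,l_\infty+x_I)$ and the tree of index $i\ne I$ has law $\mathrm{GW}_{x_i}$. Let $k\ge1$. Let $e_0$ be the root-corner of $\theta_\infty$,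 $e_k$ the first corner with label $-k$ after $e_0$ in clockwise order, and $e_{-k+1}$ the last corner with label $-k+1$ before $e_0$ (for $k=1$ this is $e_0$ itself); the same notation is used for the incident vertices. Let $v_k$ be the most recent common ancestor of $e_k$ and $e_{-k+1}$. Let $a_\infty,b_\infty,c_\infty$ be the distances in $T_\infty$ from $v_k$ to $e_k$, $e_{-k+1}$, $e_0$ respectively. Denote by $\mathbf x_0,\dots,\mathbf x_{a_\infty}$ the path from $e_k$ to $v_k$, by $\mathbf y_0,\dots,\mathbf y_{b_\infty}$ the path from $e_{-k+1}$ to $v_k$, by $\mathbf z_0,\dots,\mathbf z_{c_\infty}$ the path from $v_k$ to $e_0$, and by $X_i,Y_i,Z_i$ the labels of $\mathbf x_i,\mathbf y_i,\mathbf z_i$ for $l_\infty+k$. Put $\mathbf x_{a_\infty+i}=\mathbf z_i$ and $\mathbf y_{b_\infty+i}=\mathbf z_i$ for $0\le i\le c_\infty$. The following plane trees all carry the labels $l_\infty+k$, and "left" and "right" refer to $T_\infty$ drawn from its root $e_0$, children being ordered from left to right: - $\tau_i$ ($1\le i\le a_\infty+c_\infty$) is the tree made of $\mathbf x_i$ and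 its descendants through its children to the left of $\mathbf x_{i-1}$; - $\tau'_i$ ($1\le i\le b_\infty+c_\infty$) is the tree made of $\mathbf y_i$ and its descendants through its children to the right of $\mathbf y_{i-1}$; - $\bar\tau_0$ is the tree of $e_k$ and its descendants; for $0<i<a_\infty$, $\bar\tau_i$ is made of $\mathbf x_i$ and its descendants through its children to the right of $\mathbf x_{i-1}$; $\bar\tau_{a_\infty}$ is made of $v_k$ and its descendants through its children strictly between $\mathbf x_{a_\infty-1}$ and $\mathbf y_{b_\infty-1}$; - $\bar\tau'_0$ is the tree of $e_{-k+1}$ and its descendants; for $0<i<b_\infty$, $\bar\tau'_i$ is made of $\mathbf y_i$ and its descendants through its children to the left of $\mathbf y_{i-1}$. **Statement.** Let $a,b,c,k'\ge1$ and let $(x_1,\dots,x_a)$, $(y_1,\dots,y_b)$, $(z_0,\dots,z_c)$ be integer walks with steps in $\{-1,0,1\}$ such that $x_1=1$, $x_a=k'$ and all $x_i>0$; $y_1=2$, $y_b=k'$ and all $y_i>1$; $z_0=k'$, $z_c=k$ and all $z_i>1$. Let $A$ be the event that $a_\infty=a$, $b_\infty=b$, $c_\infty=c$, $(X_1,\dots,X_a)=(x_1,\dots,x_a)$,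 $(Y_1,\dots,Y_b)=(y_1,\dots,y_b)$ and $(Z_0,\dots,Z_c)=(z_0,\dots,z_c)$. Then $$\mathbb P(A)=\frac{a+b+1}{3^{a+b+c}}\Big(\prod_{i=1}^a w(x_i)\Big)\Big(\prod_{i=1}^b w(y_i-1)\Big)\Big(\prod_{i=1}^{c} w(z_i)\,w(z_i-1)\Big).$$ Moreover, conditionally on $A$: - the forests $(\tau_i)_{1\le i\le a+c}$, $(\tau'_i)_{1\le i\le b+c}$ and $(\bar\tau_0,\dots,\bar\tau_a,\bar\tau'_0,\dots,\bar\tau'_{b-1})$ are independent; - the trees $\tau_i$ are independent, with law $\mathrm{GW}^+_{x_i}$ for $1\le i\le a$ and $\mathrm{GW}^+_{z_{i-a}}$ for $a+1\le i\le a+c$; - the trees $\tau'_i$ are independent, and $\tau'_i$ is obtained by adding $1$ to all labels of a tree with law $\mathrm{GW}^+_{y_i-1}$ for $1\le i\le b$ and $\mathrm{GW}^+_{z_{i-b}-1}$ for $b+1\le i\le b+c$; - the forest $(\bar\tau_0,\dots,\bar\tau_a,\bar\tau'_0,\dots,\bar\tau'_{b-1})$ has law $\mu_{(0,x_1,\dots,x_a,1,y_1,\dots,y_{b-1})}$.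 -/

import Mathlib

open MeasureTheory ProbabilityTheory

noncomputable section

namespace UIPQ

/-! ### Well-labeled plane trees -/

/-- A well-labeled rooted plane tree (finite, or infinite and locally finite), in Ulam-Harris
coding: a vertex is the list of the ranks (starting from `0`) of the successive children met on the
way up from the root, so `[]` is the root and `u ++ [i]` is the `i`-th child of `u`, from left to
right. `lab u` is the label of `u` if `u` is a vertex and `none` otherwise. -/
@[ext] structure LTree where
  /-- the label of a vertex (`none` outside the tree) -/
  lab : List ℕ → Option ℤ
  root_mem : (lab []).isSome
  parent_mem : ∀ u i, (lab (u ++ [i])).isSome → (lab u).isSome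
  sibling_mem : ∀ u i j, j < i → (lab (u ++ [i])).isSome → (lab (u ++ [j])).isSome
  locally_finite : ∀ u, ∃ d, (lab (u ++ [d])) = none
  well_labeled : ∀ u i p q, lab u = some p → lab (u ++ [i]) = some q → |q - p| ≤ 1

/-- The Borel `σ`-algebra of the local topology: it is generated by the maps `T ↦ T.lab u`. -/
instance : MeasurableSpace LTree :=
  MeasurableSpace.comap LTree.lab (MeasurableSpace.pi (m := fun _ => ⊤))

namespace LTree

/-- The number of children of `u` (`0` if `u` is not a vertex). -/
def deg (T : LTree) (u : List ℕ) : ℕ := by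
  classical exact Nat.find (T.locally_finite u)

/-- The label of the vertex `u`, as an integer (`0` if `u` is not a vertex). -/
def label (T : LTree) (u : List ℕ) : ℤ := (T.lab u).getD 0

/-- Adding the constant `x` to all the labels. -/
def shift (x : ℤ) (T : LTree) : LTree where
  lab u := (T.lab u).map (· + x)
  root_mem := by simpa using T.root_mem
  parent_mem u i h := by simpa using T.parent_mem u i (by simpa using h)
  sibling_mem u i j hj h := by simpa using T.sibling_mem u i j hj (by simpa using h)
  locally_finite u := by simpa using T.locally_finite u
  well_labeled u i p q hp hq := by
    simp only [Option.map_eq_some_iff] at hp hq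
    obtain ⟨p', hp', rfl⟩ := hp
    obtain ⟨q', hq', rfl⟩ := hq
    simpa using T.well_labeled u i p' q' hp' hq'

/-- The labels of `piece`. -/
def pieceLab (T : LTree) (u : List ℕ) (lo hi : ℕ) : List ℕ → Option ℤ
  | [] => some (T.label u)
  | i :: w => if lo + i < hi then T.lab (u ++ (lo + i) :: w) else none

/-- The subtree of `T` rooted at the vertex `u` and made of `u` and of its descendants through its
children of rank `r` with `lo ≤ r < hi`. -/
def piece (T : LTree) (u : List ℕ) (lo hi : ℕ) : LTree where
  lab := T.pieceLab u lo hi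
  root_mem := by simp [pieceLab]
  parent_mem v i h := by
    cases v with
    | nil => simp [pieceLab]
    | cons j w =>
      simp only [pieceLab, List.cons_append] at h ⊢
      split_ifs at h ⊢ with hj
      · exact T.parent_mem (u ++ (lo + j) :: w) i (by simpa using h)
      · simp at h
  sibling_mem v i j hj h := by
    cases v with
    | nil =>
      simp only [pieceLab, List.nil_append] at h ⊢
      split_ifs at h with hi'
      · rw [if_pos (by omega)]
        exact T.sibling_mem u (lo + i) (lo + j) (by omega) h
      · simp at h
    | cons r w =>
      simp only [pieceLab, List.cons_append] at h ⊢
      split_ifs at h ⊢ with hr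
      · simpa using T.sibling_mem (u ++ (lo + r) :: w) i j hj (by simpa using h)
      · simp at h
  locally_finite v := by
    cases v with
    | nil => exact ⟨hi, by simp [pieceLab]⟩
    | cons j w =>
      simp only [pieceLab, List.cons_append]
      split_ifs
      · simpa using T.locally_finite (u ++ (lo + j) :: w)
      · simp
  well_labeled v i p q hp hq := by
    cases v with
    | nil =>
      simp only [pieceLab, List.nil_append, Option.some.injEq] at hp hq
      split_ifs at hq
      obtain ⟨p', hp'⟩ := Option.isSome_iff_exists.1
        (T.parent_mem u (lo + i) (by rw [hq]; rfl))
      have : p = p' := by rw [← hp, label, hp']; rfl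
      exact T.well_labeled u (lo + i) p q (by rw [hp', this]) hq
    | cons j w =>
      simp only [pieceLab, List.cons_append] at hp hq
      split_ifs at hp hq
      exact T.well_labeled (u ++ (lo + j) :: w) i p q hp (by simpa using hq)

/-! ### Corners

The corner `(u, j)`, `0 ≤ j ≤ deg u`, is the one met around `u` just before its child of rank `j`
(after its last child if `j = deg u`) in the clockwise contour of the tree started from the root.
The pairs `([], 0)` and `([], deg [])` stand for the same corner, the root-corner. -/

/-- The next corner in clockwise order. -/
def nextCorner (T : LTree) : List ℕ × ℕ → List ℕ × ℕ := fun (u, j) =>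
  if j < T.deg u then (u ++ [j], 0)
  else if u = [] then (if 0 < T.deg [] then ([0], 0) else ([], 0))
  else (u.dropLast, u.getLastD 0 + 1)

/-- The previous corner in clockwise order. -/
def prevCorner (T : LTree) : List ℕ × ℕ → List ℕ × ℕ := fun (u, j) =>
  if 0 < j then (u ++ [j - 1], T.deg (u ++ [j - 1]))
  else if u = [] then
    (if 0 < T.deg [] then ([T.deg [] - 1], T.deg [T.deg [] - 1]) else ([], 0))
  else (u.dropLast, u.getLastD 0)

/-- The vertex incident to the corner `c_n`, where `(c_n)`, `n ∈ ℤ`, are the corners in clockwise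
order and `c_0` is the root-corner. -/
def cornerVertex (T : LTree) : ℤ → List ℕ
  | Int.ofNat n => (T.nextCorner^[n] ([], 0)).1
  | Int.negSucc n => (T.prevCorner^[n + 1] ([], 0)).1

/-- The vertex `e_k`, incident to the first corner with label `-k` after the root-corner. (It is
the root if there is no such corner.) -/
def ptE (T : LTree) (k : ℕ) : List ℕ :=
  T.cornerVertex (sInf {n : ℕ | T.label (T.cornerVertex n) = -k} : ℕ)

/-- The vertex `e_{-k+1}`, incident to the last corner with label `-k+1` before the root-corner.
(It is the root if there is no such corner.) -/
def ptE' (T : LTree) (k : ℕ) : List ℕ :=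
  T.cornerVertex (-(sInf {n : ℕ | T.label (T.cornerVertex (-(n : ℤ))) = -k + 1} : ℕ))

/-! ### The three branches -/

/-- The longest common prefix, i.e. the most recent common ancestor of two vertices. -/
def mrca : List ℕ → List ℕ → List ℕ
  | i :: u, j :: v => if i = j then i :: mrca u v else []
  | _, _ => []

/-- The `i`-th ancestor of `e` (`e` itself if `i = 0`). -/
def anc (e : List ℕ) (i : ℕ) : List ℕ := e.take (e.length - i)

/-- For `1 ≤ i ≤ e.length`, the rank of the vertex `anc e (i-1)` among the children of its parent
`anc e i`. -/
def branchRank (e : List ℕ) (i : ℕ) : ℕ := e.getD (e.length - i) 0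

/-- The vertex `v_k`, most recent common ancestor of `e_k` and `e_{-k+1}`. -/
def ptV (T : LTree) (k : ℕ) : List ℕ := mrca (T.ptE k) (T.ptE' k)

/-- The distance `a` between `v_k` and `e_k`. -/
def brA (T : LTree) (k : ℕ) : ℕ := (T.ptE k).length - (T.ptV k).length

/-- The distance `b` between `v_k` and `e_{-k+1}`. -/
def brB (T : LTree) (k : ℕ) : ℕ := (T.ptE' k).length - (T.ptV k).length

/-- The distance `c` between `v_k` and the root `e_0`. -/
def brC (T : LTree) (k : ℕ) : ℕ := (T.ptV k).length

/-- The labels `X_i`, shifted by `k`, along the path from `e_k` to `v_k`. -/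
def labX (T : LTree) (k i : ℕ) : ℤ := T.label (anc (T.ptE k) i) + k

/-- The labels `Y_i`, shifted by `k`, along the path from `e_{-k+1}` to `v_k`. -/
def labY (T : LTree) (k i : ℕ) : ℤ := T.label (anc (T.ptE' k) i) + k

/-- The labels `Z_i`, shifted by `k`, along the path from `v_k` to `e_0`. -/
def labZ (T : LTree) (k i : ℕ) : ℤ := T.label (anc (T.ptV k) i) + k

/-! ### The subtrees grafted on the branches

All of them carry the labels of `T` shifted by `k`. In the depth-first order `<`, the vertices `v`
with `anc e i ≤ v < anc e (i-1)` are `anc e i` and its descendants through the children on the left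
of the branch; the descendants `v` of `anc e i` which come after `anc e (i-1)` without being its
descendants are those through the children on the right of the branch. -/

/-- The subtree grafted at `anc e i`, on the left of the branch from `e` to the root. -/
def leftTree (T : LTree) (k : ℕ) (e : List ℕ) (i : ℕ) : LTree :=
  (T.piece (anc e i) 0 (branchRank e i)).shift k

/-- The subtree grafted at `anc e i`, on the right of the branch from `e` to the root. -/
def rightTree (T : LTree) (k : ℕ) (e : List ℕ) (i : ℕ) : LTree :=
  (T.piece (anc e i) (branchRank e i + 1) (T.deg (anc e i))).shift k

/-- The subtree of the descendants of `e`. -/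
def descTree (T : LTree) (k : ℕ) (e : List ℕ) : LTree := (T.piece e 0 (T.deg e)).shift k

/-- The subtree grafted at `v_k`, strictly between the branches to `e_k` and to `e_{-k+1}`. -/
def middleTree (T : LTree) (k : ℕ) : LTree :=
  (T.piece (T.ptV k) (branchRank (T.ptE k) (T.brA k) + 1)
    (branchRank (T.ptE' k) (T.brB k))).shift k

/-- `τ_i`, `1 ≤ i ≤ a + c`: the subtrees on the left of the path from `e_k` to the root. (The
`(a+i)`-th ancestor of `e_k` is the `i`-th ancestor of `v_k`.) -/
def tau (T : LTree) (k i : ℕ) : LTree := T.leftTree k (T.ptE k) i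

/-- `τ'_i`, `1 ≤ i ≤ b + c`: the subtrees on the right of the path from `e_{-k+1}` to the root. -/
def tau' (T : LTree) (k i : ℕ) : LTree := T.rightTree k (T.ptE' k) i

/-- `\bar τ_i`, `0 ≤ i ≤ a`: the descendants of `e_k` for `i = 0`, the subtrees on the right of the
branch from `e_k` to `v_k` for `0 < i < a`, and the subtree between the two branches for `i = a`. -/
def tauBar (T : LTree) (k i : ℕ) : LTree :=
  if i = 0 then T.descTree k (T.ptE k)
  else if i = T.brA k then T.middleTree k
  else T.rightTree k (T.ptE k) i

/-- `\bar τ'_i`, `0 ≤ i ≤ b - 1`: the descendants of `e_{-k+1}` for `i = 0`, the subtrees on the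
left of the branch from `e_{-k+1}` to `v_k` for `0 < i < b`. -/
def tauBar' (T : LTree) (k i : ℕ) : LTree :=
  if i = 0 then T.descTree k (T.ptE' k) else T.leftTree k (T.ptE' k) i

/-- The forest `(τ_1, …, τ_{a+c})`. -/
def forestTau (k a c : ℕ) (T : LTree) : Fin (a + c) → LTree := fun i => T.tau k (i + 1)

/-- The forest `(τ'_1, …, τ'_{b+c})`. -/
def forestTau' (k b c : ℕ) (T : LTree) : Fin (b + c) → LTree := fun i => T.tau' k (i + 1)

/-- The forest `(\bar τ_0, …, \bar τ_a, \bar τ'_0, …, \bar τ'_{b-1})`. -/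
def forestBar (k a b : ℕ) (T : LTree) : Fin (a + 1) ⊕ Fin b → LTree :=
  Sum.elim (fun i => T.tauBar k i) (fun i => T.tauBar' k i)

/-- The set of the trees such that the three branches have lengths `a, b, c` and labels
`(X_1, …, X_a) = (x_1, …, x_a)`, `(Y_1, …, Y_b) = (y_1, …, y_b)`,
`(Z_0, …, Z_c) = (z_0, …, z_c)`. -/
def branchSet (k a b c : ℕ) (x y z : ℕ → ℤ) : Set LTree :=
  {T | T.brA k = a ∧ T.brB k = b ∧ T.brC k = c ∧
    (∀ i ∈ Finset.Icc 1 a, T.labX k i = x i) ∧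
    (∀ i ∈ Finset.Icc 1 b, T.labY k i = y i) ∧
    (∀ i ∈ Finset.Icc 0 c, T.labZ k i = z i)}

end LTree

/-! ### Galton-Watson trees with uniform labels -/

/-- The geometric distribution `P(j) = 2^{-(j+1)}`, `j ≥ 0`. -/
def geomHalf : Measure ℕ := geometricMeasure ⟨1 / 2, by norm_num, by norm_num⟩

instance : IsProbabilityMeasure geomHalf := by unfold geomHalf; infer_instance

/-- The uniform distribution on `Fin 3`. -/
def unif3 : Measure (Fin 3) := (PMF.uniformOfFintype (Fin 3)).toMeasure

instance : IsProbabilityMeasure unif3 := by unfold unif3; infer_instance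

/-- The bijection from `Fin 3` to the set of steps `{-1, 0, 1}`. -/
def step (e : Fin 3) : ℤ := (e.val : ℤ) - 1

/-- The randomness of a labeled Galton-Watson tree: at every possible vertex `u`, its number of
children and the label increment between its parent and `u`. -/
abbrev Seed : Type := List ℕ → ℕ × Fin 3

/-- The seed law: independent geometric numbers of children and uniform label increments. -/
def seedLaw : Measure Seed := Measure.infinitePi (fun _ => geomHalf.prod unif3)

instance : IsProbabilityMeasure seedLaw := by unfold seedLaw; infer_instance

/-- The labels of the tree with root-label `x` generated by a seed. -/
def gwLab : Seed → ℤ → List ℕ → Option ℤ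
  | _, x, [] => some x
  | s, x, i :: u =>
    if i < (s []).1 then gwLab (fun v => s (i :: v)) (x + step (s [i]).2) u else none

theorem abs_step_le (e : Fin 3) : |step e| ≤ 1 := by
  fin_cases e <;> simp [step]

theorem gwLab_parent (u : List ℕ) : ∀ (s : Seed) (x : ℤ) (i : ℕ),
    (gwLab s x (u ++ [i])).isSome → (gwLab s x u).isSome := by
  induction u with
  | nil => intro s x i _; simp [gwLab]
  | cons j u ih =>
    intro s x i h
    simp only [gwLab, List.cons_append] at h ⊢
    split_ifs at h ⊢
    · exact ih _ _ _ h
    · simp at h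

theorem gwLab_sibling (u : List ℕ) : ∀ (s : Seed) (x : ℤ) (i j : ℕ), j < i →
    (gwLab s x (u ++ [i])).isSome → (gwLab s x (u ++ [j])).isSome := by
  induction u with
  | nil =>
    intro s x i j hj h
    simp only [gwLab, List.nil_append] at h ⊢
    split_ifs at h
    · rw [if_pos (by omega)]; simp
    · simp at h
  | cons r u ih =>
    intro s x i j hj h
    simp only [gwLab, List.cons_append] at h ⊢
    split_ifs at h ⊢
    · exact ih _ _ _ _ hj h
    · simp at h

theorem gwLab_finite (u : List ℕ) : ∀ (s : Seed) (x : ℤ), ∃ d, gwLab s x (u ++ [d]) = none := by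
  induction u with
  | nil => intro s x; exact ⟨(s []).1, by simp [gwLab]⟩
  | cons r u ih =>
    intro s x
    simp only [gwLab, List.cons_append]
    split_ifs
    · exact ih _ _
    · exact ⟨0, rfl⟩

theorem gwLab_close (u : List ℕ) : ∀ (s : Seed) (x : ℤ) (i : ℕ) (p q : ℤ),
    gwLab s x u = some p → gwLab s x (u ++ [i]) = some q → |q - p| ≤ 1 := by
  induction u with
  | nil =>
    intro s x i p q hp hq
    simp only [gwLab, List.nil_append, Option.some.injEq] at hp hq
    split_ifs at hq
    simp only [Option.some.injEq] at hq
    rw [← hp, ← hq]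
    simpa using abs_step_le _
  | cons r u ih =>
    intro s x i p q hp hq
    simp only [gwLab, List.cons_append] at hp hq
    split_ifs at hp hq
    exact ih _ _ _ _ _ hp hq

/-- The labeled tree with root-label `x` generated by a seed. -/
def gwTree (x : ℤ) (s : Seed) : LTree where
  lab := gwLab s x
  root_mem := by simp [gwLab]
  parent_mem u i := gwLab_parent u s x i
  sibling_mem u i j := gwLab_sibling u s x i j
  locally_finite u := gwLab_finite u s x
  well_labeled u i p q := gwLab_close u s x i p q

/-- The law of the Galton-Watson tree with geometric offspring distribution of parameter `1/2` and
uniform label increments in `{-1, 0, 1}`, with root-label `x`. -/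
def gw (x : ℤ) : Measure LTree := seedLaw.map (gwTree x)

/-- The law `gw x`, conditioned to have only positive labels. -/
def gwPos (x : ℤ) : Measure LTree := (gw x)[|{T : LTree | ∀ u p, T.lab u = some p → 0 < p}]

/-! ### The uniform infinite labeled tree -/

/-- The randomness of the uniform infinite labeled tree: for every `i`, the increment between the
labels of the spine vertices `i` and `i + 1`, and the seeds of the subtrees on the left and on the
right of the spine vertex `i`. -/
abbrev SpineSeed : Type := ℕ → Fin 3 × Seed × Seed

/-- The law of the randomness of the uniform infinite labeled tree. -/
def spineSeedLaw : Measure SpineSeed :=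
  Measure.infinitePi (fun _ => unif3.prod (seedLaw.prod seedLaw))

instance : IsProbabilityMeasure spineSeedLaw := by unfold spineSeedLaw; infer_instance

/-- The labels of the tree with one spine, started from label `x`: given the spine labels `S_i`, the
subtrees on the left and on the right of the `i`-th spine vertex are the trees with root-label `S_i`
generated by the two seeds. The children of the first spine vertex are those of its left subtree,
then the next spine vertex, then those of its right subtree. -/
def spineLab : SpineSeed → ℤ → List ℕ → Option ℤ
  | _, x, [] => some x
  | s, x, i :: u =>
    if i < ((s 0).2.1 []).1 then gwLab (s 0).2.1 x (i :: u)
    else if i = ((s 0).2.1 []).1 then spineLab (fun n => s (n + 1)) (x + step (s 0).1) u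
    else gwLab (s 0).2.2 x ((i - ((s 0).2.1 []).1 - 1) :: u)

theorem spineLab_parent (u : List ℕ) : ∀ (s : SpineSeed) (x : ℤ) (i : ℕ),
    (spineLab s x (u ++ [i])).isSome → (spineLab s x u).isSome := by
  induction u with
  | nil => intro s x i _; simp [spineLab]
  | cons j u ih =>
    intro s x i h
    simp only [spineLab, List.cons_append] at h ⊢
    split_ifs at h ⊢
    · exact gwLab_parent (j :: u) _ _ _ h
    · exact ih _ _ _ h
    · exact gwLab_parent (_ :: u) _ _ _ h

theorem spineLab_sibling (u : List ℕ) : ∀ (s : SpineSeed) (x : ℤ) (i j : ℕ), j < i →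
    (spineLab s x (u ++ [i])).isSome → (spineLab s x (u ++ [j])).isSome := by
  induction u with
  | nil =>
    intro s x i j hj h
    simp only [spineLab, List.nil_append] at h ⊢
    split_ifs at h ⊢
    all_goals first
      | omega
      | exact gwLab_sibling [] _ _ _ _ (by omega) h
      | simp [gwLab, *]
  | cons r u ih =>
    intro s x i j hj h
    simp only [spineLab, List.cons_append] at h ⊢
    split_ifs at h ⊢
    · exact gwLab_sibling (r :: u) _ _ _ _ hj h
    · exact ih _ _ _ _ hj h
    · exact gwLab_sibling (_ :: u) _ _ _ _ hj h

theorem spineLab_finite (u : List ℕ) : ∀ (s : SpineSeed) (x : ℤ),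
    ∃ d, spineLab s x (u ++ [d]) = none := by
  induction u with
  | nil =>
    intro s x
    refine ⟨((s 0).2.1 []).1 + 1 + ((s 0).2.2 []).1, ?_⟩
    simp only [spineLab, List.nil_append]
    rw [if_neg (by omega), if_neg (by omega)]
    simp only [gwLab]
    rw [if_neg (by omega)]
  | cons r u ih =>
    intro s x
    simp only [spineLab, List.cons_append]
    split_ifs
    · exact gwLab_finite (r :: u) _ _
    · exact ih _ _
    · exact gwLab_finite (_ :: u) _ _

theorem spineLab_close (u : List ℕ) : ∀ (s : SpineSeed) (x : ℤ) (i : ℕ) (p q : ℤ),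
    spineLab s x u = some p → spineLab s x (u ++ [i]) = some q → |q - p| ≤ 1 := by
  induction u with
  | nil =>
    intro s x i p q hp hq
    simp only [spineLab, List.nil_append] at hp hq
    split_ifs at hq
    · exact gwLab_close [] _ x i p q hp hq
    · simp only [Option.some.injEq] at hp hq
      rw [← hp, ← hq]
      simpa using abs_step_le _
    · exact gwLab_close [] _ x _ p q hp hq
  | cons r u ih =>
    intro s x i p q hp hq
    simp only [spineLab, List.cons_append] at hp hq
    split_ifs at hp hq
    · exact gwLab_close (r :: u) _ _ _ _ _ hp hq
    · exact ih _ _ _ _ _ hp hq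
    · exact gwLab_close (_ :: u) _ _ _ _ _ hp hq

/-- The labeled tree with one spine and root-label `0` generated by the randomness `s`. -/
def spineTree (s : SpineSeed) : LTree where
  lab := spineLab s 0
  root_mem := by simp [spineLab]
  parent_mem u i := spineLab_parent u s 0 i
  sibling_mem u i j := spineLab_sibling u s 0 i j
  locally_finite u := spineLab_finite u s 0
  well_labeled u i p q := spineLab_close u s 0 i p q

/-- The law of the uniform infinite labeled tree `θ_∞`. -/
def uniformInfiniteTree : Measure LTree := spineSeedLaw.map spineTree

/-- The law `μ` of the uniform infinite forest with root-labels `x_i`, `i ∈ ι`: a uniform index `I`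
is chosen, the tree of index `I` is distributed as `θ_∞` with labels shifted by `x_I`, the trees of
index `i ≠ I` have law `gw (x_i)`, and all these trees are independent. -/
def forestLaw {ι : Type} [Fintype ι] [DecidableEq ι] (x : ι → ℤ) : Measure (ι → LTree) :=
  (Fintype.card ι : ENNReal)⁻¹ • ∑ I : ι, Measure.pi (fun i =>
    if i = I then uniformInfiniteTree.map (LTree.shift (x i)) else gw (x i))

/-! ### Walks and weights -/

/-- `(x_p, …, x_q)` is a walk with steps in `{-1, 0, 1}`, from `s` to `t`, all whose values are
greater than `m`. -/
def IsWalkAbove (m : ℤ) (p q : ℕ) (s t : ℤ) (x : ℕ → ℤ) : Prop :=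
  x p = s ∧ x q = t ∧ (∀ i, p ≤ i → i ≤ q → m < x i) ∧
    ∀ i, p ≤ i → i < q → |x (i + 1) - x i| ≤ 1

/-- `w(x) = x(x+3) / ((x+1)(x+2))`. -/
def w (x : ℤ) : ℝ := (x * (x + 3)) / ((x + 1) * (x + 2))

/-! ### Measurability: the laws above are indeed probability measures -/

theorem measurable_of_lab {α : Type*} [MeasurableSpace α] {f : α → LTree}
    (h : ∀ u (o : Option ℤ), MeasurableSet {s | (f s).lab u = o}) : Measurable f := by
  refine measurable_iff_comap_le.2 ?_
  change MeasurableSpace.comap f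
    (MeasurableSpace.comap LTree.lab (MeasurableSpace.pi (m := fun _ => ⊤))) ≤ _
  rw [MeasurableSpace.comap_comp, ← measurable_iff_comap_le]
  refine @measurable_pi_lambda _ _ _ _ (fun _ => ⊤) _ fun u => ?_
  refine @measurable_to_countable' _ _ ⊤ _ _ _ fun o => h u o

theorem measurableSet_lab (u : List ℕ) (o : Option ℤ) :
    MeasurableSet {T : LTree | T.lab u = o} := by
  have h : @Measurable _ _ (MeasurableSpace.pi (m := fun _ : List ℕ => (⊤ : MeasurableSpace
    (Option ℤ)))) ⊤ (fun g : List ℕ → Option ℤ => g u) := @measurable_pi_apply _ _ (fun _ => ⊤) u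
  exact ⟨_, h (show MeasurableSet[⊤] {o} from trivial), rfl⟩

theorem measurable_shift (x : ℤ) : Measurable (LTree.shift x) := by
  refine measurable_of_lab fun u o => ?_
  have : {T : LTree | (T.shift x).lab u = o} =
      ⋃ o' ∈ {o' : Option ℤ | o'.map (· + x) = o}, {T : LTree | T.lab u = o'} := by
    ext T; simp [LTree.shift]
  rw [this]
  exact MeasurableSet.biUnion (Set.to_countable _) fun o' _ => measurableSet_lab u o'

theorem measurableSet_gwLab (u : List ℕ) : ∀ (x : ℤ) (o : Option ℤ),
    MeasurableSet {s : Seed | gwLab s x u = o} := by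
  induction u with
  | nil => intro x o; simp [gwLab]
  | cons i u ih =>
    intro x o
    have : {s : Seed | gwLab s x (i :: u) = o} =
        ({s : Seed | i < (s []).1} ∩ ⋃ e : Fin 3, ({s : Seed | (s [i]).2 = e} ∩
          (fun (s : Seed) v => s (i :: v)) ⁻¹' {s : Seed | gwLab s (x + step e) u = o}))
        ∪ ({s : Seed | i < (s []).1}ᶜ ∩ {s : Seed | none = o}) := by
      ext s
      by_cases h : i < (s []).1 <;> simp [gwLab, h]
    rw [this]
    have h0 : MeasurableSet {s : Seed | i < (s []).1} :=
      (measurable_fst.comp (measurable_pi_apply [])) (MeasurableSet.of_discrete (s := Set.Ioi i))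
    have hm : Measurable (fun (s : Seed) v => s (i :: v)) :=
      measurable_pi_lambda _ fun v => measurable_pi_apply _
    refine (h0.inter (MeasurableSet.iUnion fun e => ?_)).union (h0.compl.inter (by simp))
    exact ((measurable_snd.comp (measurable_pi_apply [i]))
      (MeasurableSet.of_discrete (s := {e}))).inter (hm (ih _ _))

theorem measurable_gwTree (x : ℤ) : Measurable (gwTree x) :=
  measurable_of_lab fun u o => measurableSet_gwLab u x o

theorem measurableSet_spineLab (u : List ℕ) : ∀ (x : ℤ) (o : Option ℤ),
    MeasurableSet {s : SpineSeed | spineLab s x u = o} := by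
  induction u with
  | nil => intro x o; simp [spineLab]
  | cons i u ih =>
    intro x o
    have : {s : SpineSeed | spineLab s x (i :: u) = o} = ⋃ d : ℕ, ⋃ e : Fin 3,
        ({s : SpineSeed | ((s 0).2.1 []).1 = d} ∩ {s : SpineSeed | (s 0).1 = e}) ∩
        (if i < d then (fun s : SpineSeed => (s 0).2.1) ⁻¹' {s | gwLab s x (i :: u) = o}
        else if i = d then
          (fun (s : SpineSeed) n => s (n + 1)) ⁻¹' {s | spineLab s (x + step e) u = o}
        else (fun s : SpineSeed => (s 0).2.2) ⁻¹' {s | gwLab s x ((i - d - 1) :: u) = o}) := by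
      ext s
      simp only [spineLab, Set.mem_ofPred_eq, Set.mem_iUnion, Set.mem_inter_iff]
      constructor
      · intro h
        refine ⟨_, _, ⟨rfl, rfl⟩, ?_⟩
        split_ifs at h ⊢ <;> exact h
      · rintro ⟨d, e, ⟨rfl, rfl⟩, h⟩
        split_ifs at h ⊢ <;> exact h
    rw [this]
    have h0 : Measurable (fun s : SpineSeed => s 0) := measurable_pi_apply 0
    have h1 : Measurable (fun s : SpineSeed => (s 0).2.1) := by fun_prop
    have h2 : Measurable (fun s : SpineSeed => (s 0).2.2) := by fun_prop
    have h3 : Measurable (fun (s : SpineSeed) n => s (n + 1)) :=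
      measurable_pi_lambda _ fun v => measurable_pi_apply _
    have h4 : Measurable (fun s : SpineSeed => ((s 0).2.1 []).1) :=
      measurable_fst.comp ((measurable_pi_apply (X := fun _ : List ℕ => ℕ × Fin 3) []).comp h1)
    refine MeasurableSet.iUnion fun d => MeasurableSet.iUnion fun e => MeasurableSet.inter
      (MeasurableSet.inter (h4 (MeasurableSet.of_discrete (s := {d})))
        ((measurable_fst.comp h0) (MeasurableSet.of_discrete (s := {e})))) ?_
    split_ifs
    · exact h1 (measurableSet_gwLab _ _ _)
    · exact h3 (ih _ _)
    · exact h2 (measurableSet_gwLab _ _ _)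

theorem measurable_spineTree : Measurable spineTree :=
  measurable_of_lab fun u o => measurableSet_spineLab u 0 o

instance (x : ℤ) : IsProbabilityMeasure (gw x) :=
  Measure.isProbabilityMeasure_map (measurable_gwTree x).aemeasurable

instance : IsProbabilityMeasure uniformInfiniteTree :=
  Measure.isProbabilityMeasure_map measurable_spineTree.aemeasurable

end UIPQ

end

namespace UIPQ

/-! ### Reindexing of independent families -/

/-! The geometric offspring law satisfies `P(i + 1 + n) = P(i) P(n)`. So, summing over all children
of the root of a Galton–Watson tree, the part on the left of the marked child, the subtree of this
child and the part on its right are three independent Galton–Watson trees, with total mass one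
(`lintegral_tsum_children`). Hence, for trees in which a marked branch is determined by the tree
itself, the probability factorizes over the pieces grafted along the branch, with a factor `1/3` for
each prescribed label increment (`gw_split`).

In the infinite tree exactly one of the three pieces carries the spine, which gives a Leibniz rule
(`uit_split`): the law `uit` behaves as a derivative of `gw`. Both laws are therefore combined into
a dual number `gw + ε uit`, which is multiplicative under splitting (`dualLaw_split`,
`dualLaw_trunk`).

The contour enters only through the description of `e_k` and `e_{-k+1}`: after shifting labels by
`k`, they have labels `0` and `1`, the trees on the left of the branch to `e_k` are finite with
positive labels, and those on the right of the branch to `e_{-k+1}` are finite with labels above `1`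
(`mem_branchSet_iff`, `shift_mem_trunk_iff`). The same label constraints make the two branches
unique. The infinite tree is almost surely infinite, so these outer trees have no `ε` part; they
contribute the probabilities `w` of positivity and the conditioned laws `gwPos`. The other `a + b +
1` trees are free, and exactly one of them carries the spine: the `ε` part of their product is `(a +
b + 1)` times the law `forestLaw`. Reading off the `ε` coefficient on measurable rectangles gives
the probability and the joint conditional law at once.

That `w` is the probability of positivity is proved by comparing two solutions of the same
recursion: their difference is convex, vanishes at `0` and tends to `0` at infinity
(`gw_real_labelsAbove_zero`). -/

theorem infinitePi_prod_map_elim {ι κ X : Type*} [MeasurableSpace X] (ρ : Measure X)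
    [IsProbabilityMeasure ρ] :
    ((Measure.infinitePi fun _ : ι => ρ).prod (Measure.infinitePi fun _ : κ => ρ)).map
      (fun p => Sum.elim p.1 p.2) = Measure.infinitePi fun _ : ι ⊕ κ => ρ := by
  have hm : Measurable (fun p : (ι → X) × (κ → X) => (Sum.elim p.1 p.2 : ι ⊕ κ → X)) := by
    refine measurable_pi_lambda _ fun i => ?_
    cases i with
    | inl i => exact (measurable_pi_apply i).comp measurable_fst
    | inr i => exact (measurable_pi_apply i).comp measurable_snd
  refine Measure.eq_infinitePi _ fun F t ht => ?_
  rw [Measure.map_apply hm (MeasurableSet.pi F.countable_toSet fun i _ => ht i)]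
  have : (fun p : (ι → X) × (κ → X) => (Sum.elim p.1 p.2 : ι ⊕ κ → X)) ⁻¹' (Set.pi F t) =
      (Set.pi F.toLeft fun i => t (Sum.inl i)) ×ˢ (Set.pi F.toRight fun i => t (Sum.inr i)) := by
    ext p
    simp [Set.mem_pi]
  rw [this, Measure.prod_prod, Measure.infinitePi_pi _ (fun i _ => ht _),
    Measure.infinitePi_pi _ (fun i _ => ht _)]
  conv_rhs => rw [← Finset.toLeft_disjSum_toRight (u := F), Finset.prod_disjSum]

/-- The surgeries on seeds below (resampling the root, grafting at a fixed rank, adding a spine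
vertex) read each new coordinate from a different old one. Injectivity of `φ` is what keeps the
coordinates independent. -/
theorem infinitePi_prod_map_reindex {ι κ σ X : Type*} [MeasurableSpace X] (ρ : Measure X)
    [IsProbabilityMeasure ρ] {φ : σ → ι ⊕ κ} (hφ : Function.Injective φ) :
    ((Measure.infinitePi fun _ : ι => ρ).prod (Measure.infinitePi fun _ : κ => ρ)).map
      (fun p i => Sum.elim p.1 p.2 (φ i)) = Measure.infinitePi fun _ : σ => ρ := by
  rw [← Measure.map_infinitePi_infinitePi_of_inj (P := fun _ : ι ⊕ κ => ρ) hφ,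
    ← infinitePi_prod_map_elim, Measure.map_map]
  · rfl
  · exact measurable_pi_lambda _ fun i => measurable_pi_apply _
  · refine measurable_pi_lambda _ fun i => ?_
    cases i with
    | inl i => exact (measurable_pi_apply i).comp measurable_fst
    | inr i => exact (measurable_pi_apply i).comp measurable_snd

/-! ### The root degree of a seed -/

theorem geomHalf_singleton (n : ℕ) : geomHalf {n} = 2⁻¹ ^ (n + 1) := by
  rw [geomHalf, geometricMeasure_singleton (by simp [← Subtype.coe_ne_coe])]
  rw [pow_succ, ENNReal.ofReal_mul (by norm_num), ENNReal.ofReal_pow (by norm_num)]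
  have : ENNReal.ofReal (1 / 2) = 2⁻¹ := by
    rw [one_div, ENNReal.ofReal_inv_of_pos (by norm_num)]; norm_num
  norm_num at this ⊢
  rw [this]

/-- The seed `s` with the number of children of the root changed to `n`. -/
def withRoot (n : ℕ) (s : Seed) : Seed
  | [] => (n, (s []).2)
  | i :: u => s (i :: u)

theorem measurable_withRoot (n : ℕ) : Measurable (withRoot n) := by
  refine measurable_pi_lambda _ fun u => ?_
  cases u with
  | nil => exact measurable_const.prodMk (measurable_snd.comp (measurable_pi_apply []))
  | cons i u => exact measurable_pi_apply (i :: u)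

theorem lintegral_seedLaw_update {f : Seed → ENNReal} (hf : Measurable f) :
    ∫⁻ s, f s ∂seedLaw =
      ∫⁻ m, ∫⁻ e, ∫⁻ s, f (Function.update s [] (m, e)) ∂seedLaw ∂unif3 ∂geomHalf := by
  -- The root coordinate is read from the first copy of the seed and all others from the second one.
  let φ : List ℕ → List ℕ ⊕ List ℕ := fun u => if u = [] then Sum.inl [] else Sum.inr u
  have hφ : Function.Injective φ := by
    intro u v h
    simp only [φ] at h
    split_ifs at h with h1 h2 h2
    · rw [h1, h2]
    · simpa using h
  have key : (seedLaw.prod seedLaw).map (fun p i => Sum.elim p.1 p.2 (φ i)) = seedLaw :=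
    infinitePi_prod_map_reindex _ hφ
  have hfun : (fun (p : Seed × Seed) (i : List ℕ) => Sum.elim p.1 p.2 (φ i)) =
      fun p => Function.update p.2 [] (p.1 []) := by
    funext p u
    by_cases h : u = []
    · subst h; simp [φ]
    · simp [φ, h]
  have hm : Measurable (fun p : (ℕ × Fin 3) × Seed => (Function.update p.2 [] p.1 : Seed)) := by
    refine measurable_pi_lambda _ fun u => ?_
    by_cases h : u = []
    · subst h; simpa using measurable_fst
    · simp only [Function.update_of_ne h]
      fun_prop
  have hm' : Measurable (fun p : Seed × Seed => (Function.update p.2 [] (p.1 []) : Seed)) :=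
    hm.comp (by fun_prop : Measurable fun p : Seed × Seed => (p.1 [], p.2))
  have hev : seedLaw.map (fun s : Seed => s []) = geomHalf.prod unif3 :=
    Measure.infinitePi_map_eval _ []
  rw [hfun] at key
  conv_lhs => rw [← key]
  rw [lintegral_map hf hm']
  refine (lintegral_prod _ (hf.comp hm').aemeasurable).trans ?_
  have h2 : Measurable fun d : ℕ × Fin 3 => ∫⁻ s, f (Function.update s [] d) ∂seedLaw :=
    (hf.comp hm).lintegral_prod_right'
  calc _ = ∫⁻ d, ∫⁻ s, f (Function.update s [] d) ∂seedLaw ∂(seedLaw.map fun s : Seed => s []) :=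
        (lintegral_map h2 (measurable_pi_apply [])).symm
    _ = _ := by rw [hev, lintegral_prod _ h2.aemeasurable]

/-- Conditioning on the number of children of the root, which is independent of the rest of the
seed. -/
theorem lintegral_seedLaw_eq_tsum {f : Seed → ENNReal} (hf : Measurable f) :
    ∫⁻ s, f s ∂seedLaw = ∑' n, 2⁻¹ ^ (n + 1) * ∫⁻ s, f (withRoot n s) ∂seedLaw := by
  rw [lintegral_seedLaw_update hf, lintegral_countable']
  refine tsum_congr fun n => ?_
  rw [geomHalf_singleton, mul_comm]
  congr 1
  refine Eq.trans ?_ (lintegral_seedLaw_update (hf.comp (measurable_withRoot n))).symm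
  have : ∀ (s : Seed) (m : ℕ) (e : Fin 3), withRoot n (Function.update s [] (m, e)) =
      Function.update s [] (n, e) := by
    intro s m e
    funext u
    cases u <;> simp [withRoot]
  simp only [Function.comp_apply, this]
  simp

/-! ### Choosing a child of the root -/

/-- The seed of the tree obtained by grafting at the root, from left to right, the children of
`s₀`, the tree of `s₁` and the children of `s₂`. -/
def comb (s₀ s₁ s₂ : Seed) : Seed
  | [] => ((s₀ []).1 + 1 + (s₂ []).1, (s₀ []).2)
  | j :: v => if j < (s₀ []).1 then s₀ (j :: v) else if j = (s₀ []).1 then s₁ v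
      else s₂ ((j - (s₀ []).1 - 1) :: v)

/-- As `comb`, with `i` children coming from `s₀`, and the root degree of `s₀`. -/
def combAt (i : ℕ) (s₀ s₁ s₂ : Seed) : Seed
  | [] => s₀ []
  | j :: v => if j < i then s₀ (j :: v) else if j = i then s₁ v else s₂ ((j - i - 1) :: v)

theorem measurable_combAt (i : ℕ) :
    Measurable fun p : Seed × Seed × Seed => combAt i p.1 p.2.1 p.2.2 := by
  refine measurable_pi_lambda _ fun u => ?_
  cases u with
  | nil => exact (measurable_pi_apply []).comp measurable_fst
  | cons j v =>
    simp only [combAt]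
    split_ifs <;> fun_prop

/-- Once the root degrees `i` and `n` are fixed, the grafting rank is no longer random, and
`map_combAt` becomes available. -/
theorem comb_withRoot (i n : ℕ) (s₀ s₁ s₂ : Seed) :
    comb (withRoot i s₀) s₁ (withRoot n s₂) = combAt i (withRoot (i + 1 + n) s₀) s₁ s₂ := by
  funext u
  cases u with
  | nil => simp [comb, combAt, withRoot]
  | cons j v => rfl

theorem measurable_comb : Measurable fun p : Seed × Seed × Seed => comb p.1 p.2.1 p.2.2 := by
  have h0 : Measurable fun p : Seed × Seed × Seed => (p.1 []).1 := by fun_prop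
  have h1 : Measurable fun p : Seed × Seed × Seed => (p.2.2 []).1 := by fun_prop
  refine measurable_pi_lambda _ fun u => ?_
  cases u with
  | nil =>
    simp only [comb]
    exact ((h0.add_const 1).add h1).prodMk (by fun_prop)
  | cons j v =>
    simp only [comb]
    refine Measurable.ite (measurableSet_lt measurable_const h0) (by fun_prop) ?_
    refine Measurable.ite (measurableSet_eq_fun measurable_const h0) (by fun_prop) ?_
    have : Measurable fun q : (Seed × Seed × Seed) × ℕ => q.1.2.2 ((j - q.2 - 1) :: v) :=
      measurable_from_prod_countable_left fun n => by dsimp only; fun_prop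
    exact this.comp (measurable_id.prodMk h0)

theorem map_combAt (i : ℕ) :
    (seedLaw.prod (seedLaw.prod seedLaw)).map (fun p => combAt i p.1 p.2.1 p.2.2) = seedLaw := by
  -- Coordinates of `s₀` with first letter at least `i`, and the root of `s₂`, are never read; the
  -- remaining ones are each read once.
  let φ : List ℕ → List ℕ ⊕ (List ℕ ⊕ List ℕ)
    | [] => Sum.inl []
    | j :: v => if j < i then Sum.inl (j :: v) else if j = i then Sum.inr (Sum.inl v)
      else Sum.inr (Sum.inr ((j - i - 1) :: v))
  have hφ : Function.Injective φ := by
    intro u v h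
    rcases u with _ | ⟨j, u⟩ <;> rcases v with _ | ⟨j', v⟩ <;> simp only [φ] at h <;>
      (try split_ifs at h) <;> (simp_all; try omega)
  have key := infinitePi_prod_map_reindex (geomHalf.prod unif3) hφ
  rw [← infinitePi_prod_map_elim] at key
  change (seedLaw.prod ((seedLaw.prod seedLaw).map _)).map _ = seedLaw at key
  have hm : Measurable (fun p : Seed × Seed => (Sum.elim p.1 p.2 : List ℕ ⊕ List ℕ → ℕ × Fin 3)) := by
    refine measurable_pi_lambda _ fun i => ?_
    cases i with
    | inl i => exact (measurable_pi_apply i).comp measurable_fst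
    | inr i => exact (measurable_pi_apply i).comp measurable_snd
  conv_rhs => rw [← key]
  conv_rhs => enter [2, 1]; rw [← Measure.map_id (μ := seedLaw)]
  rw [Measure.map_prod_map _ _ measurable_id hm, Measure.map_map _ (measurable_id.prodMap hm)]
  · congr 1
    funext p u
    cases u with
    | nil => rfl
    | cons j v =>
      simp only [combAt, φ, Function.comp_apply, Prod.map_fst, Prod.map_snd]
      split_ifs <;> rfl
  · refine measurable_pi_lambda _ fun u => ?_
    rcases φ u with i | i
    · exact (measurable_pi_apply i).comp measurable_fst
    · exact (measurable_pi_apply i).comp measurable_snd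

/-- A many-to-one formula. Marking a child under counting measure yields three independent unbiased
seeds, because the weight of degree `i + 1 + n` is the product of the weights of the degrees `i` and
`n`. -/
theorem lintegral_tsum_children {Φ : ℕ → Seed → ENNReal} (hΦ : ∀ i, Measurable (Φ i)) :
    ∫⁻ s, ∑' i, (if i < (s []).1 then Φ i s else 0) ∂seedLaw =
      ∫⁻ s₀, ∫⁻ s₁, ∫⁻ s₂, Φ (s₀ []).1 (comb s₀ s₁ s₂) ∂seedLaw ∂seedLaw ∂seedLaw := by
  have hd : Measurable fun s : Seed => (s []).1 := by fun_prop
  have hmeas : ∀ i, Measurable fun s : Seed => (if i < (s []).1 then Φ i s else 0) := fun i =>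
    Measurable.ite (measurableSet_lt measurable_const hd) (hΦ i) measurable_const
  have hw : ∀ i n, Measurable fun p : Seed × Seed × Seed =>
      Φ i (combAt i (withRoot n p.1) p.2.1 p.2.2) := fun i n =>
    (hΦ i).comp ((measurable_combAt i).comp
      (((measurable_withRoot n).comp measurable_fst).prodMk measurable_snd))
  have hw3 : ∀ i n, Measurable fun p : Seed × Seed =>
      ∫⁻ s₂, Φ i (combAt i (withRoot n p.1) p.2 s₂) ∂seedLaw := fun i n => by
    have : Measurable fun p : (Seed × Seed) × Seed =>
      Φ i (combAt i (withRoot n p.1.1) p.1.2 p.2) := (hw i n).comp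
        (by fun_prop : Measurable fun p : (Seed × Seed) × Seed => (p.1.1, p.1.2, p.2))
    exact this.lintegral_prod_right'
  have hw2 : ∀ i n, Measurable fun s₀ : Seed =>
      ∫⁻ s₁, ∫⁻ s₂, Φ i (combAt i (withRoot n s₀) s₁ s₂) ∂seedLaw ∂seedLaw := fun i n =>
    (hw3 i n).lintegral_prod_right'
  have hΨ : Measurable fun p : Seed × Seed × Seed => Φ (p.1 []).1 (comb p.1 p.2.1 p.2.2) := by
    have : Measurable fun q : Seed × ℕ => Φ q.2 q.1 := measurable_from_prod_countable_left hΦ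
    exact this.comp (measurable_comb.prodMk (hd.comp measurable_fst))
  -- the right-hand side
  have hR : ∫⁻ s₀, ∫⁻ s₁, ∫⁻ s₂, Φ (s₀ []).1 (comb s₀ s₁ s₂) ∂seedLaw ∂seedLaw ∂seedLaw =
      ∑' i, 2⁻¹ ^ (i + 1) * ∑' n, 2⁻¹ ^ (n + 1) * ∫⁻ s₀, ∫⁻ s₁, ∫⁻ s₂,
        Φ i (combAt i (withRoot (i + 1 + n) s₀) s₁ s₂) ∂seedLaw ∂seedLaw ∂seedLaw := by
    have hm3 : Measurable fun p : Seed × Seed =>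
        ∫⁻ s₂, Φ (p.1 []).1 (comb p.1 p.2 s₂) ∂seedLaw := by
      have : Measurable fun p : (Seed × Seed) × Seed =>
        Φ (p.1.1 []).1 (comb p.1.1 p.1.2 p.2) := hΨ.comp
          (by fun_prop : Measurable fun p : (Seed × Seed) × Seed => (p.1.1, p.1.2, p.2))
      exact this.lintegral_prod_right'
    rw [lintegral_seedLaw_eq_tsum hm3.lintegral_prod_right']
    refine tsum_congr fun i => ?_
    congr 1
    have : ∀ s₀ s₁ : Seed, ∫⁻ s₂, Φ (withRoot i s₀ []).1 (comb (withRoot i s₀) s₁ s₂) ∂seedLaw =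
        ∑' n, 2⁻¹ ^ (n + 1) * ∫⁻ s₂, Φ i (combAt i (withRoot (i + 1 + n) s₀) s₁ s₂) ∂seedLaw := by
      intro s₀ s₁
      rw [lintegral_seedLaw_eq_tsum]
      · simp only [comb_withRoot]; rfl
      · exact hΨ.comp (by fun_prop : Measurable fun s₂ : Seed => (withRoot i s₀, s₁, s₂))
    simp only [this]
    have h1 : ∀ s₀ : Seed, ∫⁻ s₁, ∑' n, 2⁻¹ ^ (n + 1) *
        ∫⁻ s₂, Φ i (combAt i (withRoot (i + 1 + n) s₀) s₁ s₂) ∂seedLaw ∂seedLaw =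
        ∑' n, 2⁻¹ ^ (n + 1) * ∫⁻ s₁, 
        ∫⁻ s₂, Φ i (combAt i (withRoot (i + 1 + n) s₀) s₁ s₂) ∂seedLaw ∂seedLaw := by
      intro s₀
      have hm : ∀ n, Measurable fun s₁ : Seed =>
        ∫⁻ s₂, Φ i (combAt i (withRoot (i + 1 + n) s₀) s₁ s₂) ∂seedLaw := fun n =>
        (hw3 i (i + 1 + n)).comp measurable_prodMk_left
      rw [lintegral_tsum fun n => ((hm n).const_mul _).aemeasurable]
      exact tsum_congr fun n => lintegral_const_mul _ (hm n)
    simp only [h1]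
    rw [lintegral_tsum fun n => ((hw2 i (i + 1 + n)).const_mul _).aemeasurable]
    exact tsum_congr fun n => lintegral_const_mul _ (hw2 _ _)
  rw [hR, lintegral_tsum fun i => (hmeas i).aemeasurable]
  refine tsum_congr fun i => ?_
  rw [lintegral_seedLaw_eq_tsum (hmeas i), ← ENNReal.tsum_mul_left]
  -- The `i`-th child exists only if the degree has the form `i + 1 + m`, where `m` counts the
  -- children after it.
  have hzero : ∀ n, n ∉ Set.range (fun m => i + 1 + m) →
      2⁻¹ ^ (n + 1) * ∫⁻ s, (if i < (withRoot n s []).1 then Φ i (withRoot n s) else 0) ∂seedLaw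
        = (0 : ENNReal) := by
    intro n hn
    have : ¬ i < n := fun h => hn ⟨n - (i + 1), by dsimp; omega⟩
    simp [withRoot, this]
  have hinj : Function.Injective (fun m => i + 1 + m) := fun _ _ h => by simpa using h
  rw [← hinj.tsum_eq
    (f := fun n => 2⁻¹ ^ (n + 1) *
      ∫⁻ s, (if i < (withRoot n s []).1 then Φ i (withRoot n s) else 0) ∂seedLaw)
    (fun n hn => by by_contra h; exact hn (hzero n h))]
  refine tsum_congr fun m => ?_
  have hs : ∀ s : Seed, (if i < (withRoot (i + 1 + m) s []).1 then Φ i (withRoot (i + 1 + m) s)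
      else 0) = Φ i (withRoot (i + 1 + m) s) := fun s => if_pos (by simp [withRoot]; omega)
  simp only [hs]
  have hW : Measurable fun s => Φ i (withRoot (i + 1 + m) s) :=
    (hΦ i).comp (measurable_withRoot _)
  rw [← map_combAt i, lintegral_map hW (measurable_combAt i), map_combAt i]
  have hcw : ∀ s₀ s₁ s₂ : Seed, withRoot (i + 1 + m) (combAt i s₀ s₁ s₂) =
      combAt i (withRoot (i + 1 + m) s₀) s₁ s₂ := by
    intro s₀ s₁ s₂
    funext u
    cases u <;> simp [combAt, withRoot]
  simp only [hcw]
  rw [lintegral_prod _ (hw i _).aemeasurable]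
  have : ∀ s₀ : Seed, ∫⁻ q : Seed × Seed, Φ i (combAt i (withRoot (i + 1 + m) s₀) q.1 q.2)
      ∂(seedLaw.prod seedLaw) = ∫⁻ s₁, ∫⁻ s₂,
      Φ i (combAt i (withRoot (i + 1 + m) s₀) s₁ s₂) ∂seedLaw ∂seedLaw := fun s₀ =>
    lintegral_prod _ ((hw i _).comp measurable_prodMk_left).aemeasurable
  simp only [this]
  -- The two geometric weights multiply to that of degree `i + 1 + m`.
  rw [← mul_assoc]
  congr 1
  rw [← pow_add]
  congr 1

namespace LTree

/-! ### Pieces at the root -/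

theorem lab_append_eq_none {T : LTree} {u : List ℕ} (h : T.lab u = none) (w : List ℕ) :
    T.lab (u ++ w) = none := by
  induction w using List.reverseRecOn with
  | nil => simpa using h
  | append_singleton w i ih =>
    by_contra hne
    have := T.parent_mem (u ++ w) i (by rw [List.append_assoc]; exact Option.isSome_iff_ne_none.2 hne)
    simp [ih] at this

theorem isSome_of_append {T : LTree} {u w : List ℕ} (h : (T.lab (u ++ w)).isSome) :
    (T.lab u).isSome := by
  by_contra hn
  rw [lab_append_eq_none (by simpa using hn)] at h
  simp at h

theorem lt_deg_iff {T : LTree} {u : List ℕ} {i : ℕ} :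
    i < T.deg u ↔ (T.lab (u ++ [i])).isSome := by
  classical
  rw [deg, Nat.lt_find_iff]
  refine ⟨fun h => Option.isSome_iff_ne_none.2 (h i le_rfl), fun h m hm hn => ?_⟩
  rcases hm.eq_or_lt with rfl | hm
  · simp [hn] at h
  · simpa [hn] using T.sibling_mem u i m hm h

theorem lab_append_cons_eq_none {T : LTree} {u : List ℕ} {i : ℕ} (h : T.deg u ≤ i) (w : List ℕ) :
    T.lab (u ++ i :: w) = none := by
  have h1 : T.lab (u ++ [i]) = none := by
    have := mt lt_deg_iff.2 (not_lt.2 h)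
    simpa using this
  simpa using lab_append_eq_none h1 w

theorem lab_cons_eq_none {T : LTree} {i : ℕ} (h : T.deg [] ≤ i) (w : List ℕ) :
    T.lab (i :: w) = none := lab_append_cons_eq_none (u := []) h w

theorem deg_eq_of {T : LTree} {u : List ℕ} {n : ℕ} (h : ∀ i, (T.lab (u ++ [i])).isSome ↔ i < n) :
    T.deg u = n := by
  have h' : ∀ i, i < T.deg u ↔ i < n := fun i => lt_deg_iff.trans (h i)
  have h1 := h' n
  have h2 := h' (T.deg u)
  omega

theorem some_label {T : LTree} {u : List ℕ} (h : (T.lab u).isSome) :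
    some (T.label u) = T.lab u := by
  obtain ⟨p, hp⟩ := Option.isSome_iff_exists.1 h
  simp [label, hp]

/-- The tree made of the root and of its first `i` children with their descendants. -/
def leftPiece (T : LTree) (i : ℕ) : LTree := T.piece [] 0 i

/-- The tree of the descendants of the `i`-th child of the root. -/
def childTree (T : LTree) (i : ℕ) : LTree := T.piece [i] 0 (T.deg [i])

/-- The tree made of the root and of its children after the `i`-th one with their descendants. -/
def rightPiece (T : LTree) (i : ℕ) : LTree := T.piece [] (i + 1) (T.deg [])

@[simp] theorem leftPiece_lab_nil (T : LTree) (i : ℕ) : (T.leftPiece i).lab [] = T.lab [] :=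
  some_label T.root_mem

@[simp] theorem leftPiece_lab_cons (T : LTree) (i j : ℕ) (w : List ℕ) :
    (T.leftPiece i).lab (j :: w) = if j < i then T.lab (j :: w) else none := by
  simp [leftPiece, piece, pieceLab]

@[simp] theorem rightPiece_lab_nil (T : LTree) (i : ℕ) : (T.rightPiece i).lab [] = T.lab [] :=
  some_label T.root_mem

@[simp] theorem rightPiece_lab_cons (T : LTree) (i j : ℕ) (w : List ℕ) :
    (T.rightPiece i).lab (j :: w) = T.lab ((i + 1 + j) :: w) := by
  simp only [rightPiece, piece, pieceLab, List.nil_append]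
  split_ifs with h
  · rfl
  · rw [lab_cons_eq_none (by omega)]

@[simp] theorem childTree_lab_cons (T : LTree) (i j : ℕ) (w : List ℕ) :
    (T.childTree i).lab (j :: w) = T.lab (i :: j :: w) := by
  simp only [childTree, piece, pieceLab]
  split_ifs with h
  · simp
  · rw [show i :: j :: w = [i] ++ j :: w from rfl, lab_append_cons_eq_none (by omega)]

/-- The bound on `i` matters only at the root of the piece, which exists, with default label `0`,
even when the child is absent. -/
theorem childTree_lab {T : LTree} {i : ℕ} (h : i < T.deg []) (w : List ℕ) :
    (T.childTree i).lab w = T.lab (i :: w) := by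
  cases w with
  | nil => exact some_label (lt_deg_iff.1 h)
  | cons j w => simp

@[simp] theorem leftPiece_label_nil (T : LTree) (i : ℕ) : (T.leftPiece i).label [] = T.label [] := by
  simp [label]

@[simp] theorem rightPiece_label_nil (T : LTree) (i : ℕ) :
    (T.rightPiece i).label [] = T.label [] := by
  simp [label]

/-! ### Measurability -/

theorem measurableSet_setOf_lab (u : List ℕ) (p : Option ℤ → Prop) :
    MeasurableSet {T : LTree | p (T.lab u)} := by
  have : {T : LTree | p (T.lab u)} = ⋃ o ∈ {o | p o}, {T : LTree | T.lab u = o} := by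
    ext T; simp
  rw [this]
  exact MeasurableSet.biUnion (Set.to_countable _) fun o _ => measurableSet_lab u o

theorem measurable_leftPiece (i : ℕ) : Measurable fun T : LTree => T.leftPiece i := by
  refine measurable_of_lab fun u o => ?_
  cases u with
  | nil => simpa using measurableSet_lab [] o
  | cons j w =>
    simp only [leftPiece_lab_cons]
    split_ifs
    · exact measurableSet_lab _ o
    · simp

theorem measurable_rightPiece (i : ℕ) : Measurable fun T : LTree => T.rightPiece i := by
  refine measurable_of_lab fun u o => ?_
  cases u with
  | nil => simpa using measurableSet_lab [] o
  | cons j w => simpa using measurableSet_lab _ o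

theorem measurable_childTree (i : ℕ) : Measurable fun T : LTree => T.childTree i := by
  refine measurable_of_lab fun u o => ?_
  cases u with
  | nil => exact measurableSet_setOf_lab [i] fun q => some (q.getD 0) = o
  | cons j w => simpa using measurableSet_lab _ o

theorem measurableSet_lt_deg (u : List ℕ) (i : ℕ) : MeasurableSet {T : LTree | i < T.deg u} := by
  simp only [lt_deg_iff]
  exact measurableSet_setOf_lab _ fun o => o.isSome

/-! ### Splitting a tree at a child of the root -/

/-- The `i`-th child of the root splits the tree into three pieces belonging to `A`, `B`, `C`. -/
def SplitsAt (A B C : Set LTree) (i : ℕ) : Set LTree :=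
  {T | T.leftPiece i ∈ A ∧ T.childTree i ∈ B ∧ T.rightPiece i ∈ C}

/-- Some child of the root splits the tree into three pieces belonging to `A`, `B`, `C`. -/
def split (A B C : Set LTree) : Set LTree := {T | ∃ i < T.deg [], T ∈ SplitsAt A B C i}

/-- At most one child of the root splits a tree into three pieces belonging to `A`, `B`, `C`. -/
def UniqueSplit (A B C : Set LTree) : Prop :=
  ∀ T : LTree, ∀ i j, i < j → j < T.deg [] → T ∈ SplitsAt A B C i → T ∉ SplitsAt A B C j

theorem measurableSet_splitsAt {A B C : Set LTree} (hA : MeasurableSet A) (hB : MeasurableSet B)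
    (hC : MeasurableSet C) (i : ℕ) : MeasurableSet (SplitsAt A B C i) :=
  (measurable_leftPiece i hA).inter ((measurable_childTree i hB).inter (measurable_rightPiece i hC))

theorem measurableSet_split {A B C : Set LTree} (hA : MeasurableSet A) (hB : MeasurableSet B)
    (hC : MeasurableSet C) : MeasurableSet (split A B C) := by
  have : split A B C = ⋃ i, {T : LTree | i < T.deg []} ∩ SplitsAt A B C i := by
    ext T; simp [split]
  rw [this]
  exact MeasurableSet.iUnion fun i =>
    (measurableSet_lt_deg [] i).inter (measurableSet_splitsAt hA hB hC i)

/-- Uniqueness turns the existence of a splitting child into a sum over children, the form required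
by `lintegral_tsum_children`. -/
theorem indicator_split {A B C : Set LTree} (h : UniqueSplit A B C) (T : LTree) :
    (split A B C).indicator (1 : LTree → ENNReal) T =
      ∑' i, if i < T.deg [] then (SplitsAt A B C i).indicator 1 T else 0 := by
  by_cases hT : T ∈ split A B C
  · obtain ⟨i, hi, hs⟩ := hT
    rw [Set.indicator_of_mem (show T ∈ split A B C from ⟨i, hi, hs⟩), tsum_eq_single i]
    · simp [hi, hs]
    · intro j hj
      split_ifs with hjd
      · refine Set.indicator_of_notMem (fun hs' => ?_) _
        rcases lt_or_gt_of_ne hj with hlt | hlt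
        · exact h T j i hlt hi hs' hs
        · exact h T i j hlt hjd hs hs'
      · rfl
  · rw [Set.indicator_of_notMem hT, eq_comm, ENNReal.tsum_eq_zero]
    intro i
    split_ifs with hi
    · exact Set.indicator_of_notMem (fun hs => hT ⟨i, hi, hs⟩) _
    · rfl

theorem indicator_splitsAt (A B C : Set LTree) (i : ℕ) (T : LTree) :
    (SplitsAt A B C i).indicator (1 : LTree → ENNReal) T = A.indicator 1 (T.leftPiece i) *
      (B.indicator 1 (T.childTree i) * C.indicator 1 (T.rightPiece i)) := by
  by_cases h1 : T.leftPiece i ∈ A <;> by_cases h2 : T.childTree i ∈ B <;>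
    by_cases h3 : T.rightPiece i ∈ C <;> simp [SplitsAt, h1, h2, h3]

end LTree

open LTree

/-! ### Galton-Watson trees -/

@[simp] theorem gwTree_lab (x : ℤ) (s : Seed) : (gwTree x s).lab = gwLab s x := rfl

@[simp] theorem deg_gwTree (x : ℤ) (s : Seed) : (gwTree x s).deg [] = (s []).1 :=
  deg_eq_of fun i => by by_cases h : i < (s []).1 <;> simp [gwLab, h]

theorem gwLab_shift (u : List ℕ) : ∀ (s : Seed) (x y : ℤ),
    gwLab s (y + x) u = (gwLab s y u).map (· + x) := by
  induction u with
  | nil => intro s x y; simp [gwLab]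
  | cons i u ih =>
    intro s x y
    simp only [gwLab]
    split_ifs
    · rw [add_right_comm, ih]
    · rfl

theorem gwTree_leftPiece (x : ℤ) (s₀ s₁ s₂ : Seed) :
    (gwTree x (comb s₀ s₁ s₂)).leftPiece (s₀ []).1 = gwTree x s₀ := by
  ext1
  funext u
  rcases u with _ | ⟨j, w⟩
  · simp [gwLab]
  · simp only [leftPiece_lab_cons, gwTree_lab, gwLab]
    split_ifs with h1 h2
    · simp [comb, h1]
    · simp only [comb] at h2; omega
    · rfl

/-- The increment of an edge is stored at its child end, here the root of `s₁`. -/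
theorem gwTree_childTree (x : ℤ) (s₀ s₁ s₂ : Seed) :
    (gwTree x (comb s₀ s₁ s₂)).childTree (s₀ []).1 = gwTree (x + step (s₁ []).2) s₁ := by
  have h : (s₀ []).1 < (gwTree x (comb s₀ s₁ s₂)).deg [] := by simp [comb]; omega
  ext1
  funext u
  rw [childTree_lab h]
  rw [deg_gwTree] at h
  simp only [gwTree_lab, gwLab, if_pos h]
  simp [comb]

theorem gwTree_rightPiece (x : ℤ) (s₀ s₁ s₂ : Seed) :
    (gwTree x (comb s₀ s₁ s₂)).rightPiece (s₀ []).1 = gwTree x s₂ := by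
  ext1
  funext u
  rcases u with _ | ⟨j, w⟩
  · simp [gwLab]
  · have h1 : ¬ (s₀ []).1 + 1 + j < (s₀ []).1 := by omega
    have h2 : (s₀ []).1 + 1 + j ≠ (s₀ []).1 := by omega
    have h3 : (s₀ []).1 + 1 + j - (s₀ []).1 - 1 = j := by omega
    simp [gwLab, comb, h1, h2, h3]

theorem measurable_gwTree_step : Measurable fun p : ℤ × Seed => gwTree p.1 p.2 :=
  measurable_from_prod_countable_right fun x => measurable_gwTree x

theorem gw_eq_lintegral (x : ℤ) {S : Set LTree} (hS : MeasurableSet S) :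
    gw x S = ∫⁻ s, S.indicator 1 (gwTree x s) ∂seedLaw := by
  rw [gw, ← lintegral_indicator_one hS, lintegral_map (measurable_one.indicator hS)
    (measurable_gwTree x)]

theorem lintegral_unif3 (f : Fin 3 → ENNReal) : ∫⁻ e, f e ∂unif3 = 3⁻¹ * ∑ e, f e := by
  rw [lintegral_fintype, Finset.mul_sum]
  refine Finset.sum_congr rfl fun e _ => ?_
  rw [unif3, PMF.toMeasure_apply_singleton _ _ (measurableSet_singleton e)]
  simp [mul_comm]

/-- A tree does not read the increment stored at the root of its own seed. This increment is thus a
uniform step independent of the tree, and can be averaged separately. -/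
theorem lintegral_gwTree_step (x : ℤ) {S : Set LTree} (hS : MeasurableSet S) :
    ∫⁻ s, S.indicator 1 (gwTree (x + step (s []).2) s) ∂seedLaw =
      3⁻¹ * ∑ e, gw (x + step e) S := by
  have hst : Measurable step := measurable_of_finite _
  have hm : Measurable fun s : Seed => gwTree (x + step (s []).2) s :=
    measurable_gwTree_step.comp ((measurable_const.add (hst.comp (by fun_prop))).prodMk measurable_id)
  have hind : Measurable (S.indicator (1 : LTree → ENNReal)) := measurable_one.indicator hS
  have hT : ∀ (s : Seed) (m : ℕ) (e e' : Fin 3), gwTree (x + step e) (Function.update s [] (m, e)) =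
      gwTree (x + step e) (Function.update s [] (m, e')) := by
    intro s m e e'
    ext1
    funext u
    cases u <;> simp [gwLab]
  have h : ∀ e, gw (x + step e) S = ∫⁻ m, ∫⁻ s, S.indicator 1
      (gwTree (x + step e) (Function.update s [] (m, e))) ∂seedLaw ∂geomHalf := by
    intro e
    rw [gw_eq_lintegral _ hS]
    refine (lintegral_seedLaw_update (hind.comp (measurable_gwTree _))).trans ?_
    refine lintegral_congr fun m => ?_
    simp only [Function.comp_apply]
    rw [lintegral_unif3]
    have : ∀ e' : Fin 3, ∫⁻ s : Seed, S.indicator (1 : LTree → ENNReal)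
        (gwTree (x + step e) (Function.update s [] (m, e'))) ∂seedLaw =
        ∫⁻ s : Seed, S.indicator 1 (gwTree (x + step e) (Function.update s [] (m, e))) ∂seedLaw :=
      fun e' => lintegral_congr fun s => by rw [hT s m e e']
    simp only [this]
    rw [Finset.sum_const, Finset.card_univ, Fintype.card_fin, nsmul_eq_mul, ← mul_assoc]
    norm_num
    rw [ENNReal.inv_mul_cancel (by norm_num) (by norm_num), one_mul]
  refine (lintegral_seedLaw_update (hind.comp hm)).trans ?_
  simp only [h, Function.comp_apply, Function.update_self]
  rw [← lintegral_finsetSum', ← lintegral_const_mul']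
  · exact lintegral_congr fun m => lintegral_unif3 _
  · norm_num
  · exact fun e _ => (measurable_of_countable _).aemeasurable

/-- The product formula for Galton–Watson trees: under `comb`, the three pieces are generated by the
three independent seeds. -/
theorem gw_split {A B C : Set LTree} (hA : MeasurableSet A) (hB : MeasurableSet B)
    (hC : MeasurableSet C) (h : UniqueSplit A B C) (x : ℤ) :
    gw x (split A B C) = gw x A * (3⁻¹ * ∑ e, gw (x + step e) B) * gw x C := by
  rw [gw_eq_lintegral x (measurableSet_split hA hB hC)]
  simp only [indicator_split h, deg_gwTree]
  rw [lintegral_tsum_children (Φ := fun i s => (SplitsAt A B C i).indicator 1 (gwTree x s))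
    fun i => (measurable_one.indicator (measurableSet_splitsAt hA hB hC i)).comp
      (measurable_gwTree x)]
  simp only [indicator_splitsAt, gwTree_leftPiece, gwTree_childTree, gwTree_rightPiece]
  have hi : ∀ (S : Set LTree) T, S.indicator (1 : LTree → ENNReal) T ≠ ⊤ := fun S T =>
    ne_top_of_le_ne_top ENNReal.one_ne_top (Set.indicator_le_self' (by simp) T)
  have h1 : ∀ s₀ s₁ : Seed, ∫⁻ s₂, A.indicator (1 : LTree → ENNReal) (gwTree x s₀) *
      (B.indicator 1 (gwTree (x + step (s₁ []).2) s₁) * C.indicator 1 (gwTree x s₂)) ∂seedLaw =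
      A.indicator 1 (gwTree x s₀) * (B.indicator 1 (gwTree (x + step (s₁ []).2) s₁) *
        gw x C) := by
    intro s₀ s₁
    rw [lintegral_const_mul' _ _ (hi _ _), lintegral_const_mul' _ _ (hi _ _),
      ← gw_eq_lintegral x hC]
  simp only [h1]
  have h2 : ∀ s₀ : Seed, ∫⁻ s₁, A.indicator (1 : LTree → ENNReal) (gwTree x s₀) *
      (B.indicator 1 (gwTree (x + step (s₁ []).2) s₁) * gw x C) ∂seedLaw =
      A.indicator 1 (gwTree x s₀) * ((3⁻¹ * ∑ e, gw (x + step e) B) * gw x C) := by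
    intro s₀
    rw [lintegral_const_mul' _ _ (hi _ _), lintegral_mul_const' _ _ (measure_ne_top _ _),
      lintegral_gwTree_step x hB]
  simp only [h2]
  have h3 : (3⁻¹ * ∑ e, gw (x + step e) B) * gw x C ≠ ⊤ :=
    ENNReal.mul_ne_top (ENNReal.mul_ne_top (by norm_num)
      (ENNReal.sum_ne_top.2 fun e _ => measure_ne_top _ _)) (measure_ne_top _ _)
  rw [lintegral_mul_const' _ _ h3, ← gw_eq_lintegral x hA]
  ring

/-! ### The uniform infinite tree -/

/-- The law of the uniform infinite labeled tree, with root-label `x`. -/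
noncomputable def uit (x : ℤ) : Measure LTree := uniformInfiniteTree.map (LTree.shift x)

instance (x : ℤ) : IsProbabilityMeasure (uit x) :=
  Measure.isProbabilityMeasure_map (measurable_shift x).aemeasurable

/-- The labeled tree with one spine and root-label `x` generated by the randomness `s`. -/
def spineTreeFrom (x : ℤ) (s : SpineSeed) : LTree where
  lab := spineLab s x
  root_mem := by simp [spineLab]
  parent_mem u i := spineLab_parent u s x i
  sibling_mem u i j := spineLab_sibling u s x i j
  locally_finite u := spineLab_finite u s x
  well_labeled u i p q := spineLab_close u s x i p q

@[simp] theorem spineTreeFrom_lab (x : ℤ) (s : SpineSeed) :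
    (spineTreeFrom x s).lab = spineLab s x := rfl

theorem measurable_spineTreeFrom (x : ℤ) : Measurable (spineTreeFrom x) :=
  measurable_of_lab fun u o => measurableSet_spineLab u x o

theorem spineLab_shift (u : List ℕ) : ∀ (s : SpineSeed) (x y : ℤ),
    spineLab s (y + x) u = (spineLab s y u).map (· + x) := by
  induction u with
  | nil => intro s x y; simp [spineLab]
  | cons i u ih =>
    intro s x y
    simp only [spineLab]
    split_ifs
    · exact gwLab_shift _ _ _ _
    · rw [add_right_comm, ih]
    · exact gwLab_shift _ _ _ _

theorem shift_spineTree (x : ℤ) (s : SpineSeed) : (spineTree s).shift x = spineTreeFrom x s := by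
  ext1
  funext u
  have := spineLab_shift u s x 0
  rw [zero_add] at this
  exact this.symm

theorem shift_gwTree (x y : ℤ) (s : Seed) : (gwTree y s).shift x = gwTree (y + x) s := by
  ext1
  funext u
  exact (gwLab_shift u s x y).symm

theorem gw_map_shift (x y : ℤ) : (gw y).map (LTree.shift x) = gw (y + x) := by
  rw [gw, Measure.map_map (measurable_shift x) (measurable_gwTree y), gw]
  congr 1
  funext s
  exact shift_gwTree x y s

theorem uit_eq_map (x : ℤ) : uit x = spineSeedLaw.map (spineTreeFrom x) := by
  rw [uit, uniformInfiniteTree, Measure.map_map (measurable_shift x) measurable_spineTree]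
  congr 1
  funext s
  exact shift_spineTree x s

theorem uit_eq_lintegral (x : ℤ) {S : Set LTree} (hS : MeasurableSet S) :
    uit x S = ∫⁻ s, S.indicator 1 (spineTreeFrom x s) ∂spineSeedLaw := by
  rw [uit_eq_map, ← lintegral_indicator_one hS, lintegral_map (measurable_one.indicator hS)
    (measurable_spineTreeFrom x)]

/-- Adding one spine vertex at the root. -/
def consSpine (q : Fin 3 × Seed × Seed) (s : SpineSeed) : SpineSeed
  | 0 => q
  | n + 1 => s n

theorem measurable_consSpine :
    Measurable fun p : (Fin 3 × Seed × Seed) × SpineSeed => consSpine p.1 p.2 := by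
  refine measurable_pi_lambda _ fun n => ?_
  cases n with
  | zero => exact measurable_fst
  | succ n => exact (measurable_pi_apply n).comp measurable_snd

/-- The first spine vertex is separated from the rest of the spine, which has the same law. -/
theorem lintegral_spineSeedLaw {f : SpineSeed → ENNReal} (hf : Measurable f) :
    ∫⁻ s, f s ∂spineSeedLaw =
      ∫⁻ q, ∫⁻ s, f (consSpine q s) ∂spineSeedLaw ∂(unif3.prod (seedLaw.prod seedLaw)) := by
  let φ : ℕ → ℕ ⊕ ℕ
    | 0 => Sum.inl 0
    | n + 1 => Sum.inr n
  have hφ : Function.Injective φ := by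
    intro u v h
    cases u <;> cases v <;> simp_all [φ]
  have key : (spineSeedLaw.prod spineSeedLaw).map (fun p i => Sum.elim p.1 p.2 (φ i)) =
      spineSeedLaw := infinitePi_prod_map_reindex _ hφ
  have hfun : (fun (p : SpineSeed × SpineSeed) (i : ℕ) => Sum.elim p.1 p.2 (φ i)) =
      fun p => consSpine (p.1 0) p.2 := by
    funext p u
    cases u <;> rfl
  have hm' : Measurable (fun p : SpineSeed × SpineSeed => consSpine (p.1 0) p.2) :=
    measurable_consSpine.comp (by fun_prop : Measurable fun p : SpineSeed × SpineSeed => (p.1 0, p.2))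
  have hev : spineSeedLaw.map (fun s : SpineSeed => s 0) = unif3.prod (seedLaw.prod seedLaw) :=
    Measure.infinitePi_map_eval _ 0
  rw [hfun] at key
  conv_lhs => rw [← key]
  rw [lintegral_map hf hm']
  refine (lintegral_prod _ (hf.comp hm').aemeasurable).trans ?_
  rw [← hev]
  exact (lintegral_map (f := fun q => ∫⁻ s, f (consSpine q s) ∂spineSeedLaw)
    (hf.comp measurable_consSpine).lintegral_prod_right' (measurable_pi_apply 0)).symm

/-- The seed of the left subtree is integrated first, so that `lintegral_tsum_children` can be
applied to it with everything else frozen. The version `lintegral_spineSeedLaw_right` plays the same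
role for a marked child on the right of the spine. -/
theorem lintegral_spineSeedLaw_left {f : SpineSeed → ENNReal} (hf : Measurable f) :
    ∫⁻ s, f s ∂spineSeedLaw = ∫⁻ e, ∫⁻ r, ∫⁻ s, ∫⁻ l, f (consSpine (e, l, r) s)
      ∂seedLaw ∂spineSeedLaw ∂seedLaw ∂unif3 := by
  have hm := hf.comp measurable_consSpine
  rw [lintegral_spineSeedLaw hf]
  refine (lintegral_prod _ hm.lintegral_prod_right'.aemeasurable).trans (lintegral_congr fun e => ?_)
  have hm2 : Measurable fun q : (Seed × Seed) × SpineSeed => f (consSpine (e, q.1) q.2) :=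
    hm.comp (by fun_prop : Measurable fun q : (Seed × Seed) × SpineSeed => ((e, q.1), q.2))
  have hm3 : Measurable fun q : Seed × Seed => ∫⁻ s, f (consSpine (e, q) s) ∂spineSeedLaw :=
    hm2.lintegral_prod_right'
  refine (lintegral_prod_symm _ hm3.aemeasurable).trans (lintegral_congr fun r => ?_)
  refine lintegral_lintegral_swap (f := fun l s => f (consSpine (e, l, r) s)) ?_
  exact (hm2.comp (by fun_prop : Measurable fun q : Seed × SpineSeed => ((q.1, r), q.2))).aemeasurable

theorem lintegral_spineSeedLaw_right {f : SpineSeed → ENNReal} (hf : Measurable f) :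
    ∫⁻ s, f s ∂spineSeedLaw = ∫⁻ e, ∫⁻ l, ∫⁻ s, ∫⁻ r, f (consSpine (e, l, r) s)
      ∂seedLaw ∂spineSeedLaw ∂seedLaw ∂unif3 := by
  have hm := hf.comp measurable_consSpine
  rw [lintegral_spineSeedLaw hf]
  refine (lintegral_prod _ hm.lintegral_prod_right'.aemeasurable).trans (lintegral_congr fun e => ?_)
  have hm2 : Measurable fun q : (Seed × Seed) × SpineSeed => f (consSpine (e, q.1) q.2) :=
    hm.comp (by fun_prop : Measurable fun q : (Seed × Seed) × SpineSeed => ((e, q.1), q.2))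
  have hm3 : Measurable fun q : Seed × Seed => ∫⁻ s, f (consSpine (e, q) s) ∂spineSeedLaw :=
    hm2.lintegral_prod_right'
  refine (lintegral_prod _ hm3.aemeasurable).trans (lintegral_congr fun l => ?_)
  refine lintegral_lintegral_swap (f := fun r s => f (consSpine (e, l, r) s)) ?_
  exact (hm2.comp (by fun_prop : Measurable fun q : Seed × SpineSeed => ((l, q.1), q.2))).aemeasurable

theorem spineLab_consSpine (x : ℤ) (e : Fin 3) (l r : Seed) (s : SpineSeed) (i : ℕ) (u : List ℕ) :
    spineLab (consSpine (e, l, r) s) x (i :: u) =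
      if i < (l []).1 then gwLab l x (i :: u)
      else if i = (l []).1 then spineLab s (x + step e) u
      else gwLab r x ((i - (l []).1 - 1) :: u) := rfl

section Pieces

variable (x : ℤ) (e : Fin 3) (l r s₀ s₁ s₂ : Seed) (s : SpineSeed)

@[simp] theorem deg_spineTreeFrom (s : SpineSeed) :
    (spineTreeFrom x s).deg [] = ((s 0).2.1 []).1 + 1 + ((s 0).2.2 []).1 := by
  refine deg_eq_of fun i => ?_
  simp only [List.nil_append, spineTreeFrom_lab, spineLab, gwLab]
  split_ifs <;> simp <;> omega

theorem spineTreeFrom_leftPiece_spine :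
    (spineTreeFrom x (consSpine (e, l, r) s)).leftPiece (l []).1 = gwTree x l := by
  ext1
  funext u
  rcases u with _ | ⟨j, w⟩
  · simp [gwLab, spineLab]
  · simp only [leftPiece_lab_cons, spineTreeFrom_lab, gwTree_lab, spineLab_consSpine]
    by_cases h : j < (l []).1 <;> simp [gwLab, h]

theorem spineTreeFrom_childTree_spine :
    (spineTreeFrom x (consSpine (e, l, r) s)).childTree (l []).1 =
      spineTreeFrom (x + step e) s := by
  ext1
  funext u
  rw [childTree_lab (by simp [consSpine]; omega)]
  simp [spineLab, consSpine]

theorem spineTreeFrom_rightPiece_spine :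
    (spineTreeFrom x (consSpine (e, l, r) s)).rightPiece (l []).1 = gwTree x r := by
  ext1
  funext u
  rcases u with _ | ⟨j, w⟩
  · simp [gwLab, spineLab]
  · have h1 : ¬ (l []).1 + 1 + j < (l []).1 := by omega
    have h2 : (l []).1 + 1 + j ≠ (l []).1 := by omega
    have h3 : (l []).1 + 1 + j - (l []).1 - 1 = j := by omega
    simp [spineLab, consSpine, h1, h2, h3]

theorem spineTreeFrom_leftPiece_left :
    (spineTreeFrom x (consSpine (e, comb s₀ s₁ s₂, r) s)).leftPiece (s₀ []).1 = gwTree x s₀ := by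
  ext1
  funext u
  rcases u with _ | ⟨j, w⟩
  · simp [gwLab, spineLab]
  · simp only [leftPiece_lab_cons, spineTreeFrom_lab, gwTree_lab, spineLab, gwLab, consSpine, comb]
    split_ifs with h1 h2 h3
    · simp
    all_goals first | rfl | omega

theorem spineTreeFrom_childTree_left :
    (spineTreeFrom x (consSpine (e, comb s₀ s₁ s₂, r) s)).childTree (s₀ []).1 =
      gwTree (x + step (s₁ []).2) s₁ := by
  ext1
  funext u
  rw [childTree_lab (by simp [consSpine, comb]; omega)]
  have h : (s₀ []).1 < (s₀ []).1 + 1 + (s₂ []).1 := by omega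
  simp [spineLab, gwLab, consSpine, comb, h]

/-- A child marked on the left of the spine leaves the spine in the right piece, with `s₂` as the
new left seed. -/
theorem spineTreeFrom_rightPiece_left :
    (spineTreeFrom x (consSpine (e, comb s₀ s₁ s₂, r) s)).rightPiece (s₀ []).1 =
      spineTreeFrom x (consSpine (e, s₂, r) s) := by
  ext1
  funext u
  rcases u with _ | ⟨j, w⟩
  · simp [spineLab]
  · have h1 : ¬ (s₀ []).1 + 1 + j < (s₀ []).1 := by omega
    have h2 : (s₀ []).1 + 1 + j ≠ (s₀ []).1 := by omega
    have h3 : (s₀ []).1 + 1 + j - (s₀ []).1 - 1 = j := by omega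
    have h4 : (s₀ []).1 + 1 + j - ((s₀ []).1 + 1 + (s₂ []).1) - 1 = j - (s₂ []).1 - 1 := by omega
    simp only [rightPiece_lab_cons, spineTreeFrom_lab, spineLab_consSpine]
    by_cases h5 : j < (s₂ []).1
    · simp [gwLab, comb, h1, h2, h3, h5]
    by_cases h6 : j = (s₂ []).1
    · simp [comb, h6]
    · simp [comb, h4, h5, h6]

/-- Before the marked child come the left children, the spine child and the children of `s₀`, whence
its rank. The spine stays in the left piece. -/
theorem spineTreeFrom_leftPiece_right :
    (spineTreeFrom x (consSpine (e, l, comb s₀ s₁ s₂) s)).leftPiece ((l []).1 + 1 + (s₀ []).1) =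
      spineTreeFrom x (consSpine (e, l, s₀) s) := by
  ext1
  funext u
  rcases u with _ | ⟨j, w⟩
  · simp [spineLab]
  · simp only [leftPiece_lab_cons, spineTreeFrom_lab, spineLab_consSpine]
    by_cases h1 : j < (l []).1
    · rw [if_pos (by omega), if_pos h1, if_pos h1]
    by_cases h2 : j = (l []).1
    · rw [if_pos (by omega), if_neg h1, if_pos h2, if_neg h1, if_pos h2]
    rw [if_neg h1, if_neg h2, if_neg h1, if_neg h2]
    simp only [gwLab, comb]
    by_cases h3 : j - (l []).1 - 1 < (s₀ []).1
    · have h4 : j - (l []).1 - 1 < (s₀ []).1 + 1 + (s₂ []).1 := by omega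
      rw [if_pos (by omega), if_pos (by omega), if_pos h3]
      simp [h3, h4]
    · rw [if_neg (by omega), if_neg h3]

theorem spineTreeFrom_childTree_right :
    (spineTreeFrom x (consSpine (e, l, comb s₀ s₁ s₂) s)).childTree ((l []).1 + 1 + (s₀ []).1) =
      gwTree (x + step (s₁ []).2) s₁ := by
  ext1
  funext u
  rw [childTree_lab (by simp [consSpine, comb]; omega)]
  have h1 : ¬ (l []).1 + 1 + (s₀ []).1 < (l []).1 := by omega
  have h2 : (l []).1 + 1 + (s₀ []).1 ≠ (l []).1 := by omega
  have h3 : (l []).1 + 1 + (s₀ []).1 - (l []).1 - 1 = (s₀ []).1 := by omega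
  have h4 : (s₀ []).1 < (s₀ []).1 + 1 + (s₂ []).1 := by omega
  simp [spineLab, gwLab, consSpine, comb, h1, h2, h3, h4]

theorem spineTreeFrom_rightPiece_right :
    (spineTreeFrom x (consSpine (e, l, comb s₀ s₁ s₂) s)).rightPiece ((l []).1 + 1 + (s₀ []).1) =
      gwTree x s₂ := by
  ext1
  funext u
  rcases u with _ | ⟨j, w⟩
  · simp [spineLab, gwLab]
  · have h1 : ¬ (l []).1 + 1 + (s₀ []).1 + 1 + j < (l []).1 := by omega
    have h2 : (l []).1 + 1 + (s₀ []).1 + 1 + j ≠ (l []).1 := by omega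
    have h3 : (l []).1 + 1 + (s₀ []).1 + 1 + j - (l []).1 - 1 = (s₀ []).1 + 1 + j := by omega
    have h5 : ¬ (s₀ []).1 + 1 + j < (s₀ []).1 := by omega
    have h6 : (s₀ []).1 + 1 + j ≠ (s₀ []).1 := by omega
    have h7 : (s₀ []).1 + 1 + j - (s₀ []).1 - 1 = j := by omega
    simp [spineLab, gwLab, consSpine, comb, h1, h2, h3, h5, h6, h7]

end Pieces

/-! ### The Leibniz rule for the infinite tree -/

theorem tsum_ite_lt_add (f : ℕ → ENNReal) (n m : ℕ) :
    ∑' i, (if i < n + 1 + m then f i else 0) =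
      ∑' i, (if i < n then f i else 0) + f n + ∑' j, (if j < m then f (n + 1 + j) else 0) := by
  have h : ∀ (k : ℕ) (g : ℕ → ENNReal), ∑' i, (if i < k then g i else 0) =
      ∑ i ∈ Finset.range k, g i := by
    intro k g
    rw [tsum_eq_sum (s := Finset.range k) fun i hi => if_neg (by simpa using hi)]
    exact Finset.sum_congr rfl fun i hi => if_pos (by simpa using hi)
  rw [h, h, h, Finset.sum_range_add, Finset.sum_range_succ]

theorem indicator_one_ne_top (S : Set LTree) (T : LTree) :
    S.indicator (1 : LTree → ENNReal) T ≠ ⊤ :=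
  ne_top_of_le_ne_top ENNReal.one_ne_top (Set.indicator_le_self' (by simp) T)

/-- The factor `h` stands for the piece carrying the spine. Finiteness allows constants to be pulled
out of the integrals without measurability conditions. -/
theorem lintegral_mul_mul_seedLaw {A B : Set LTree} (hA : MeasurableSet A) (hB : MeasurableSet B)
    (x : ℤ) {h : Seed → ENNReal} (hh : ∫⁻ s, h s ∂seedLaw ≠ ⊤) :
    ∫⁻ s₀, ∫⁻ s₁, ∫⁻ s₂, A.indicator 1 (gwTree x s₀) *
      (B.indicator 1 (gwTree (x + step (s₁ []).2) s₁) * h s₂) ∂seedLaw ∂seedLaw ∂seedLaw =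
    gw x A * (3⁻¹ * ∑ e, gw (x + step e) B) * ∫⁻ s, h s ∂seedLaw := by
  have hB' : 3⁻¹ * ∑ e, gw (x + step e) B ≠ ⊤ := ENNReal.mul_ne_top (by norm_num)
      (ENNReal.sum_ne_top.2 fun e _ => measure_ne_top _ _)
  simp only [lintegral_const_mul' _ _ (indicator_one_ne_top _ _), lintegral_mul_const' _ _ hh,
    lintegral_gwTree_step x hB, lintegral_mul_const' _ _ (ENNReal.mul_ne_top hB' hh),
    ← gw_eq_lintegral x hA]
  ring

theorem lintegral_mul_mul_seedLaw' {B C : Set LTree} (hB : MeasurableSet B) (hC : MeasurableSet C)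
    (x : ℤ) {h : Seed → ENNReal} (hf : ∀ s, h s ≠ ⊤) :
    ∫⁻ s₀, ∫⁻ s₁, ∫⁻ s₂, h s₀ * (B.indicator 1 (gwTree (x + step (s₁ []).2) s₁) *
      C.indicator 1 (gwTree x s₂)) ∂seedLaw ∂seedLaw ∂seedLaw =
    (∫⁻ s, h s ∂seedLaw) * (3⁻¹ * ∑ e, gw (x + step e) B) * gw x C := by
  have hB' : 3⁻¹ * ∑ e, gw (x + step e) B ≠ ⊤ := ENNReal.mul_ne_top (by norm_num)
      (ENNReal.sum_ne_top.2 fun e _ => measure_ne_top _ _)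
  simp only [lintegral_const_mul' _ _ (indicator_one_ne_top _ _), lintegral_const_mul' _ _ (hf _),
    ← gw_eq_lintegral x hC, lintegral_mul_const' _ _ (measure_ne_top (gw x) C),
    lintegral_gwTree_step x hB, 
    lintegral_mul_const' _ _ (ENNReal.mul_ne_top hB' (measure_ne_top (gw x) C))]
  ring

theorem lintegral_indicator_le_one {α : Type*} [MeasurableSpace α] (μ : Measure α)
    [IsProbabilityMeasure μ] (S : Set LTree) (f : α → LTree) :
    ∫⁻ s, S.indicator (1 : LTree → ENNReal) (f s) ∂μ ≤ 1 := by
  refine (lintegral_mono fun s => (Set.indicator_le_self' (by simp) (f s) :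
    S.indicator (1 : LTree → ENNReal) (f s) ≤ 1)).trans ?_
  simp

theorem measurable_of_natIndex {α β : Type*} [MeasurableSpace α] [MeasurableSpace β]
    {n : α → ℕ} (hn : Measurable n) {f : ℕ → α → β} (hf : ∀ i, Measurable (f i)) :
    Measurable fun a => f (n a) a := by
  have : Measurable fun q : α × ℕ => f q.2 q.1 := measurable_from_prod_countable_left hf
  exact this.comp (measurable_id.prodMk hn)

/-- The marked child is on the right of the spine, on the spine, or on its left; correspondingly the
spine lies in the left piece, in the subtree of the child, or in the right piece. These cases give
the three terms, in this order. -/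
theorem uit_split {A B C : Set LTree} (hA : MeasurableSet A) (hB : MeasurableSet B)
    (hC : MeasurableSet C) (h : UniqueSplit A B C) (x : ℤ) :
    uit x (split A B C) = uit x A * (3⁻¹ * ∑ e, gw (x + step e) B) * gw x C +
      gw x A * (3⁻¹ * ∑ e, uit (x + step e) B) * gw x C +
      gw x A * (3⁻¹ * ∑ e, gw (x + step e) B) * uit x C := by
  let G : ℕ → LTree → ENNReal := fun i => (SplitsAt A B C i).indicator 1
  have hG : ∀ i, Measurable (G i) := fun i =>
    measurable_one.indicator (measurableSet_splitsAt hA hB hC i)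
  have hGT : ∀ i, Measurable fun s => G i (spineTreeFrom x s) := fun i =>
    (hG i).comp (measurable_spineTreeFrom x)
  have hnl : Measurable fun s : SpineSeed => ((s 0).2.1 []).1 := by fun_prop
  have hnr : Measurable fun s : SpineSeed => ((s 0).2.2 []).1 := by fun_prop
  -- `F₁`, `F₂`, `F₃` collect the children on the left of the spine, the spine child, and the
  -- children on its right.
  let F₁ : SpineSeed → ENNReal := fun s =>
    ∑' i, if i < ((s 0).2.1 []).1 then G i (spineTreeFrom x s) else 0
  let F₂ : SpineSeed → ENNReal := fun s => G ((s 0).2.1 []).1 (spineTreeFrom x s)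
  let F₃ : SpineSeed → ENNReal := fun s =>
    ∑' j, if j < ((s 0).2.2 []).1 then G (((s 0).2.1 []).1 + 1 + j) (spineTreeFrom x s) else 0
  have hF₁ : Measurable F₁ := Measurable.tsum fun i =>
    Measurable.ite (measurableSet_lt measurable_const hnl) (hGT i) measurable_const
  have hF₂ : Measurable F₂ := measurable_of_natIndex hnl hGT
  have hF₃ : Measurable F₃ := Measurable.tsum fun j =>
    Measurable.ite (measurableSet_lt measurable_const hnr)
      (measurable_of_natIndex (f := fun i s => G (i + 1 + j) (spineTreeFrom x s)) hnl
        fun i => hGT _) measurable_const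
  have hmc : ∀ e r s, Measurable fun l : Seed => consSpine (e, l, r) s := fun e r s =>
    measurable_consSpine.comp (by fun_prop : Measurable fun l : Seed => ((e, l, r), s))
  have hmc' : ∀ e l s, Measurable fun r : Seed => consSpine (e, l, r) s := fun e l s =>
    measurable_consSpine.comp (by fun_prop : Measurable fun r : Seed => ((e, l, r), s))
  have hνB : 3⁻¹ * ∑ e, gw (x + step e) B ≠ ⊤ := ENNReal.mul_ne_top (by norm_num)
      (ENNReal.sum_ne_top.2 fun e _ => measure_ne_top _ _)
  have hAB : gw x A * (3⁻¹ * ∑ e, gw (x + step e) B) ≠ ⊤ :=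
    ENNReal.mul_ne_top (measure_ne_top _ _) hνB
  have I₁ : ∫⁻ s, F₁ s ∂spineSeedLaw =
      gw x A * (3⁻¹ * ∑ e, gw (x + step e) B) * uit x C := by
    have inner : ∀ e r s, ∫⁻ l, F₁ (consSpine (e, l, r) s) ∂seedLaw =
        gw x A * (3⁻¹ * ∑ e, gw (x + step e) B) *
          ∫⁻ l, C.indicator 1 (spineTreeFrom x (consSpine (e, l, r) s)) ∂seedLaw := by
      intro e r s
      refine (lintegral_tsum_children
        (Φ := fun i l => G i (spineTreeFrom x (consSpine (e, l, r) s)))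
        fun i => (hGT i).comp (hmc e r s)).trans ?_
      simp only [G, indicator_splitsAt, spineTreeFrom_leftPiece_left, spineTreeFrom_childTree_left,
        spineTreeFrom_rightPiece_left]
      exact lintegral_mul_mul_seedLaw hA hB x
        (ne_top_of_le_ne_top ENNReal.one_ne_top (lintegral_indicator_le_one _ _ _))
    rw [lintegral_spineSeedLaw_left hF₁]
    simp only [inner, lintegral_const_mul' _ _ hAB]
    rw [uit_eq_lintegral x hC, lintegral_spineSeedLaw_left]
    exact (measurable_one.indicator hC : Measurable (C.indicator (1 : LTree → ENNReal))).comp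
      (measurable_spineTreeFrom x)
  have I₃ : ∫⁻ s, F₃ s ∂spineSeedLaw =
      uit x A * (3⁻¹ * ∑ e, gw (x + step e) B) * gw x C := by
    have inner : ∀ e l s, ∫⁻ r, F₃ (consSpine (e, l, r) s) ∂seedLaw =
        (∫⁻ r, A.indicator 1 (spineTreeFrom x (consSpine (e, l, r) s)) ∂seedLaw) *
          ((3⁻¹ * ∑ e, gw (x + step e) B) * gw x C) := by
      intro e l s
      refine (lintegral_tsum_children
        (Φ := fun i r => G ((l []).1 + 1 + i) (spineTreeFrom x (consSpine (e, l, r) s)))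
        fun i => (hGT _).comp (hmc' e l s)).trans ?_
      simp only [G, indicator_splitsAt, spineTreeFrom_leftPiece_right,
        spineTreeFrom_childTree_right, spineTreeFrom_rightPiece_right]
      rw [← mul_assoc]
      exact lintegral_mul_mul_seedLaw' hB hC x fun s => indicator_one_ne_top _ _
    rw [lintegral_spineSeedLaw_right hF₃]
    simp only [inner, lintegral_mul_const' _ _ (ENNReal.mul_ne_top hνB (measure_ne_top (gw x) C))]
    rw [uit_eq_lintegral x hA, lintegral_spineSeedLaw_right]
    · ring
    exact (measurable_one.indicator hA : Measurable (A.indicator (1 : LTree → ENNReal))).comp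
      (measurable_spineTreeFrom x)
  have I₂ : ∫⁻ s, F₂ s ∂spineSeedLaw =
      gw x A * (3⁻¹ * ∑ e, uit (x + step e) B) * gw x C := by
    have e1 : ∀ e l r s, F₂ (consSpine (e, l, r) s) = A.indicator 1 (gwTree x l) *
        (B.indicator 1 (spineTreeFrom (x + step e) s) * C.indicator 1 (gwTree x r)) := by
      intro e l r s
      have : F₂ (consSpine (e, l, r) s) =
        G (l []).1 (spineTreeFrom x (consSpine (e, l, r) s)) := rfl
      rw [this]
      simp only [G, indicator_splitsAt, spineTreeFrom_leftPiece_spine,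
        spineTreeFrom_childTree_spine, spineTreeFrom_rightPiece_spine]
    rw [lintegral_spineSeedLaw_right hF₂]
    simp only [e1, lintegral_const_mul' _ _ (indicator_one_ne_top _ _), ← gw_eq_lintegral x hC,
      lintegral_mul_const' _ _ (measure_ne_top (gw x) C), ← uit_eq_lintegral _ hB]
    have hu : ∀ e, uit (x + step e) B * gw x C ≠ ⊤ := fun e =>
      ENNReal.mul_ne_top (measure_ne_top _ _) (measure_ne_top _ _)
    simp only [lintegral_mul_const' _ _ (hu _), ← gw_eq_lintegral x hA]
    rw [lintegral_const_mul' _ _ (measure_ne_top _ _),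
      lintegral_mul_const' _ _ (measure_ne_top _ _), lintegral_unif3]
    ring
  have hsum : ∀ s, (split A B C).indicator (1 : LTree → ENNReal) (spineTreeFrom x s) =
      F₁ s + F₂ s + F₃ s := by
    intro s
    rw [indicator_split h, deg_spineTreeFrom]
    exact tsum_ite_lt_add (fun i => G i (spineTreeFrom x s)) _ _
  rw [uit_eq_lintegral x (measurableSet_split hA hB hC)]
  simp only [hsum]
  rw [lintegral_add_right _ hF₃, lintegral_add_left hF₁, I₁, I₂, I₃]
  ring

/-! ### Both laws at once, as a dual number -/

/-- The probabilities of `S` under `gw x` and under `uit x`, as a dual number: the second law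
behaves as a derivative of the first one. -/
noncomputable def dualLaw (x : ℤ) (S : Set LTree) : TrivSqZeroExt ENNReal ENNReal :=
  (gw x S, uit x S)

@[simp] theorem fst_dualLaw (x : ℤ) (S : Set LTree) : (dualLaw x S).fst = gw x S := rfl

@[simp] theorem snd_dualLaw (x : ℤ) (S : Set LTree) : (dualLaw x S).snd = uit x S := rfl

theorem measurableSet_label (u : List ℕ) (y : ℤ) : MeasurableSet {T : LTree | T.label u = y} :=
  measurableSet_setOf_lab u fun o => o.getD 0 = y

@[simp] theorem gwTree_label_nil (x : ℤ) (s : Seed) : (gwTree x s).label [] = x := rfl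

@[simp] theorem spineTreeFrom_label_nil (x : ℤ) (s : SpineSeed) :
    (spineTreeFrom x s).label [] = x := rfl

theorem gw_eq_zero {x y : ℤ} (h : x ≠ y) {B : Set LTree} (hB : B ⊆ {T | T.label [] = y}) :
    gw x B = 0 := by
  refine measure_mono_null hB ?_
  rw [gw, Measure.map_apply (measurable_gwTree x) (measurableSet_label [] y)]
  simp [h]

theorem uit_eq_zero {x y : ℤ} (h : x ≠ y) {B : Set LTree} (hB : B ⊆ {T | T.label [] = y}) :
    uit x B = 0 := by
  refine measure_mono_null hB ?_
  rw [uit_eq_map, Measure.map_apply (measurable_spineTreeFrom x) (measurableSet_label [] y)]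
  simp [h]

theorem exists_step {d : ℤ} (h : |d| ≤ 1) : ∃ e, step e = d := by
  have : d = -1 ∨ d = 0 ∨ d = 1 := by rw [abs_le] at h; omega
  rcases this with rfl | rfl | rfl
  · exact ⟨0, by simp [step]⟩
  · exact ⟨1, by simp [step]⟩
  · exact ⟨2, by simp [step]⟩

theorem step_injective : Function.Injective step := by
  intro e e' h
  simp only [step, sub_left_inj, Nat.cast_inj] at h
  exact Fin.ext h

/-- `gw_split` and `uit_split` are the two components of a single product of dual numbers.
Prescribing the root-label of `B` selects one of the three steps, whence the factor `1/3`. -/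
theorem dualLaw_split {A B C : Set LTree} (hA : MeasurableSet A) (hB : MeasurableSet B)
    (hC : MeasurableSet C) (h : UniqueSplit A B C) {x y : ℤ} (hxy : |y - x| ≤ 1)
    (hBy : B ⊆ {T | T.label [] = y}) :
    dualLaw x (split A B C) =
      dualLaw x A * (TrivSqZeroExt.inl 3⁻¹ * dualLaw y B) * dualLaw x C := by
  obtain ⟨e₀, he₀⟩ := exists_step hxy
  have hne : ∀ e, e ≠ e₀ → x + step e ≠ y := fun e he h' => he (step_injective (by omega))
  have h1 : ∑ e, gw (x + step e) B = gw y B := by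
    rw [Finset.sum_eq_single e₀ (fun e _ he => gw_eq_zero (hne e he) hBy) (by simp), he₀]
    congr 2; omega
  have h2 : ∑ e, uit (x + step e) B = uit y B := by
    rw [Finset.sum_eq_single e₀ (fun e _ he => uit_eq_zero (hne e he) hBy) (by simp), he₀]
    congr 2; omega
  refine TrivSqZeroExt.ext ?_ ?_
  · simp only [fst_dualLaw, TrivSqZeroExt.fst_mul, TrivSqZeroExt.fst_inl]
    rw [gw_split hA hB hC h, h1]
  · simp only [fst_dualLaw, snd_dualLaw, TrivSqZeroExt.fst_mul, TrivSqZeroExt.snd_mul,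
      TrivSqZeroExt.fst_inl, TrivSqZeroExt.snd_inl, smul_eq_mul, op_smul_eq_smul, mul_zero, add_zero]
    rw [uit_split hA hB hC h, h1, h2]
    ring

namespace LTree

/-! ### Finite trees and trees with positive labels -/

theorem deg_leftPiece {T : LTree} {i : ℕ} (h : i ≤ T.deg []) : (T.leftPiece i).deg [] = i := by
  refine deg_eq_of fun j => ?_
  simp only [List.nil_append, leftPiece_lab_cons]
  split_ifs with hj
  · simpa [hj] using (lt_deg_iff (T := T) (u := [])).1 (hj.trans_le h)
  · simp [hj]

theorem deg_rightPiece (T : LTree) (i : ℕ) : (T.rightPiece i).deg [] = T.deg [] - (i + 1) := by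
  refine deg_eq_of fun j => ?_
  simp only [List.nil_append, rightPiece_lab_cons]
  have : i + 1 + j < T.deg [] ↔ (T.lab [i + 1 + j]).isSome := lt_deg_iff
  rw [← this]
  omega

theorem childTree_rightPiece {T : LTree} {i j : ℕ} (h : i + 1 + j < T.deg []) :
    (T.rightPiece i).childTree j = T.childTree (i + 1 + j) := by
  ext1
  funext u
  rw [childTree_lab (by rw [deg_rightPiece]; omega), childTree_lab h, rightPiece_lab_cons]

/-- All the subtrees of the descendants of the children of the root belong to `S`. -/
def allChildren (S : Set LTree) : Set LTree := {T | ∀ i < T.deg [], T.childTree i ∈ S}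

/-- The tree is reduced to its root. -/
def single : Set LTree := {T | T.deg [] = 0}

theorem measurableSet_single : MeasurableSet single := by
  have : single = {T : LTree | 0 < T.deg []}ᶜ := by ext T; simp [single]
  rw [this]
  exact (measurableSet_lt_deg [] 0).compl

theorem measurableSet_allChildren {S : Set LTree} (hS : MeasurableSet S) :
    MeasurableSet (allChildren S) := by
  have : allChildren S = ⋂ i, ({T : LTree | i < T.deg []}ᶜ ∪ (fun T => T.childTree i) ⁻¹' S) := by
    ext T
    simp only [allChildren, Set.mem_iInter, Set.mem_union, Set.mem_compl_iff, Set.mem_preimage,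
      Set.mem_ofPred_eq]
    exact forall_congr' fun i => imp_iff_not_or
  rw [this]
  exact MeasurableSet.iInter fun i =>
    (measurableSet_lt_deg [] i).compl.union (measurable_childTree i hS)

theorem uniqueSplit_single (B C : Set LTree) : UniqueSplit single B C := by
  rintro T i j hij hj - ⟨h, -⟩
  rw [single, Set.mem_ofPred_eq, deg_leftPiece hj.le] at h
  omega

/-- Peeling off the first child leaves a tree of the same kind; this is what closes the equation for
the probability of `allChildren S`. -/
theorem allChildren_eq (S : Set LTree) :
    allChildren S = single ∪ split single S (allChildren S) := by
  ext T
  constructor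
  · intro h
    rcases Nat.eq_zero_or_pos (T.deg []) with h0 | h0
    · exact Or.inl h0
    · refine Or.inr ⟨0, h0, ?_, h 0 h0, fun j hj => ?_⟩
      · exact deg_leftPiece h0.le
      · rw [deg_rightPiece] at hj
        rw [childTree_rightPiece (by omega)]
        exact h _ (by omega)
  · rintro (h | ⟨i, hi, h1, h2, h3⟩)
    · intro i hi
      rw [single, Set.mem_ofPred_eq] at h
      omega
    · rw [single, Set.mem_ofPred_eq, deg_leftPiece hi.le] at h1
      subst h1
      intro j hj
      rcases Nat.eq_zero_or_pos j with rfl | hj0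
      · exact h2
      · have := h3 (j - 1) (by rw [deg_rightPiece]; omega)
        rwa [childTree_rightPiece (by omega), show 0 + 1 + (j - 1) = j by omega] at this

theorem disjoint_single_split (A B C : Set LTree) : Disjoint single (split A B C) := by
  rw [Set.disjoint_left]
  rintro T h ⟨i, hi, -⟩
  rw [single, Set.mem_ofPred_eq] at h
  omega

end LTree

/-! ### Recursive equations and finiteness -/

theorem gw_single (x : ℤ) : gw x single = 2⁻¹ := by
  rw [gw, Measure.map_apply (measurable_gwTree x) measurableSet_single]
  have h1 : gwTree x ⁻¹' single = (fun s : Seed => s []) ⁻¹' ({0} ×ˢ Set.univ) := by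
    ext s; simp [single]
  have hev : seedLaw.map (fun s : Seed => s []) = geomHalf.prod unif3 :=
    Measure.infinitePi_map_eval _ []
  rw [h1, ← Measure.map_apply (measurable_pi_apply []) (by measurability), hev, Measure.prod_prod,
    geomHalf_singleton]
  simp

theorem sum_step (f : ℤ → ℝ) (x : ℤ) : ∑ e, f (x + step e) = f (x - 1) + f x + f (x + 1) := by
  simp [Fin.sum_univ_three, step, sub_eq_add_neg]

/-- With `g` the probability on the left and `m` the average of the three probabilities of `S`,
peeling off the first child gives `g = 1/2 + (1/2) m g`. -/
theorem gw_real_allChildren {S : Set LTree} (hS : MeasurableSet S) (x : ℤ) :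
    (gw x).real (allChildren S) *
      (2 - ((gw (x - 1)).real S + (gw x).real S + (gw (x + 1)).real S) / 3) = 1 := by
  have h := gw_split measurableSet_single hS (measurableSet_allChildren hS)
    (uniqueSplit_single _ _) x
  have h1 : gw x (allChildren S) = gw x single + gw x (split single S (allChildren S)) := by
    conv_lhs => rw [allChildren_eq]
    exact measure_union (disjoint_single_split _ _ _)
      (measurableSet_split measurableSet_single hS (measurableSet_allChildren hS))
  rw [h, gw_single] at h1
  have h2 := congrArg ENNReal.toReal h1
  rw [ENNReal.toReal_add (by simp) (by
    refine ENNReal.mul_ne_top (ENNReal.mul_ne_top (by simp) (ENNReal.mul_ne_top (by simp) ?_))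
      (measure_ne_top _ _)
    exact ENNReal.sum_ne_top.2 fun e _ => measure_ne_top _ _)] at h2
  simp only [ENNReal.toReal_mul, ENNReal.toReal_inv, ENNReal.toReal_ofNat,
    ENNReal.toReal_sum fun e _ => measure_ne_top (gw (x + step e)) S] at h2
  rw [← sum_step fun y => (gw y).real S]
  simp only [measureReal_def]
  linear_combination 2 * h2

namespace LTree

/-- The trees of height at most `n`. -/
def heightLE (n : ℕ) : Set LTree := {T | ∀ u : List ℕ, n < u.length → T.lab u = none}

/-- The finite trees. -/
def finiteTrees : Set LTree := {T | ∃ n, T ∈ heightLE n}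

/-- The trees with labels greater than `m`. -/
def labelsAbove (m : ℤ) : Set LTree := {T | ∀ u p, T.lab u = some p → m < p}

/-- The trees whose labels up to height `n` are positive. -/
def posUpTo (n : ℕ) : Set LTree := {T | ∀ u p, u.length ≤ n → T.lab u = some p → 0 < p}

theorem measurableSet_heightLE (n : ℕ) : MeasurableSet (heightLE n) := by
  have : heightLE n = ⋂ u : List ℕ, ⋂ _ : n < u.length, {T : LTree | T.lab u = none} := by
    ext T; simp [heightLE]
  rw [this]
  exact MeasurableSet.iInter fun u => MeasurableSet.iInter fun _ => measurableSet_lab u none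

theorem finiteTrees_eq : finiteTrees = ⋃ n, heightLE n := by
  ext T; simp [finiteTrees]

theorem measurableSet_finiteTrees : MeasurableSet finiteTrees := by
  rw [finiteTrees_eq]
  exact MeasurableSet.iUnion measurableSet_heightLE

theorem measurableSet_labelsAbove (m : ℤ) : MeasurableSet (labelsAbove m) := by
  have : labelsAbove m = ⋂ u : List ℕ, {T : LTree | ∀ p, T.lab u = some p → m < p} := by
    ext T; simp [labelsAbove]
  rw [this]
  exact MeasurableSet.iInter fun u => measurableSet_setOf_lab u fun o => ∀ p, o = some p → m < p

theorem measurableSet_posUpTo (n : ℕ) : MeasurableSet (posUpTo n) := by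
  have : posUpTo n = ⋂ u : List ℕ, ⋂ _ : u.length ≤ n,
      {T : LTree | ∀ p, T.lab u = some p → 0 < p} := by
    ext T
    simp only [posUpTo, Set.mem_iInter, Set.mem_ofPred_eq]
    exact ⟨fun h u hu p => h u p hu, fun h u p hu => h u hu p⟩
  rw [this]
  exact MeasurableSet.iInter fun u => MeasurableSet.iInter fun _ =>
    measurableSet_setOf_lab u fun o => ∀ p, o = some p → 0 < p

theorem heightLE_zero : heightLE 0 = single := by
  ext T
  constructor
  · intro h
    by_contra h0
    have := (lt_deg_iff (T := T) (u := [])).1 (Nat.pos_of_ne_zero h0)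
    rw [List.nil_append, h [0] (by simp)] at this
    simp at this
  · intro h u hu
    cases u with
    | nil => simp at hu
    | cons i u =>
      rw [single, Set.mem_ofPred_eq] at h
      exact lab_cons_eq_none (by omega) u

theorem heightLE_succ (n : ℕ) : heightLE (n + 1) = allChildren (heightLE n) := by
  ext T
  constructor
  · intro h i hi u hu
    rw [childTree_lab hi]
    exact h _ (by simpa using hu)
  · intro h u hu
    cases u with
    | nil => simp at hu
    | cons i u =>
      rcases lt_or_ge i (T.deg []) with hi | hi
      · rw [← childTree_lab hi]
        exact h i hi u (by simpa using hu)
      · exact lab_cons_eq_none hi u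

theorem mem_posUpTo_succ {T : LTree} {n : ℕ} :
    T ∈ posUpTo (n + 1) ↔ 0 < T.label [] ∧ T ∈ allChildren (posUpTo n) := by
  constructor
  · intro h
    refine ⟨h [] _ (by simp) (some_label T.root_mem).symm, fun i hi u p hu hp => ?_⟩
    rw [childTree_lab hi] at hp
    exact h _ p (by simpa using hu) hp
  · rintro ⟨h0, h⟩ u p hu hp
    cases u with
    | nil =>
      rw [← some_label T.root_mem] at hp
      simpa using (Option.some.inj hp) ▸ h0
    | cons i u =>
      have hi : i < T.deg [] := by
        by_contra hi
        rw [lab_cons_eq_none (not_lt.1 hi)] at hp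
        simp at hp
      rw [← childTree_lab hi] at hp
      exact h i hi u p (by simpa using hu) hp

theorem posUpTo_anti : Antitone posUpTo := fun _ _ hnm _ h u p hu hp => h u p (hu.trans hnm) hp

theorem labelsAbove_zero_eq : labelsAbove 0 = ⋂ n, posUpTo n := by
  ext T
  simp only [labelsAbove, posUpTo, Set.mem_iInter, Set.mem_ofPred_eq]
  exact ⟨fun h n u p _ => h u p, fun h u p => h _ u p le_rfl⟩

end LTree

/-- The values do not depend on `x` and satisfy `q (n + 1) = 1 / (2 - q n)` with `q 0 = 1 / 2`. -/
theorem gw_real_heightLE (n : ℕ) : ∀ x, (gw x).real (heightLE n) = (n + 1) / (n + 2) := by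
  induction n with
  | zero => intro x; rw [heightLE_zero, measureReal_def, gw_single]; simp
  | succ n ih =>
    intro x
    have h := gw_real_allChildren (measurableSet_heightLE n) x
    rw [ih, ih, ih, ← heightLE_succ] at h
    have : (2 : ℝ) - ((n + 1) / (n + 2) + (n + 1) / (n + 2) + (n + 1) / (n + 2)) / 3 =
        (n + 3) / (n + 2) := by field_simp; ring
    rw [this] at h
    field_simp at h
    push_cast
    rw [eq_div_iff (by positivity)]
    linarith

theorem gw_finiteTrees (x : ℤ) : gw x finiteTrees = 1 := by
  refine le_antisymm prob_le_one ?_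
  have h1 : Filter.Tendsto (fun n : ℕ => gw x (heightLE n)) Filter.atTop (nhds 1) := by
    rw [← ENNReal.tendsto_toReal_iff (fun n => measure_ne_top _ _) (by simp)]
    have h2 : (fun n : ℕ => (gw x (heightLE n)).toReal) = fun n : ℕ => 1 - 1 / ((n : ℝ) + 2) := by
      funext n
      have := gw_real_heightLE n x
      rw [measureReal_def] at this
      rw [this]
      field_simp
      ring
    rw [h2]
    have h3 : Filter.Tendsto (fun n : ℕ => 1 / ((n : ℝ) + 2)) Filter.atTop (nhds 0) := by
      simp only [one_div]
      exact (Filter.tendsto_atTop_add_const_right _ 2 tendsto_natCast_atTop_atTop).inv_tendsto_atTop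
    simpa using h3.const_sub 1
  exact le_of_tendsto' h1 fun n => measure_mono fun T hT => ⟨n, hT⟩

/-- The spine provides a vertex at every height, for every value of the randomness. -/
theorem uit_finiteTrees (x : ℤ) : uit x finiteTrees = 0 := by
  rw [uit_eq_map, Measure.map_apply (measurable_spineTreeFrom x) measurableSet_finiteTrees]
  have h : ∀ (n : ℕ) (x : ℤ) (s : SpineSeed), ∃ u, u.length = n ∧ (spineLab s x u).isSome := by
    intro n
    induction n with
    | zero => exact fun x s => ⟨[], rfl, by simp [spineLab]⟩
    | succ n ih =>
      intro x s
      obtain ⟨u, hu, h⟩ := ih (x + step (s 0).1) (fun n => s (n + 1))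
      exact ⟨((s 0).2.1 []).1 :: u, by simp [hu], by simpa [spineLab] using h⟩
  convert measure_empty (μ := spineSeedLaw)
  ext s
  simp only [Set.mem_preimage, Set.mem_empty_iff_false, iff_false]
  rintro ⟨n, hn⟩
  obtain ⟨u, hu, h'⟩ := h (n + 1) x s
  have := hn u (by omega)
  rw [spineTreeFrom_lab] at this
  simp [this] at h'

/-! ### The probability that all labels are positive -/

theorem gw_label_nil (x : ℤ) : ∀ᵐ T ∂(gw x), T.label [] = x := by
  rw [gw, ae_map_iff (measurable_gwTree x).aemeasurable (measurableSet_label [] x)]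
  exact Filter.Eventually.of_forall fun s => rfl

theorem gw_real_posUpTo_succ (n : ℕ) {x : ℤ} (hx : 1 ≤ x) :
    (gw x).real (posUpTo (n + 1)) * (2 - ((gw (x - 1)).real (posUpTo n) + (gw x).real (posUpTo n) +
      (gw (x + 1)).real (posUpTo n)) / 3) = 1 := by
  rw [← gw_real_allChildren (measurableSet_posUpTo n) x]
  congr 1
  refine measureReal_congr ?_
  filter_upwards [gw_label_nil x] with T hT
  refine propext (mem_posUpTo_succ.trans ?_)
  rw [hT]
  exact and_iff_right (by omega)

theorem gw_real_posUpTo_of_nonpos (n : ℕ) {x : ℤ} (hx : x ≤ 0) : (gw x).real (posUpTo n) = 0 := by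
  rw [measureReal_def, ENNReal.toReal_eq_zero_iff]
  left
  rw [measure_eq_zero_iff_ae_notMem]
  filter_upwards [gw_label_nil x] with T hT h
  have := h [] _ (by simp) (some_label T.root_mem).symm
  omega

theorem gw_real_posUpTo_zero {x : ℤ} (hx : 1 ≤ x) : (gw x).real (posUpTo 0) = 1 := by
  have : gw x (posUpTo 0) = 1 := by
    rw [prob_compl_eq_zero_iff (measurableSet_posUpTo 0) |>.symm, measure_eq_zero_iff_ae_notMem]
    filter_upwards [gw_label_nil x] with T hT h
    refine h fun u p hu hp => ?_
    obtain rfl : u = [] := by simpa using hu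
    rw [← some_label T.root_mem, hT] at hp
    have := Option.some.inj hp
    omega
  simp [measureReal_def, this]

/-- The function `w` solves the equation satisfied by the probability of positivity. -/
theorem w_recursion {x : ℤ} (hx : 1 ≤ x) :
    w x * (2 - (w (x - 1) + w x + w (x + 1)) / 3) = 1 := by
  have h : (1 : ℝ) ≤ x := by exact_mod_cast hx
  simp only [w]
  push_cast
  have h1 : (x : ℝ) ≠ 0 := by linarith
  have h2 : (x : ℝ) + 1 ≠ 0 := by linarith
  have h3 : (x : ℝ) + 2 ≠ 0 := by linarith
  have h4 : (x : ℝ) + 3 ≠ 0 := by linarith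
  have e1 : (x : ℝ) - 1 + 1 = x := by ring
  have e2 : (x : ℝ) - 1 + 2 = x + 1 := by ring
  have e3 : (x : ℝ) + 1 + 1 = x + 2 := by ring
  have e4 : (x : ℝ) + 1 + 2 = x + 3 := by ring
  rw [e1, e2, e3, e4]
  field_simp
  ring

/-- The decay of `1 - w` serves as boundary condition at infinity in the uniqueness argument. -/
theorem one_sub_w {x : ℤ} (hx : 0 ≤ x) : 1 - w x = 2 / ((x + 1) * (x + 2)) := by
  have h : (0 : ℝ) ≤ x := by exact_mod_cast hx
  have h2 : (x : ℝ) + 1 ≠ 0 := by linarith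
  have h3 : (x : ℝ) + 2 ≠ 0 := by linarith
  simp only [w]
  field_simp
  ring

theorem w_le_one {x : ℤ} (hx : 0 ≤ x) : w x ≤ 1 := by
  have h : (0 : ℝ) ≤ x := by exact_mod_cast hx
  have h1 : 0 ≤ 1 - w x := by rw [one_sub_w hx]; positivity
  linarith

theorem w_pos {x : ℤ} (hx : 1 ≤ x) : 0 < w x := by
  have h : (1 : ℝ) ≤ x := by exact_mod_cast hx
  simp only [w]
  positivity

/-- The recursion is monotone, `w` is a fixed point of it, and the iteration starts from `1 ≥ w` at
positive labels. -/
theorem w_le_gw_real_posUpTo (n : ℕ) : ∀ x : ℤ, 0 ≤ x → w x ≤ (gw x).real (posUpTo n) := by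
  induction n with
  | zero =>
    intro x hx
    rcases hx.eq_or_lt with rfl | hx
    · simp [w]
    · rw [gw_real_posUpTo_zero (by omega)]
      exact w_le_one (by omega)
  | succ n ih =>
    intro x hx
    rcases hx.eq_or_lt with rfl | hx
    · simp [w]
    · have h1 := gw_real_posUpTo_succ n (x := x) (by omega)
      have h2 := w_recursion (x := x) (by omega)
      have i1 := ih (x - 1) (by omega)
      have i2 := ih x (by omega)
      have i3 := ih (x + 1) (by omega)
      have hw := w_pos (x := x) (by omega)
      have j1 := measureReal_le_one (μ := gw (x - 1)) (s := posUpTo n)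
      have j2 := measureReal_le_one (μ := gw x) (s := posUpTo n)
      have j3 := measureReal_le_one (μ := gw (x + 1)) (s := posUpTo n)
      set D := 2 - ((gw (x - 1)).real (posUpTo n) + (gw x).real (posUpTo n) +
        (gw (x + 1)).real (posUpTo n)) / 3 with hD
      have hD1 : 0 < D := by linarith
      have hle : w x * D ≤ (gw x).real (posUpTo (n + 1)) * D := by
        rw [h1, ← h2]
        exact mul_le_mul_of_nonneg_left (by linarith) hw.le
      exact le_of_mul_le_mul_right hle hD1

theorem tendsto_gw_real_posUpTo (x : ℤ) : Filter.Tendsto (fun n => (gw x).real (posUpTo n))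
    Filter.atTop (nhds ((gw x).real (labelsAbove 0))) := by
  rw [labelsAbove_zero_eq]
  exact (ENNReal.tendsto_toReal (measure_ne_top _ _)).comp (tendsto_measure_iInter_atTop
    (fun n => (measurableSet_posUpTo n).nullMeasurableSet) posUpTo_anti ⟨0, measure_ne_top _ _⟩)

theorem gw_real_labelsAbove_recursion {x : ℤ} (hx : 1 ≤ x) :
    (gw x).real (labelsAbove 0) * (2 - ((gw (x - 1)).real (labelsAbove 0) +
      (gw x).real (labelsAbove 0) + (gw (x + 1)).real (labelsAbove 0)) / 3) = 1 := by
  have ht := tendsto_gw_real_posUpTo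
  have h1 := ((ht x).comp (Filter.tendsto_add_atTop_nat 1)).mul
    ((((ht (x - 1)).add (ht x)).add (ht (x + 1))).div_const 3 |>.const_sub 2)
  refine tendsto_nhds_unique h1 ?_
  have : (fun n => (gw x).real (posUpTo (n + 1)) * (2 - ((gw (x - 1)).real (posUpTo n) +
      (gw x).real (posUpTo n) + (gw (x + 1)).real (posUpTo n)) / 3)) = fun _ => 1 :=
    funext fun n => gw_real_posUpTo_succ n hx
  exact (tendsto_const_nhds (x := (1 : ℝ)) (f := Filter.atTop (α := ℕ))).congr
    fun n => (congrFun this n).symm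

/-- The recursion alone does not determine its solution. The difference `d` with `w` is nonnegative
and vanishes at `0`; it is convex, hence nondecreasing; and it is at most `1 - w`, which tends to
`0`. So `d` is zero. -/
theorem gw_real_labelsAbove_zero {x : ℤ} (hx : 1 ≤ x) : (gw x).real (labelsAbove 0) = w x := by
  have hge : ∀ y : ℤ, 0 ≤ y → w y ≤ (gw y).real (labelsAbove 0) := fun y hy =>
    ge_of_tendsto' (tendsto_gw_real_posUpTo y) fun n => w_le_gw_real_posUpTo n y hy
  let d : ℕ → ℝ := fun n => (gw n).real (labelsAbove 0) - w n
  have hd0 : ∀ n, 0 ≤ d n := fun n => sub_nonneg.2 (hge n (by omega))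
  have hzero : d 0 = 0 := by
    have : (gw 0).real (labelsAbove 0) ≤ 0 := by
      rw [← gw_real_posUpTo_of_nonpos 0 (x := 0) le_rfl]
      exact measureReal_mono fun T h u p _ => h u p
    have h2 : w 0 = 0 := by simp [w]
    have := hd0 0
    simp only [d, Nat.cast_zero, h2] at this ⊢
    linarith
  have hconv : ∀ n, 2 * d (n + 1) ≤ d n + d (n + 2) := by
    intro n
    have hx1 : (1 : ℤ) ≤ (n + 1 : ℕ) := by push_cast; omega
    have h1 := gw_real_labelsAbove_recursion hx1
    have h2 := w_recursion hx1
    have e1 : ((n + 1 : ℕ) : ℤ) - 1 = (n : ℕ) := by push_cast; ring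
    have e2 : ((n + 1 : ℕ) : ℤ) + 1 = (n + 2 : ℕ) := by push_cast; ring
    rw [e1, e2] at h1 h2
    have k1 := hd0 n
    have k2 := hd0 (n + 1)
    have k3 := hd0 (n + 2)
    have hu := hge (n + 1 : ℕ) (by omega)
    have hw := w_pos hx1
    have hw1 := w_le_one (x := (n + 1 : ℕ)) (by omega)
    have hu1 := measureReal_le_one (μ := gw (n + 1 : ℕ)) (s := labelsAbove 0)
    simp only [d] at k1 k2 k3 ⊢
    set u0 := (gw (n : ℕ)).real (labelsAbove 0)
    set u1 := (gw (n + 1 : ℕ)).real (labelsAbove 0)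
    set u2 := (gw (n + 2 : ℕ)).real (labelsAbove 0)
    set w0 := w (n : ℕ)
    set w1 := w (n + 1 : ℕ)
    set w2 := w (n + 2 : ℕ)
    -- The difference of the two recursions. Since `u1 * w1 ≤ 1`, the value of `d` at the middle is
    -- at most the average of three consecutive values, which is convexity.
    have key : u1 - w1 = u1 * w1 * (((u0 - w0) + (u1 - w1) + (u2 - w2)) / 3) := by
      linear_combination w1 * h1 - u1 * h2
    have hS : 0 ≤ ((u0 - w0) + (u1 - w1) + (u2 - w2)) / 3 := by linarith
    have hle : u1 * w1 ≤ 1 := mul_le_one₀ hu1 hw.le hw1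
    have := mul_le_mul_of_nonneg_right hle hS
    linarith
  have hincr : ∀ n, 0 ≤ d (n + 1) - d n := by
    intro n
    induction n with
    | zero => rw [hzero]; simpa using hd0 1
    | succ n ih => have := hconv n; linarith
  have hmono : Monotone d := monotone_nat_of_le_succ fun n => by linarith [hincr n]
  have hbound : ∀ n : ℕ, d n ≤ 2 / ((n : ℝ) + 1) := by
    intro n
    have h1 := one_sub_w (x := n) (by omega)
    have h2 := measureReal_le_one (μ := gw n) (s := labelsAbove 0)
    push_cast at h1
    have h3 : (2 : ℝ) / ((n + 1) * (n + 2)) ≤ 2 / (n + 1) := by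
      have hn : (0 : ℝ) ≤ n := Nat.cast_nonneg n
      apply div_le_div_of_nonneg_left (by norm_num) (by positivity)
      nlinarith
    simp only [d]
    linarith
  obtain ⟨m, rfl⟩ : ∃ m : ℕ, x = m := ⟨x.toNat, by omega⟩
  have hlim : Filter.Tendsto (fun n : ℕ => 2 / ((n : ℝ) + 1)) Filter.atTop (nhds 0) := by
    have := (tendsto_one_div_add_atTop_nhds_zero_nat (𝕜 := ℝ)).const_mul 2
    simpa [div_eq_mul_inv] using this
  have hm : d m ≤ 0 := ge_of_tendsto hlim
    (Filter.eventually_atTop.2 ⟨m, fun n hn => (hmono hn).trans (hbound n)⟩)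
  have := hd0 m
  simp only [d] at hm this
  linarith

/-! ### The lexicographic order on vertices -/

/-- The list `u ++ [0]` is the immediate successor of `u`: comparing with the first corner of `u`
amounts to comparing with the vertex `u`. -/
theorem lt_append_zero_iff {v u : List ℕ} : v < u ++ [0] ↔ v = u ∨ v < u := by
  induction u generalizing v with
  | nil => cases v <;> simp [List.cons_lt_cons_iff]
  | cons i u ih =>
    cases v with
    | nil => simp
    | cons j v =>
      simp only [List.cons_append, List.cons_lt_cons_iff, ih, List.cons.injEq]
      tauto

theorem append_lt_append_iff (u : List ℕ) {v v' : List ℕ} : u ++ v < u ++ v' ↔ v < v' := by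
  induction u with
  | nil => simp
  | cons i u ih => simp [ih]

theorem lt_append_cons (u : List ℕ) (i : ℕ) (w : List ℕ) : u < u ++ i :: w := by
  simpa using (append_lt_append_iff u (v := []) (v' := i :: w)).2 (by simp)

/-- If `u` is not a prefix, the first differing letter decides the order, whatever is appended. -/
theorem prefix_or_append_lt {u v : List ℕ} (h : u < v) :
    u <+: v ∨ ∀ w w', u ++ w < v ++ w' := by
  induction u generalizing v with
  | nil => simp
  | cons i u ih =>
    cases v with
    | nil => simp at h
    | cons j v =>
      rcases List.cons_lt_cons_iff.1 h with h' | ⟨rfl, h'⟩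
      · exact Or.inr fun w w' => List.cons_lt_cons_iff.2 (Or.inl h')
      · rcases ih h' with h' | h'
        · exact Or.inl (by simpa using h')
        · exact Or.inr fun w w' => List.cons_lt_cons_iff.2 (Or.inr ⟨rfl, h' w w'⟩)

theorem eq_cons_of_not_lt {d : ℕ} {v : List ℕ} (h : ¬ v < [d]) : ∃ i w, d ≤ i ∧ v = i :: w := by
  cases v with
  | nil => simp at h
  | cons i w =>
    refine ⟨i, w, ?_, rfl⟩
    by_contra hi
    exact h (List.cons_lt_cons_iff.2 (Or.inl (not_le.1 hi)))

/-- Applied with `d` the degree of `u ++ [r]`, this shows that no vertex lies between the last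
corner of a child and the next corner of its parent. -/
theorem eq_append_of_between {u v : List ℕ} {r d : ℕ} (h1 : ¬ v < u ++ [r, d])
    (h2 : v < u ++ [r + 1]) : ∃ i w, d ≤ i ∧ v = u ++ r :: i :: w := by
  induction u generalizing v with
  | nil =>
    cases v with
    | nil => simp at h1
    | cons r' v' =>
      simp only [List.nil_append, List.cons_lt_cons_iff, List.not_lt_nil, and_false, or_false,
        not_or, not_and] at h1 h2
      obtain rfl : r' = r := by omega
      obtain ⟨i, w, hi, rfl⟩ := eq_cons_of_not_lt (d := d) (v := v') (by
        intro h; exact h1.2 rfl h)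
      exact ⟨i, w, hi, rfl⟩
  | cons k u ih =>
    cases v with
    | nil => simp at h1
    | cons k' v =>
      simp only [List.cons_append, List.cons_lt_cons_iff, not_or, not_and] at h1 h2
      obtain rfl : k' = k := by omega
      obtain ⟨i, w, hi, rfl⟩ := ih (v := v) (h1.2 rfl) (by simpa using h2)
      exact ⟨i, w, hi, rfl⟩

namespace LTree

/-! ### The contour -/

theorem nextCorner_of_lt {T : LTree} {u : List ℕ} {j : ℕ} (h : j < T.deg u) :
    T.nextCorner (u, j) = (u ++ [j], 0) := by simp [nextCorner, h]

theorem nextCorner_append {T : LTree} {u : List ℕ} {r j : ℕ} (h : T.deg (u ++ [r]) ≤ j) :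
    T.nextCorner (u ++ [r], j) = (u, r + 1) := by simp [nextCorner, not_lt.2 h]

theorem nextCorner_root {T : LTree} {j : ℕ} (h : T.deg [] ≤ j) :
    T.nextCorner ([], j) = if 0 < T.deg [] then ([0], 0) else ([], 0) := by
  simp [nextCorner, not_lt.2 h]

theorem prevCorner_succ (T : LTree) (u : List ℕ) (j : ℕ) :
    T.prevCorner (u, j + 1) = (u ++ [j], T.deg (u ++ [j])) := by simp [prevCorner]

theorem prevCorner_append (T : LTree) (u : List ℕ) (r : ℕ) :
    T.prevCorner (u ++ [r], 0) = (u, r) := by simp [prevCorner]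

theorem prevCorner_root (T : LTree) : T.prevCorner ([], 0) =
    if 0 < T.deg [] then ([T.deg [] - 1], T.deg [T.deg [] - 1]) else ([], 0) := by
  simp [prevCorner]

/-- `(u, j)` is a corner of `T`. -/
def IsCorner (T : LTree) (c : List ℕ × ℕ) : Prop := (T.lab c.1).isSome ∧ c.2 ≤ T.deg c.1

/-- The list attached to a corner: the corners met after the root-corner in the contour, before it
wraps around, have increasing keys for the lexicographic order. -/
def key (c : List ℕ × ℕ) : List ℕ := c.1 ++ [c.2]

theorem isCorner_nextCorner {T : LTree} {c : List ℕ × ℕ} (h : T.IsCorner c) :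
    T.IsCorner (T.nextCorner c) := by
  obtain ⟨u, j⟩ := c
  obtain ⟨h1, h2⟩ := h
  dsimp only at h1 h2
  rcases h2.lt_or_eq with hj | rfl
  · rw [nextCorner_of_lt hj]
    exact ⟨lt_deg_iff.1 hj, Nat.zero_le _⟩
  · rcases List.eq_nil_or_concat' u with rfl | ⟨u, r, rfl⟩
    · rw [nextCorner_root le_rfl]
      split_ifs with h0
      · exact ⟨lt_deg_iff.1 h0, Nat.zero_le _⟩
      · exact ⟨h1, Nat.zero_le _⟩
    · rw [nextCorner_append le_rfl]
      exact ⟨isSome_of_append h1, lt_deg_iff.2 h1⟩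

theorem isCorner_prevCorner {T : LTree} {c : List ℕ × ℕ} (h : T.IsCorner c) :
    T.IsCorner (T.prevCorner c) := by
  obtain ⟨u, j⟩ := c
  obtain ⟨h1, h2⟩ := h
  dsimp only at h1 h2
  rcases j with _ | j
  · rcases List.eq_nil_or_concat' u with rfl | ⟨u, r, rfl⟩
    · rw [prevCorner_root]
      split_ifs with h0
      · exact ⟨lt_deg_iff.1 (show T.deg [] - 1 < T.deg [] by omega), le_rfl⟩
      · exact ⟨h1, Nat.zero_le _⟩
    · rw [prevCorner_append]
      exact ⟨isSome_of_append h1, (lt_deg_iff.2 h1).le⟩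
  · rw [prevCorner_succ]
    exact ⟨lt_deg_iff.1 h2, le_rfl⟩

theorem not_isSome_of_deg_le {T : LTree} {u : List ℕ} {i : ℕ} {w : List ℕ} (h : T.deg u ≤ i) :
    ¬ (T.lab (u ++ i :: w)).isSome := by
  rw [lab_append_cons_eq_none h]; simp

theorem isCorner_iterate_nextCorner (T : LTree) (n : ℕ) :
    T.IsCorner (T.nextCorner^[n] ([], 0)) := by
  induction n with
  | zero => exact ⟨T.root_mem, Nat.zero_le _⟩
  | succ n ih => rw [Function.iterate_succ_apply']; exact isCorner_nextCorner ih

theorem isCorner_iterate_prevCorner (T : LTree) (n : ℕ) :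
    T.IsCorner (T.prevCorner^[n] ([], T.deg [])) := by
  induction n with
  | zero => exact ⟨T.root_mem, le_rfl⟩
  | succ n ih => rw [Function.iterate_succ_apply']; exact isCorner_prevCorner ih

/-- Going up to a child adds only that child to the vertices below the key. Going down to a parent,
or wrapping around at the root, adds none. -/
theorem exists_visit_of_lt_key {T : LTree} (n : ℕ) : ∀ v, (T.lab v).isSome →
    v < key (T.nextCorner^[n] ([], 0)) → ∃ m ≤ n, (T.nextCorner^[m] ([], 0)).1 = v := by
  induction n with
  | zero =>
    intro v _ hv
    rcases lt_append_zero_iff.1 hv with rfl | h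
    · exact ⟨0, le_rfl, rfl⟩
    · simp at h
  | succ n ih =>
    intro v hvT hv
    have hc := isCorner_iterate_nextCorner T n
    have hnext := Function.iterate_succ_apply' T.nextCorner n ([], 0)
    by_cases hlt : v < key (T.nextCorner^[n] ([], 0))
    · obtain ⟨m, hm, h⟩ := ih v hvT hlt
      exact ⟨m, by omega, h⟩
    rw [hnext] at hv
    suffices h : v = (T.nextCorner (T.nextCorner^[n] ([], 0))).1 from
      ⟨n + 1, le_rfl, by rw [hnext, h]⟩
    generalize T.nextCorner^[n] ([], 0) = c at *
    obtain ⟨u, j⟩ := c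
    obtain ⟨h1, h2⟩ := hc
    dsimp only [key] at h1 h2 hlt
    rcases h2.lt_or_eq with hj | rfl
    · rw [nextCorner_of_lt hj] at hv ⊢
      exact (lt_append_zero_iff.1 hv).resolve_right hlt
    · rcases List.eq_nil_or_concat' u with rfl | ⟨u, r, rfl⟩
      · exfalso
        obtain ⟨i, w, hi, rfl⟩ := eq_cons_of_not_lt hlt
        exact not_isSome_of_deg_le (u := []) hi hvT
      · exfalso
        rw [nextCorner_append le_rfl] at hv
        obtain ⟨i, w, hi, rfl⟩ := eq_append_of_between (by simpa using hlt) hv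
        exact not_isSome_of_deg_le (u := u ++ [r]) hi (by simpa using hvT)

/-- As long as the first corner of `p` is ahead, the contour advances without wrapping around, and
it cannot jump over that corner. -/
theorem key_lt_key_nextCorner {T : LTree} {c : List ℕ × ℕ} {p : List ℕ} (hp : (T.lab p).isSome)
    (hc : T.IsCorner c) (hcp : key c < p ++ [0]) :
    key c < key (T.nextCorner c) ∧
      (key (T.nextCorner c) < p ++ [0] ∨ T.nextCorner c = (p, 0)) := by
  obtain ⟨u, j⟩ := c
  obtain ⟨h1, h2⟩ := hc
  dsimp only [key] at h1 h2 hcp ⊢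
  rcases h2.lt_or_eq with hj | rfl
  · rw [nextCorner_of_lt hj]
    refine ⟨lt_append_cons _ _ _, ?_⟩
    rcases lt_append_zero_iff.1 hcp with rfl | h
    · exact Or.inr rfl
    · left
      rcases lt_trichotomy (u ++ [j] ++ [0]) p with h' | h' | h'
      · exact lt_append_zero_iff.2 (Or.inr h')
      · exact lt_append_zero_iff.2 (Or.inl h')
      · rcases lt_append_zero_iff.1 h' with rfl | h'
        · exact absurd h (lt_irrefl _)
        · exact absurd (h.trans h') (lt_irrefl _)
  · have hnot : ¬ p < u ++ [T.deg u] := by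
      rcases lt_append_zero_iff.1 hcp with h | h
      · rw [h]; exact lt_irrefl _
      · exact h.not_gt
    rcases List.eq_nil_or_concat' u with rfl | ⟨u, r, rfl⟩
    · exfalso
      obtain ⟨i, w, hi, rfl⟩ := eq_cons_of_not_lt hnot
      exact not_isSome_of_deg_le (u := []) hi hp
    · rw [nextCorner_append le_rfl]
      have hnot' : ¬ p < u ++ [r + 1] := by
        intro hlt
        obtain ⟨i, w, hi, rfl⟩ := eq_append_of_between (by simpa using hnot) hlt
        exact not_isSome_of_deg_le (u := u ++ [r]) hi (by simpa using hp)
      refine ⟨?_, Or.inl ?_⟩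
      · rw [List.append_assoc, append_lt_append_iff]
        simp [List.cons_lt_cons_iff]
      · refine lt_append_zero_iff.2 ?_
        rcases lt_trichotomy p (u ++ [r + 1]) with h | h | h
        · exact absurd h hnot'
        · exact Or.inl h.symm
        · exact Or.inr h

/-- Only finitely many corners belong to vertices before `p`, while the keys strictly increase: the
contour must reach `p`. Without finiteness it could be trapped in an infinite part on the left. -/
theorem exists_iterate_nextCorner_eq {T : LTree} {p : List ℕ} (hp : (T.lab p).isSome)
    (hfin : {v | (T.lab v).isSome ∧ v < p}.Finite) :
    ∃ N, T.nextCorner^[N] ([], 0) = (p, 0) ∧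
      ∀ m < N, (T.nextCorner^[m] ([], 0)).1 < p := by
  have hinv : ∀ n, (∀ m ≤ n, T.nextCorner^[m] ([], 0) ≠ (p, 0)) →
      key (T.nextCorner^[n] ([], 0)) < p ++ [0] := by
    intro n
    induction n with
    | zero =>
      intro h
      have hp0 : p ≠ [] := by rintro rfl; exact h 0 le_rfl rfl
      obtain ⟨i, w, rfl⟩ := List.exists_cons_of_ne_nil hp0
      change [0] < i :: (w ++ [0])
      rw [List.cons_lt_cons_iff]
      rcases Nat.eq_zero_or_pos i with rfl | hi
      · exact Or.inr ⟨rfl, by cases w <;> simp⟩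
      · exact Or.inl hi
    | succ n ih =>
      intro h
      have h' := h (n + 1) le_rfl
      rw [Function.iterate_succ_apply'] at h' ⊢
      exact (key_lt_key_nextCorner hp (isCorner_iterate_nextCorner T n)
        (ih fun m hm => h m (by omega))).2.resolve_right h'
  have hvert : ∀ n, key (T.nextCorner^[n] ([], 0)) < p ++ [0] →
      (T.nextCorner^[n] ([], 0)).1 < p := by
    intro n h
    have h1 : (T.nextCorner^[n] ([], 0)).1 < key (T.nextCorner^[n] ([], 0)) := lt_append_cons _ _ _
    rcases lt_append_zero_iff.1 h with h | h
    · rwa [h] at h1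
    · exact h1.trans h
  have hex : ∃ N, T.nextCorner^[N] ([], 0) = (p, 0) := by
    by_contra! hne
    have hkey := fun n => hinv n fun m _ => hne m
    have hmono : StrictMono fun n => key (T.nextCorner^[n] ([], 0)) := by
      refine strictMono_nat_of_lt_succ fun n => ?_
      rw [Function.iterate_succ_apply']
      exact (key_lt_key_nextCorner hp (isCorner_iterate_nextCorner T n) (hkey n)).1
    refine (Set.infinite_of_injective_forall_mem (f := fun n => T.nextCorner^[n] ([], 0))
      (s := ⋃ v ∈ {v | (T.lab v).isSome ∧ v < p}, (fun j => (v, j)) '' Set.Iic (T.deg v))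
      (fun m n h => hmono.injective (congrArg key h)) fun n => ?_)
      (hfin.biUnion fun v _ => (Set.finite_Iic _).image _)
    simp only [Set.mem_iUnion]
    exact ⟨_, ⟨(isCorner_iterate_nextCorner T n).1, hvert n (hkey n)⟩, _,
      (isCorner_iterate_nextCorner T n).2, rfl⟩
  classical
  refine ⟨Nat.find hex, Nat.find_spec hex, fun m hm => hvert m (hinv m fun m' hm' => ?_)⟩
  exact Nat.find_min hex (by omega)

/-- The vertices met by the backward contour before the last corner of `q`: the strict ancestors of
`q` and the vertices on the right of the branch from `q` to the root. -/
def RightOf (q v : List ℕ) : Prop := (v <+: q ∧ v ≠ q) ∨ (q < v ∧ ¬ q <+: v)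

theorem rightOf_of_lt_key {T : LTree} {c : List ℕ × ℕ} {q : List ℕ} (hc : T.IsCorner c)
    (h : q ++ [T.deg q] < key c) : RightOf q c.1 := by
  obtain ⟨u, j⟩ := c
  obtain ⟨h1, h2⟩ := hc
  dsimp only [key] at h1 h2 h ⊢
  by_cases hq : q <+: u
  · exfalso
    obtain ⟨t, rfl⟩ := hq
    rcases t with _ | ⟨i, t⟩
    · simp only [List.append_nil] at h h2
      rw [append_lt_append_iff] at h
      simp [List.cons_lt_cons_iff] at h
      omega
    · rw [List.append_assoc, append_lt_append_iff] at h
      simp [List.cons_lt_cons_iff] at h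
      exact not_isSome_of_deg_le (by omega) h1
  · rcases lt_trichotomy q u with h' | h' | h'
    · exact Or.inr ⟨h', hq⟩
    · exact absurd (h' ▸ List.prefix_refl q) hq
    · rcases prefix_or_append_lt h' with h3 | h3
      · exact Or.inl ⟨h3, h'.ne⟩
      · exact absurd (h.trans (h3 _ _)) (lt_irrefl _)

/-- The prefix alternative accounts for the ancestors of the current vertex: the backward contour
meets them first, although they are smaller in the lexicographic order. -/
theorem exists_visit_of_rightOf_key {T : LTree} (n : ℕ) : ∀ v, (T.lab v).isSome →
    (v <+: (T.prevCorner^[n] ([], T.deg [])).1 ∨ ¬ v < key (T.prevCorner^[n] ([], T.deg []))) →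
    ∃ m ≤ n, (T.prevCorner^[m] ([], T.deg [])).1 = v := by
  induction n with
  | zero =>
    rintro v hvT (hv | hv)
    · exact ⟨0, le_rfl, (List.prefix_nil.1 hv).symm⟩
    · obtain ⟨i, w, hi, rfl⟩ := eq_cons_of_not_lt hv
      exact absurd hvT (not_isSome_of_deg_le (u := []) hi)
  | succ n ih =>
    intro v hvT hv
    have hc := isCorner_iterate_prevCorner T n
    have hprev := Function.iterate_succ_apply' T.prevCorner n ([], T.deg [])
    by_cases hold : v <+: (T.prevCorner^[n] ([], T.deg [])).1 ∨
        ¬ v < key (T.prevCorner^[n] ([], T.deg []))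
    · obtain ⟨m, hm, h⟩ := ih v hvT hold
      exact ⟨m, by omega, h⟩
    rw [hprev] at hv
    suffices h : v = (T.prevCorner (T.prevCorner^[n] ([], T.deg []))).1 from
      ⟨n + 1, le_rfl, by rw [hprev, h]⟩
    generalize T.prevCorner^[n] ([], T.deg []) = c at *
    obtain ⟨u, j⟩ := c
    obtain ⟨h1, h2⟩ := hc
    dsimp only [key] at h1 h2 hold
    simp only [not_or, not_not] at hold
    rcases j with _ | j
    · rcases List.eq_nil_or_concat' u with rfl | ⟨u, r, rfl⟩
      · cases v <;> simp [List.cons_lt_cons_iff] at hold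
      · exfalso
        rw [prevCorner_append] at hv
        rcases lt_append_zero_iff.1 hold.2 with rfl | hlt
        · exact hold.1 (List.prefix_refl _)
        · rcases hv with hv | hv
          · exact hold.1 (hv.trans (List.prefix_append _ _))
          · exact hv hlt
    · rw [prevCorner_succ] at hv ⊢
      rcases hv with hv | hv
      · exact (List.prefix_concat_iff.1 hv).resolve_right hold.1
      · exfalso
        obtain ⟨i, w, hi, rfl⟩ := eq_append_of_between (by simpa [key] using hv) hold.2
        exact not_isSome_of_deg_le (u := u ++ [j]) hi (by simpa using hvT)

theorem key_prevCorner_lt_key {T : LTree} {c : List ℕ × ℕ} {q : List ℕ} (hq : (T.lab q).isSome)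
    (hcq : q ++ [T.deg q] < key c) :
    key (T.prevCorner c) < key c ∧
      (q ++ [T.deg q] < key (T.prevCorner c) ∨ T.prevCorner c = (q, T.deg q)) := by
  obtain ⟨u, j⟩ := c
  dsimp only [key] at hcq ⊢
  have hcase : ∀ c' : List ℕ × ℕ, ¬ q ++ [T.deg q] < c'.1 ++ [c'.2] →
      c' = (q, T.deg q) ∨ c'.1 ++ [c'.2] < q ++ [T.deg q] := by
    intro c' h
    rcases lt_trichotomy (q ++ [T.deg q]) (c'.1 ++ [c'.2]) with h' | h' | h'
    · exact absurd h' h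
    · left
      have := List.append_inj' h' rfl
      simp only [List.cons.injEq, and_true] at this
      exact Prod.ext this.1.symm this.2.symm
    · exact Or.inr h'
  rcases j with _ | j
  · rcases List.eq_nil_or_concat' u with rfl | ⟨u, r, rfl⟩
    · exfalso
      rcases lt_append_zero_iff.1 hcq with h | h <;> simp at h
    · rw [prevCorner_append]
      refine ⟨lt_append_cons _ _ _, ?_⟩
      rcases lt_append_zero_iff.1 hcq with h | h
      · right
        have := List.append_inj' h rfl
        simp only [List.cons.injEq, and_true] at this
        exact Prod.ext this.1.symm this.2.symm
      · exact Or.inl h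
  · rw [prevCorner_succ]
    refine ⟨?_, ?_⟩
    · rw [List.append_assoc, append_lt_append_iff]
      simp [List.cons_lt_cons_iff]
    · by_contra hcon
      simp only [not_or] at hcon
      rcases hcase (u ++ [j], T.deg (u ++ [j])) hcon.1 with h | h
      · exact hcon.2 h
      · obtain ⟨i, w, hi, hw⟩ := eq_append_of_between (by simpa using h.not_gt) hcq
        rcases List.eq_nil_or_concat' w with rfl | ⟨w, d, rfl⟩
        · have h3 := List.append_inj' (show q ++ [T.deg q] = (u ++ [j]) ++ [i] by simpa using hw) rfl
          simp only [List.cons.injEq, and_true] at h3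
          obtain ⟨rfl, h4⟩ := h3
          exact hcon.2 rfl
        · have h3 := List.append_inj'
            (show q ++ [T.deg q] = ((u ++ [j]) ++ i :: w) ++ [d] by simpa using hw) rfl
          obtain ⟨rfl, -⟩ := h3
          exact not_isSome_of_deg_le (u := u ++ [j]) hi hq

/-- The backward contour is started from the code `([], T.deg [])` of the root-corner, so that keys
decrease; finiteness again forces it to reach the last corner of `q`. -/
theorem exists_iterate_prevCorner_eq {T : LTree} {q : List ℕ} (hq : (T.lab q).isSome)
    (hfin : {v | (T.lab v).isSome ∧ RightOf q v}.Finite) :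
    ∃ N, T.prevCorner^[N] ([], T.deg []) = (q, T.deg q) ∧
      ∀ m < N, RightOf q (T.prevCorner^[m] ([], T.deg [])).1 := by
  have hinv : ∀ n, (∀ m ≤ n, T.prevCorner^[m] ([], T.deg []) ≠ (q, T.deg q)) →
      q ++ [T.deg q] < key (T.prevCorner^[n] ([], T.deg [])) := by
    intro n
    induction n with
    | zero =>
      intro h
      have hq0 : q ≠ [] := by rintro rfl; exact h 0 le_rfl rfl
      obtain ⟨i, w, rfl⟩ := List.exists_cons_of_ne_nil hq0
      have : i < T.deg [] := lt_deg_iff.2 (isSome_of_append (w := w) (by simpa using hq))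
      exact List.cons_lt_cons_iff.2 (Or.inl this)
    | succ n ih =>
      intro h
      have h' := h (n + 1) le_rfl
      rw [Function.iterate_succ_apply'] at h' ⊢
      exact (key_prevCorner_lt_key hq (ih fun m hm => h m (by omega))).2.resolve_right h'
  have hex : ∃ N, T.prevCorner^[N] ([], T.deg []) = (q, T.deg q) := by
    by_contra! hne
    have hkey := fun n => hinv n fun m _ => hne m
    have hanti : StrictAnti fun n => key (T.prevCorner^[n] ([], T.deg [])) := by
      refine strictAnti_nat_of_succ_lt fun n => ?_
      rw [Function.iterate_succ_apply']
      exact (key_prevCorner_lt_key hq (hkey n)).1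
    refine (Set.infinite_of_injective_forall_mem (f := fun n => T.prevCorner^[n] ([], T.deg []))
      (s := ⋃ v ∈ {v | (T.lab v).isSome ∧ RightOf q v}, (fun j => (v, j)) '' Set.Iic (T.deg v))
      (fun m n h => hanti.injective (congrArg key h)) fun n => ?_)
      (hfin.biUnion fun v _ => (Set.finite_Iic _).image _)
    simp only [Set.mem_iUnion]
    have hc := isCorner_iterate_prevCorner T n
    exact ⟨_, ⟨hc.1, rightOf_of_lt_key hc (hkey n)⟩, _, hc.2, rfl⟩
  classical
  refine ⟨Nat.find hex, Nat.find_spec hex, fun m hm =>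
    rightOf_of_lt_key (isCorner_iterate_prevCorner T m) (hinv m fun m' hm' => ?_)⟩
  exact Nat.find_min hex (by omega)

theorem cornerVertex_natCast (T : LTree) (n : ℕ) :
    T.cornerVertex n = (T.nextCorner^[n] ([], 0)).1 := rfl

theorem cornerVertex_neg_natCast (T : LTree) (n : ℕ) :
    T.cornerVertex (-(n : ℤ)) = (T.prevCorner^[n] ([], T.deg [])).1 := by
  -- The two codes of the root-corner have the same predecessor, so the change of starting point is
  -- harmless.
  have key : T.prevCorner ([], 0) = T.prevCorner ([], T.deg []) := by
    rw [prevCorner_root]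
    split_ifs with h
    · obtain ⟨d, hd⟩ := Nat.exists_eq_succ_of_ne_zero h.ne'
      rw [hd]
      simp [prevCorner]
    · rw [show T.deg [] = 0 by omega, prevCorner_root, if_neg h]
  cases n with
  | zero => rfl
  | succ n =>
    change (T.prevCorner^[n + 1] ([], 0)).1 = _
    rw [Function.iterate_succ_apply, Function.iterate_succ_apply, key]

/-! ### Characterization of the two points -/

theorem ptE_eq {T : LTree} {k : ℕ} {p : List ℕ} (hp : (T.lab p).isSome) (hl : T.label p = -k)
    (hfin : {v | (T.lab v).isSome ∧ v < p}.Finite)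
    (hne : ∀ v, (T.lab v).isSome → v < p → T.label v ≠ -k) : T.ptE k = p := by
  obtain ⟨N, hN, hlt⟩ := exists_iterate_nextCorner_eq hp hfin
  have : IsLeast {n : ℕ | T.label (T.cornerVertex n) = -k} N := by
    refine ⟨?_, fun m hm => ?_⟩
    · simp only [cornerVertex_natCast, Set.mem_ofPred_eq, hN, hl]
    · by_contra hmN
      exact hne _ (isCorner_iterate_nextCorner T m).1 (hlt m (by omega)) hm
  rw [ptE, this.csInf_eq, cornerVertex_natCast, hN]

/-- The hypothesis excludes the default value: the infimum of the empty set is `0`, which gives the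
root. -/
theorem ptE_spec {T : LTree} {k : ℕ} (h : T.ptE k ≠ []) :
    (T.lab (T.ptE k)).isSome ∧ T.label (T.ptE k) = -k ∧
      {v | (T.lab v).isSome ∧ v < T.ptE k}.Finite ∧
      ∀ v, (T.lab v).isSome → v < T.ptE k → T.label v ≠ -k := by
  have hS : {n : ℕ | T.label (T.cornerVertex n) = -k}.Nonempty := by
    by_contra hS
    rw [Set.not_nonempty_iff_eq_empty] at hS
    apply h
    rw [ptE, hS, Nat.sInf_empty]
    rfl
  set N := sInf {n : ℕ | T.label (T.cornerVertex n) = -k} with hN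
  have hp : T.ptE k = (T.nextCorner^[N] ([], 0)).1 := rfl
  have hvis : ∀ v, (T.lab v).isSome → v < T.ptE k →
      ∃ m ≤ N, (T.nextCorner^[m] ([], 0)).1 = v := fun v hvT hv =>
    exists_visit_of_lt_key N v hvT (hv.trans (by rw [hp]; exact lt_append_cons _ _ _))
  refine ⟨by rw [hp]; exact (isCorner_iterate_nextCorner T N).1, Nat.sInf_mem hS, ?_, ?_⟩
  · refine ((Set.finite_Iic N).image fun m => (T.nextCorner^[m] ([], 0)).1).subset ?_
    rintro v ⟨hvT, hv⟩
    exact hvis v hvT hv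
  · intro v hvT hv hl
    obtain ⟨m, hm, rfl⟩ := hvis v hvT hv
    have h1 : N ≤ m := Nat.sInf_le hl
    obtain rfl : m = N := le_antisymm hm h1
    rw [hp] at hv
    exact lt_irrefl _ hv

theorem ptE'_eq {T : LTree} {k : ℕ} {q : List ℕ} (hq : (T.lab q).isSome)
    (hl : T.label q = -k + 1) (hfin : {v | (T.lab v).isSome ∧ RightOf q v}.Finite)
    (hne : ∀ v, (T.lab v).isSome → RightOf q v → T.label v ≠ -k + 1) : T.ptE' k = q := by
  obtain ⟨N, hN, hlt⟩ := exists_iterate_prevCorner_eq hq hfin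
  have : IsLeast {n : ℕ | T.label (T.cornerVertex (-(n : ℤ))) = -k + 1} N := by
    refine ⟨?_, fun m hm => ?_⟩
    · simp only [cornerVertex_neg_natCast, Set.mem_ofPred_eq, hN, hl]
    · simp only [cornerVertex_neg_natCast, Set.mem_ofPred_eq] at hm
      by_contra hmN
      exact hne _ (isCorner_iterate_prevCorner T m).1 (hlt m (by omega)) hm
  rw [ptE', this.csInf_eq, cornerVertex_neg_natCast, hN]

theorem not_rightOf_self (q : List ℕ) : ¬ RightOf q q := by
  rintro (⟨-, h⟩ | ⟨h, -⟩)
  · exact h rfl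
  · exact lt_irrefl _ h

theorem ptE'_spec {T : LTree} {k : ℕ} (h : T.ptE' k ≠ []) :
    (T.lab (T.ptE' k)).isSome ∧ T.label (T.ptE' k) = -k + 1 ∧
      {v | (T.lab v).isSome ∧ RightOf (T.ptE' k) v}.Finite ∧
      ∀ v, (T.lab v).isSome → RightOf (T.ptE' k) v → T.label v ≠ -k + 1 := by
  have hS : {n : ℕ | T.label (T.cornerVertex (-(n : ℤ))) = -k + 1}.Nonempty := by
    by_contra hS
    rw [Set.not_nonempty_iff_eq_empty] at hS
    apply h
    rw [ptE', hS, Nat.sInf_empty]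
    rfl
  set N := sInf {n : ℕ | T.label (T.cornerVertex (-(n : ℤ))) = -k + 1} with hN
  have hq : T.ptE' k = (T.prevCorner^[N] ([], T.deg [])).1 := by
    rw [ptE', cornerVertex_neg_natCast]
  have hvis : ∀ v, (T.lab v).isSome → RightOf (T.ptE' k) v →
      ∃ m ≤ N, (T.prevCorner^[m] ([], T.deg [])).1 = v := by
    intro v hvT hv
    refine exists_visit_of_rightOf_key N v hvT ?_
    rw [hq] at hv
    rcases hv with ⟨hv, -⟩ | ⟨hv, hv'⟩
    · exact Or.inl hv
    · right
      have := (prefix_or_append_lt hv).resolve_left hv' [(T.prevCorner^[N] ([], T.deg [])).2] []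
      rw [List.append_nil] at this
      exact this.not_gt
  refine ⟨by rw [hq]; exact (isCorner_iterate_prevCorner T N).1, Nat.sInf_mem hS, ?_, ?_⟩
  · refine ((Set.finite_Iic N).image fun m => (T.prevCorner^[m] ([], T.deg [])).1).subset ?_
    rintro v ⟨hvT, hv⟩
    exact hvis v hvT hv
  · intro v hvT hv hl
    obtain ⟨m, hm, rfl⟩ := hvis v hvT hv
    have h1 : N ≤ m := Nat.sInf_le (by simpa [cornerVertex_neg_natCast] using hl)
    obtain rfl : m = N := le_antisymm hm h1
    rw [← hq] at hv
    exact not_rightOf_self _ hv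

/-- A set of vertices which is closed under taking parents. -/
theorem label_gt_of_ne {T : LTree} {m : ℤ} {S : List ℕ → Prop}
    (hS : ∀ u i, S (u ++ [i]) → S u) (h0 : m < T.label [])
    (hne : ∀ v, (T.lab v).isSome → S v → T.label v ≠ m) :
    ∀ v, (T.lab v).isSome → S v → m < T.label v := by
  intro v
  induction v using List.reverseRecOn with
  | nil => exact fun _ _ => h0
  | append_singleton v i ih =>
    intro hvT hv
    have h1 := isSome_of_append hvT
    have h2 := ih h1 (hS _ _ hv)
    -- Labels vary by at most one along an edge, so they cannot pass below `m` without taking the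
    -- value `m`.
    have h3 := hne _ hvT hv
    have h4 := T.well_labeled v i _ _ (some_label h1).symm (some_label hvT).symm
    rw [abs_le] at h4
    omega

theorem rightOf_parent {q u : List ℕ} {i : ℕ} (h : RightOf q (u ++ [i])) : RightOf q u := by
  rcases h with ⟨h, -⟩ | ⟨h, h'⟩
  · refine Or.inl ⟨(List.prefix_append _ _).trans h, ?_⟩
    rintro rfl
    simpa using h.length_le
  · rcases lt_trichotomy q u with h1 | h1 | h1
    · exact Or.inr ⟨h1, fun h2 => h' (h2.trans (List.prefix_append _ _))⟩
    · exact absurd (h1 ▸ List.prefix_append _ _) h'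
    · rcases prefix_or_append_lt h1 with h2 | h2
      · exact Or.inl ⟨h2, h1.ne⟩
      · have := h2 [i] []
        rw [List.append_nil] at this
        exact absurd (h.trans this) (lt_irrefl _)

/-! ### Branches and the pieces along them -/

theorem anc_append_of_le {r s : List ℕ} {t : ℕ} (h : t ≤ s.length) :
    anc (r ++ s) t = r ++ anc s t := by
  rw [anc, anc, List.length_append, Nat.add_sub_assoc h, List.take_length_add_append]

theorem anc_append_add (r s : List ℕ) (t : ℕ) : anc (r ++ s) (s.length + t) = anc r t := by
  rw [anc, anc, List.length_append, show r.length + s.length - (s.length + t) = r.length - t by omega,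
    List.take_append_of_le_length (by omega)]

theorem branchRank_append_of_le {r s : List ℕ} {t : ℕ} (h : t ≤ s.length) :
    branchRank (r ++ s) t = branchRank s t := by
  rw [branchRank, branchRank, List.length_append, Nat.add_sub_assoc h, List.getD_append_right _ _ _ _
    (by omega)]
  congr 1; omega

theorem branchRank_append_add {r : List ℕ} (s : List ℕ) {t : ℕ} (h1 : 1 ≤ t) (h2 : t ≤ r.length) :
    branchRank (r ++ s) (s.length + t) = branchRank r t := by
  rw [branchRank, branchRank, List.length_append,
    show r.length + s.length - (s.length + t) = r.length - t by omega,
    List.getD_append _ _ _ _ (by omega)]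

@[simp] theorem anc_length (u : List ℕ) : anc u u.length = [] := by simp [anc]

theorem anc_cons_length (i : ℕ) (u : List ℕ) : anc (i :: u) (u.length + 1) = [] := by simp [anc]

theorem branchRank_cons_length (i : ℕ) (u : List ℕ) :
    branchRank (i :: u) (u.length + 1) = i := by simp [branchRank]

theorem anc_cons_of_le {i : ℕ} {u : List ℕ} {t : ℕ} (h : t ≤ u.length) :
    anc (i :: u) t = i :: anc u t := anc_append_of_le (r := [i]) h

theorem branchRank_cons_of_le {i : ℕ} {u : List ℕ} {t : ℕ} (h : t ≤ u.length) :
    branchRank (i :: u) t = branchRank u t := branchRank_append_of_le (r := [i]) h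

theorem exists_eq_anc_append (p : List ℕ) {t : ℕ} (h1 : 1 ≤ t) (h2 : t ≤ p.length) :
    ∃ s, p = anc p t ++ branchRank p t :: s := by
  refine ⟨p.drop (p.length - t + 1), ?_⟩
  have hlt : p.length - t < p.length := by omega
  rw [anc, branchRank, List.getD_eq_getElem _ _ hlt, ← List.drop_eq_getElem_cons hlt,
    List.take_append_drop]

theorem anc_prefix (p : List ℕ) (t : ℕ) : anc p t <+: p := List.take_prefix _ _

/-- The tree of the descendants of `u`. -/
def sub (T : LTree) (u : List ℕ) : LTree := T.piece u 0 (T.deg u)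

/-- The tree on the left of the branch from `e` to the root, at the `t`-th ancestor of `e`. -/
def leftAt (T : LTree) (e : List ℕ) (t : ℕ) : LTree := T.piece (anc e t) 0 (branchRank e t)

/-- The tree on the right of the branch from `e` to the root, at the `t`-th ancestor of `e`. -/
def rightAt (T : LTree) (e : List ℕ) (t : ℕ) : LTree :=
  T.piece (anc e t) (branchRank e t + 1) (T.deg (anc e t))

theorem sub_lab {T : LTree} {u : List ℕ} (h : (T.lab u).isSome) (v : List ℕ) :
    (T.sub u).lab v = T.lab (u ++ v) := by
  cases v with
  | nil => rw [List.append_nil]; exact some_label h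
  | cons i w =>
    simp only [sub, piece, pieceLab]
    split_ifs with hi
    · simp
    · rw [lab_append_cons_eq_none (by omega)]

theorem sub_label {T : LTree} {u : List ℕ} (h : (T.lab u).isSome) (v : List ℕ) :
    (T.sub u).label v = T.label (u ++ v) := by
  rw [label, label, sub_lab h]

theorem deg_sub {T : LTree} {u : List ℕ} (h : (T.lab u).isSome) (v : List ℕ) :
    (T.sub u).deg v = T.deg (u ++ v) :=
  deg_eq_of fun i => by rw [sub_lab h, ← List.append_assoc, lt_deg_iff]

theorem piece_sub {T : LTree} {u : List ℕ} (h : (T.lab u).isSome) (v : List ℕ) (lo hi : ℕ) :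
    (T.sub u).piece v lo hi = T.piece (u ++ v) lo hi := by
  ext1
  funext w
  cases w with
  | nil => simp [piece, pieceLab, sub_label h]
  | cons i w => simp [piece, pieceLab, sub_lab h]

theorem sub_sub {T : LTree} {u : List ℕ} (h : (T.lab u).isSome) (v : List ℕ) :
    (T.sub u).sub v = T.sub (u ++ v) := by
  rw [sub, piece_sub h, deg_sub h]; rfl

theorem sub_nil (T : LTree) : T.sub [] = T := by
  ext1
  funext v
  rw [sub_lab T.root_mem, List.nil_append]

theorem childTree_eq_sub (T : LTree) (i : ℕ) : T.childTree i = T.sub [i] := rfl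

theorem leftAt_sub {T : LTree} {r s : List ℕ} (h : (T.lab r).isSome) {t : ℕ} (ht : t ≤ s.length) :
    (T.sub r).leftAt s t = T.leftAt (r ++ s) t := by
  rw [leftAt, leftAt, piece_sub h, anc_append_of_le ht, branchRank_append_of_le ht]

theorem rightAt_sub {T : LTree} {r s : List ℕ} (h : (T.lab r).isSome) {t : ℕ} (ht : t ≤ s.length) :
    (T.sub r).rightAt s t = T.rightAt (r ++ s) t := by
  rw [rightAt, rightAt, piece_sub h, deg_sub h, anc_append_of_le ht, branchRank_append_of_le ht]

theorem leftAt_append_add {T : LTree} {r : List ℕ} (s : List ℕ) {t : ℕ} (h1 : 1 ≤ t)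
    (h2 : t ≤ r.length) : T.leftAt (r ++ s) (s.length + t) = T.leftAt r t := by
  rw [leftAt, leftAt, anc_append_add, branchRank_append_add s h1 h2]

theorem rightAt_append_add {T : LTree} {r : List ℕ} (s : List ℕ) {t : ℕ} (h1 : 1 ≤ t)
    (h2 : t ≤ r.length) : T.rightAt (r ++ s) (s.length + t) = T.rightAt r t := by
  rw [rightAt, rightAt, anc_append_add, branchRank_append_add s h1 h2]

theorem leftAt_cons_length (T : LTree) (i : ℕ) (u : List ℕ) :
    T.leftAt (i :: u) (u.length + 1) = T.leftPiece i := by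
  rw [leftAt, anc_cons_length, branchRank_cons_length]; rfl

theorem rightAt_cons_length (T : LTree) (i : ℕ) (u : List ℕ) :
    T.rightAt (i :: u) (u.length + 1) = T.rightPiece i := by
  rw [rightAt, anc_cons_length, branchRank_cons_length]; rfl

/-! ### Trees with a marked branch -/

/-- The trees with a marked vertex at height `n`, whose subtree belongs to `B`, such that the trees
on the left and on the right of the branch at its `t`-th ancestor belong to `L t` and `R t`. -/
def chain (B : Set LTree) (L R : ℕ → Set LTree) : ℕ → Set LTree
  | 0 => B
  | n + 1 => split (L (n + 1)) (chain B L R n) (R (n + 1))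

theorem measurableSet_chain {B : Set LTree} {L R : ℕ → Set LTree} (hB : MeasurableSet B)
    (hL : ∀ t, MeasurableSet (L t)) (hR : ∀ t, MeasurableSet (R t)) (n : ℕ) :
    MeasurableSet (chain B L R n) := by
  induction n with
  | zero => exact hB
  | succ n ih => exact measurableSet_split (hL _) ih (hR _)

/-- The recursive form on the left suits the product formula; the marked vertex with its ancestors
on the right suits the contour. -/
theorem mem_chain {B : Set LTree} {L R : ℕ → Set LTree} {n : ℕ} : ∀ {T : LTree},
    T ∈ chain B L R n ↔ ∃ u : List ℕ, u.length = n ∧ (T.lab u).isSome ∧ T.sub u ∈ B ∧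
      ∀ t, 1 ≤ t → t ≤ n → T.leftAt u t ∈ L t ∧ T.rightAt u t ∈ R t := by
  induction n with
  | zero =>
    intro T
    constructor
    · intro h
      exact ⟨[], rfl, T.root_mem, by rwa [sub_nil], fun t h1 h2 => by omega⟩
    · rintro ⟨u, hu, -, h, -⟩
      rw [List.length_eq_zero_iff] at hu
      subst hu
      rwa [sub_nil] at h
  | succ n ih =>
    intro T
    constructor
    · rintro ⟨i, hi, h1, h2, h3⟩
      have hi' : (T.lab [i]).isSome := lt_deg_iff.1 hi
      obtain ⟨u, rfl, huT, huB, h⟩ := ih.1 h2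
      rw [childTree_eq_sub] at huT huB h
      refine ⟨i :: u, rfl, by rw [sub_lab hi'] at huT; exact huT,
        by rw [sub_sub hi'] at huB; exact huB, fun t ht1 ht2 => ?_⟩
      rcases ht2.eq_or_lt with rfl | ht2
      · rw [leftAt_cons_length, rightAt_cons_length]
        exact ⟨h1, h3⟩
      · have := h t ht1 (by omega)
        rw [leftAt_sub hi' (by omega), rightAt_sub hi' (by omega)] at this
        exact this
    · rintro ⟨u, hu, huT, huB, h⟩
      obtain ⟨i, u, rfl⟩ := List.exists_cons_of_length_eq_add_one hu
      simp only [List.length_cons, Nat.add_right_cancel_iff] at hu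
      subst hu
      have hi' : (T.lab [i]).isSome := isSome_of_append (w := u) huT
      have htop := h (u.length + 1) (by omega) le_rfl
      rw [leftAt_cons_length, rightAt_cons_length] at htop
      refine ⟨i, lt_deg_iff.2 hi', htop.1, ih.2 ⟨u, rfl, ?_, ?_, fun t ht1 ht2 => ?_⟩, htop.2⟩
      · rw [childTree_eq_sub, sub_lab hi']; exact huT
      · rw [childTree_eq_sub, sub_sub hi']; exact huB
      · rw [childTree_eq_sub, leftAt_sub hi' ht2, rightAt_sub hi' ht2]
        exact h t ht1 (by omega)

theorem leftPiece_rightPiece (T : LTree) (i j : ℕ) :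
    (T.rightPiece i).leftPiece j = T.piece [] (i + 1) (i + 1 + j) := by
  ext1
  funext u
  cases u with
  | nil => rw [leftPiece_lab_nil, rightPiece_lab_nil]; exact (some_label T.root_mem).symm
  | cons m w =>
    simp [piece, pieceLab]

theorem rightPiece_rightPiece (T : LTree) (i j : ℕ) :
    (T.rightPiece i).rightPiece j = T.rightPiece (i + 1 + j) := by
  ext1
  funext u
  cases u with
  | nil => simp
  | cons m w =>
    simp only [rightPiece_lab_cons]
    congr 2
    omega

/-- The second splitting takes place in the right piece of the first one, whose ranks restart at `i
+ 1`. -/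
theorem mem_split_split {A B C D E : Set LTree} {T : LTree} :
    T ∈ split A B (split C D E) ↔ ∃ i j, i < j ∧ j < T.deg [] ∧ T.leftPiece i ∈ A ∧
      T.childTree i ∈ B ∧ T.piece [] (i + 1) j ∈ C ∧ T.childTree j ∈ D ∧ T.rightPiece j ∈ E := by
  constructor
  · rintro ⟨i, hi, h1, h2, j, hj, h3, h4, h5⟩
    rw [deg_rightPiece] at hj
    refine ⟨i, i + 1 + j, by omega, by omega, h1, h2, ?_, ?_, ?_⟩
    · rwa [leftPiece_rightPiece] at h3
    · rwa [childTree_rightPiece (by omega)] at h4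
    · rwa [rightPiece_rightPiece] at h5
  · rintro ⟨i, j, hij, hj, h1, h2, h3, h4, h5⟩
    obtain ⟨m, rfl⟩ : ∃ m, j = i + 1 + m := ⟨j - (i + 1), by omega⟩
    refine ⟨i, by omega, h1, h2, m, by rw [deg_rightPiece]; omega, ?_, ?_, ?_⟩
    · rwa [leftPiece_rightPiece]
    · rwa [childTree_rightPiece (by omega)]
    · rwa [rightPiece_rightPiece]

/-- Two branches of lengths `a` and `b` started from the root. -/
def fork (L R X Y : ℕ → Set LTree) (a b : ℕ) : Set LTree :=
  split (L a) (chain (X 0) L X (a - 1)) (split (X a) (chain (Y 0) Y R (b - 1)) (R b))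

/-- Two branches of lengths `a` and `b`, grafted at height `c`. The trees on the left of the first
branch belong to the sets `L t`, those on the right of the second one to the sets `R t`, and the
trees between the two branches to the sets `X t` and `Y t`. -/
def trunk (L R X Y : ℕ → Set LTree) (a b c : ℕ) : Set LTree :=
  chain (fork L R X Y a b) (fun t => L (a + t)) (fun t => R (b + t)) c

/-- Below the branch point `r` the two branches have the same ancestors, numbered `a + t` from one
end and `b + t` from the other. Along the trunk only the trees outside the two branches remain. -/
theorem mem_trunk {L R X Y : ℕ → Set LTree} {a b c : ℕ} (ha : 1 ≤ a) (hb : 1 ≤ b) {T : LTree} :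
    T ∈ trunk L R X Y a b c ↔ ∃ r i p j q, r.length = c ∧ p.length + 1 = a ∧ q.length + 1 = b ∧
      i < j ∧ (T.lab (r ++ i :: p)).isSome ∧ (T.lab (r ++ j :: q)).isSome ∧
      (∀ t, 1 ≤ t → t ≤ a + c → T.leftAt (r ++ i :: p) t ∈ L t) ∧
      (∀ t, 1 ≤ t → t ≤ b + c → T.rightAt (r ++ j :: q) t ∈ R t) ∧
      T.sub (r ++ i :: p) ∈ X 0 ∧ (∀ t, 1 ≤ t → t < a → T.rightAt (r ++ i :: p) t ∈ X t) ∧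
      T.piece r (i + 1) j ∈ X a ∧
      T.sub (r ++ j :: q) ∈ Y 0 ∧ (∀ t, 1 ≤ t → t < b → T.leftAt (r ++ j :: q) t ∈ Y t) := by
  rw [trunk, mem_chain]
  constructor
  · rintro ⟨r, rfl, hrT, hf, htr⟩
    rw [fork, mem_split_split] at hf
    obtain ⟨i, j, hij, hj, h1, h2, h3, h4, h5⟩ := hf
    have hjT : ((T.sub r).lab [j]).isSome := lt_deg_iff.1 hj
    have hiT : ((T.sub r).lab [i]).isSome := lt_deg_iff.1 (hij.trans hj)
    obtain ⟨p, hp, hpT, hp0, hp1⟩ := mem_chain.1 h2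
    obtain ⟨q, hq, hqT, hq0, hq1⟩ := mem_chain.1 h4
    rw [childTree_eq_sub] at hpT hp0 hp1 hqT hq0 hq1
    rw [sub_lab hiT, sub_lab hrT] at hpT
    rw [sub_lab hjT, sub_lab hrT] at hqT
    rw [sub_sub hiT, sub_sub hrT] at hp0
    rw [sub_sub hjT, sub_sub hrT] at hq0
    refine ⟨r, i, p, j, q, rfl, by omega, by omega, hij, hpT, hqT, ?_, ?_, hp0, ?_, ?_, hq0, ?_⟩
    · intro t ht1 ht2
      rcases lt_trichotomy t a with h | rfl | h
      · have := (hp1 t ht1 (by omega)).1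
        rw [leftAt_sub hiT (by omega), leftAt_sub hrT (by simp; omega)] at this
        exact this
      · rw [← leftAt_sub hrT (by simp; omega), show t = p.length + 1 by omega, leftAt_cons_length]
        rwa [show p.length + 1 = t by omega]
      · have := (htr (t - a) (by omega) (by omega)).1
        have e : t = (i :: p).length + (t - a) := by simp; omega
        rw [← leftAt_append_add (i :: p) (by omega) (by omega), ← e,
          show a + (t - a) = t by omega] at this
        exact this
    · intro t ht1 ht2
      rcases lt_trichotomy t b with h | rfl | h
      · have := (hq1 t ht1 (by omega)).2
        rw [rightAt_sub hjT (by omega), rightAt_sub hrT (by simp; omega)] at this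
        exact this
      · rw [← rightAt_sub hrT (by simp; omega), show t = q.length + 1 by omega, rightAt_cons_length]
        rwa [show q.length + 1 = t by omega]
      · have := (htr (t - b) (by omega) (by omega)).2
        have e : t = (j :: q).length + (t - b) := by simp; omega
        rw [← rightAt_append_add (j :: q) (by omega) (by omega), ← e,
          show b + (t - b) = t by omega] at this
        exact this
    · intro t ht1 ht2
      have := (hp1 t ht1 (by omega)).2
      rw [rightAt_sub hiT (by omega), rightAt_sub hrT (by simp; omega)] at this
      exact this
    · rwa [piece_sub hrT, List.append_nil] at h3
    · intro t ht1 ht2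
      have := (hq1 t ht1 (by omega)).1
      rw [leftAt_sub hjT (by omega), leftAt_sub hrT (by simp; omega)] at this
      exact this
  · rintro ⟨r, i, p, j, q, rfl, hp, hq, hij, hpT, hqT, hL, hR, hX0, hX, hXa, hY0, hY⟩
    have hrT : (T.lab r).isSome := isSome_of_append hpT
    have hiT : ((T.sub r).lab [i]).isSome := by
      rw [sub_lab hrT]; exact isSome_of_append (w := p) (by simpa using hpT)
    have hjT : ((T.sub r).lab [j]).isSome := by
      rw [sub_lab hrT]; exact isSome_of_append (w := q) (by simpa using hqT)
    refine ⟨r, rfl, hrT, ?_, fun t ht1 ht2 => ⟨?_, ?_⟩⟩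
    · rw [fork, mem_split_split]
      refine ⟨i, j, hij, lt_deg_iff.2 hjT, ?_, ?_, ?_, ?_, ?_⟩
      · have := hL a ha (by omega)
        rw [← leftAt_sub hrT (by simp; omega)] at this
        rwa [show (T.sub r).leftAt (i :: p) a = (T.sub r).leftPiece i by
          rw [← hp, leftAt_cons_length]] at this
      · refine mem_chain.2 ⟨p, by omega, ?_, ?_, fun t ht1 ht2 => ⟨?_, ?_⟩⟩
        · rw [childTree_eq_sub, sub_lab hiT, sub_lab hrT]; exact hpT
        · rw [childTree_eq_sub, sub_sub hiT, sub_sub hrT]; exact hX0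
        · rw [childTree_eq_sub, leftAt_sub hiT (by omega), leftAt_sub hrT (by simp; omega)]
          exact hL t ht1 (by omega)
        · rw [childTree_eq_sub, rightAt_sub hiT (by omega), rightAt_sub hrT (by simp; omega)]
          exact hX t ht1 (by omega)
      · rwa [piece_sub hrT, List.append_nil]
      · refine mem_chain.2 ⟨q, by omega, ?_, ?_, fun t ht1 ht2 => ⟨?_, ?_⟩⟩
        · rw [childTree_eq_sub, sub_lab hjT, sub_lab hrT]; exact hqT
        · rw [childTree_eq_sub, sub_sub hjT, sub_sub hrT]; exact hY0
        · rw [childTree_eq_sub, leftAt_sub hjT (by omega), leftAt_sub hrT (by simp; omega)]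
          exact hY t ht1 (by omega)
        · rw [childTree_eq_sub, rightAt_sub hjT (by omega), rightAt_sub hrT (by simp; omega)]
          exact hR t ht1 (by omega)
      · have := hR b hb (by omega)
        rw [← rightAt_sub hrT (by simp; omega)] at this
        rwa [show (T.sub r).rightAt (j :: q) b = (T.sub r).rightPiece j by
          rw [← hq, rightAt_cons_length]] at this
    · have := hL (a + t) (by omega) (by omega)
      rwa [show T.leftAt (r ++ i :: p) (a + t) = T.leftAt r t by
        rw [← leftAt_append_add (i :: p) ht1 ht2]; congr 1; simp; omega] at this
    · have := hR (b + t) (by omega) (by omega)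
      rwa [show T.rightAt (r ++ j :: q) (b + t) = T.rightAt r t by
        rw [← rightAt_append_add (j :: q) ht1 ht2]; congr 1; simp; omega] at this

/-! ### The vertices on the left and on the right of a branch -/

/-- The ancestor `anc p t` is the point where the branch to `v` leaves the branch to `p`. -/
theorem exists_of_lt {p : List ℕ} : ∀ {v : List ℕ}, v < p → ∃ t, 1 ≤ t ∧ t ≤ p.length ∧
    (v = anc p t ∨ ∃ i w, i < branchRank p t ∧ v = anc p t ++ i :: w) := by
  induction p with
  | nil => intro v h; simp at h
  | cons j p ih =>
    intro v h
    rcases v with _ | ⟨i, v⟩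
    · exact ⟨p.length + 1, by omega, le_rfl, Or.inl (anc_cons_length j p).symm⟩
    · rcases List.cons_lt_cons_iff.1 h with h' | ⟨rfl, h'⟩
      · refine ⟨p.length + 1, by omega, le_rfl, Or.inr ⟨i, v, ?_, ?_⟩⟩
        · rwa [branchRank_cons_length]
        · rw [anc_cons_length]; rfl
      · obtain ⟨t, ht1, ht2, h3⟩ := ih h'
        refine ⟨t, ht1, ht2.trans (Nat.le_succ _), ?_⟩
        rw [anc_cons_of_le ht2, branchRank_cons_of_le ht2]
        rcases h3 with rfl | ⟨i', w, h4, rfl⟩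
        · exact Or.inl rfl
        · exact Or.inr ⟨i', w, h4, rfl⟩

theorem exists_of_rightOf {q : List ℕ} : ∀ {v : List ℕ}, RightOf q v → ∃ t, 1 ≤ t ∧
    t ≤ q.length ∧ (v = anc q t ∨ ∃ i w, branchRank q t < i ∧ v = anc q t ++ i :: w) := by
  induction q with
  | nil =>
    rintro v (⟨h, h'⟩ | ⟨-, h⟩)
    · exact absurd (List.prefix_nil.1 h) h'
    · exact absurd (List.nil_prefix) h
  | cons j q ih =>
    intro v h
    rcases v with _ | ⟨i, v⟩
    · exact ⟨q.length + 1, by omega, le_rfl, Or.inl (anc_cons_length j q).symm⟩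
    · by_cases hij : i = j
      · subst hij
        have h' : RightOf q v := by
          simpa [RightOf, List.cons_prefix_cons, List.cons_lt_cons_iff] using h
        obtain ⟨t, ht1, ht2, h3⟩ := ih h'
        refine ⟨t, ht1, ht2.trans (Nat.le_succ _), ?_⟩
        rw [anc_cons_of_le ht2, branchRank_cons_of_le ht2]
        rcases h3 with rfl | ⟨i', w, h4, rfl⟩
        · exact Or.inl rfl
        · exact Or.inr ⟨i', w, h4, rfl⟩
      · refine ⟨q.length + 1, by omega, le_rfl, Or.inr ⟨i, v, ?_, ?_⟩⟩
        · rw [branchRank_cons_length]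
          rcases h with ⟨h, -⟩ | ⟨h, -⟩
          · exact absurd (List.cons_prefix_cons.1 h).1 hij
          · rcases List.cons_lt_cons_iff.1 h with h | ⟨h, -⟩
            · exact h
            · exact absurd h.symm hij
        · rw [anc_cons_length]; rfl

theorem anc_lt {p : List ℕ} {t : ℕ} (h1 : 1 ≤ t) (h2 : t ≤ p.length) : anc p t < p := by
  obtain ⟨s, hs⟩ := exists_eq_anc_append p h1 h2
  conv_rhs => rw [hs]
  exact lt_append_cons _ _ _

theorem anc_append_lt {p : List ℕ} {t i : ℕ} (h1 : 1 ≤ t) (h2 : t ≤ p.length)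
    (hi : i < branchRank p t) (w : List ℕ) : anc p t ++ i :: w < p := by
  obtain ⟨s, hs⟩ := exists_eq_anc_append p h1 h2
  conv_rhs => rw [hs]
  rw [append_lt_append_iff]
  exact List.cons_lt_cons_iff.2 (Or.inl hi)

theorem rightOf_anc {q : List ℕ} {t : ℕ} (h1 : 1 ≤ t) (h2 : t ≤ q.length) : RightOf q (anc q t) :=
  Or.inl ⟨anc_prefix q t, (anc_lt h1 h2).ne⟩

theorem rightOf_anc_append {q : List ℕ} {t i : ℕ} (h1 : 1 ≤ t) (h2 : t ≤ q.length)
    (hi : branchRank q t < i) (w : List ℕ) : RightOf q (anc q t ++ i :: w) := by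
  obtain ⟨s, hs⟩ := exists_eq_anc_append q h1 h2
  generalize anc q t = u at *
  generalize branchRank q t = j at *
  subst hs
  refine Or.inr ⟨?_, ?_⟩
  · rw [append_lt_append_iff]
    exact List.cons_lt_cons_iff.2 (Or.inl hi)
  · rw [List.prefix_append_right_inj, List.cons_prefix_cons]
    omega

/-- The vertex of `T` corresponding to a vertex of `T.piece u lo hi`. -/
def pieceVertex (u : List ℕ) (lo : ℕ) : List ℕ → List ℕ
  | [] => u
  | i :: w => u ++ (lo + i) :: w

theorem length_le_pieceVertex (u : List ℕ) (lo : ℕ) (v : List ℕ) :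
    v.length ≤ (pieceVertex u lo v).length := by
  cases v with
  | nil => exact Nat.zero_le _
  | cons i w => simp [pieceVertex]

/-- By local finiteness, bounded height means finitely many vertices. -/
theorem finite_vertices {n : ℕ} : ∀ {T : LTree}, T ∈ heightLE n →
    {u | (T.lab u).isSome}.Finite := by
  induction n with
  | zero =>
    intro T h
    refine (Set.finite_singleton []).subset fun u hu => ?_
    by_contra hne
    rw [Set.mem_ofPred_eq, h u (List.length_pos_iff.2 hne)] at hu
    simp at hu
  | succ n ih =>
    intro T h
    rw [heightLE_succ] at h
    refine ((Set.finite_singleton []).union ((Set.finite_Iio (T.deg [])).biUnion fun i hi =>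
      (ih (h i hi)).image (List.cons i))).subset fun u hu => ?_
    rcases u with _ | ⟨i, u⟩
    · exact Or.inl rfl
    · have hi : i < T.deg [] := lt_deg_iff.2 (isSome_of_append (u := [i]) (w := u) hu)
      refine Or.inr (Set.mem_biUnion hi ⟨u, ?_, rfl⟩)
      rw [Set.mem_ofPred_eq, childTree_lab hi]
      exact hu

/-- A common form for both sides of a branch: the maps `g t` send the vertices of the pieces onto
the vertices satisfying `P`, without decreasing heights. The latter bounds the heights of the pieces
when these vertices are finitely many. -/
theorem forall_pieces_iff {T : LTree} {m : ℤ} {P : List ℕ → Prop} {n : ℕ} {f : ℕ → LTree}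
    {g : ℕ → List ℕ → List ℕ}
    (h1 : ∀ v, (T.lab v).isSome → P v → ∃ t, 1 ≤ t ∧ t ≤ n ∧ ∃ u, g t u = v ∧ (f t).lab u = T.lab v)
    (h2 : ∀ t, 1 ≤ t → t ≤ n → ∀ u, ((f t).lab u).isSome →
      T.lab (g t u) = (f t).lab u ∧ P (g t u) ∧ u.length ≤ (g t u).length) :
    (∀ t, 1 ≤ t → t ≤ n → f t ∈ labelsAbove m ∩ finiteTrees) ↔
      {v | (T.lab v).isSome ∧ P v}.Finite ∧ ∀ v, (T.lab v).isSome → P v → m < T.label v := by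
  constructor
  · intro h
    constructor
    · refine ((Set.finite_Icc 1 n).biUnion (t := fun t => g t '' {u | ((f t).lab u).isSome})
        fun t ht => ?_).subset ?_
      · obtain ⟨N, hN⟩ := (h t ht.1 ht.2).2
        exact (finite_vertices hN).image _
      · rintro v ⟨hv, hP⟩
        obtain ⟨t, ht1, ht2, u, rfl, hu⟩ := h1 v hv hP
        exact Set.mem_biUnion (show t ∈ Set.Icc 1 n from ⟨ht1, ht2⟩)
          ⟨u, by rw [Set.mem_ofPred_eq, hu]; exact hv, rfl⟩
    · intro v hv hP
      obtain ⟨t, ht1, ht2, u, rfl, hu⟩ := h1 v hv hP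
      exact (h t ht1 ht2).1 u _ (hu.trans (some_label hv).symm)
  · rintro ⟨hfin, hlab⟩ t ht1 ht2
    constructor
    · intro u x hx
      obtain ⟨h3, h4, -⟩ := h2 t ht1 ht2 u (by rw [hx]; rfl)
      have hsome : (T.lab (g t u)).isSome := by rw [h3, hx]; rfl
      have := hlab _ hsome h4
      rw [← some_label hsome, hx] at h3
      rwa [Option.some.inj h3] at this
    · obtain ⟨N, hN⟩ := (hfin.image List.length).bddAbove
      refine ⟨N, fun u hu => ?_⟩
      by_contra hne
      have hsome : ((f t).lab u).isSome := Option.isSome_iff_ne_none.2 hne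
      obtain ⟨h3, h4, h5⟩ := h2 t ht1 ht2 u hsome
      have := hN ⟨g t u, ⟨by rw [h3]; exact hsome, h4⟩, rfl⟩
      omega

theorem forall_leftAt_iff {T : LTree} {m : ℤ} {p : List ℕ} (hp : (T.lab p).isSome) :
    (∀ t, 1 ≤ t → t ≤ p.length → T.leftAt p t ∈ labelsAbove m ∩ finiteTrees) ↔
      {v | (T.lab v).isSome ∧ v < p}.Finite ∧ ∀ v, (T.lab v).isSome → v < p → m < T.label v := by
  have hanc : ∀ t, (T.lab (anc p t)).isSome := fun t => by
    obtain ⟨w, hw⟩ := anc_prefix p t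
    rw [← hw] at hp
    exact isSome_of_append hp
  refine forall_pieces_iff (g := fun t => pieceVertex (anc p t) 0) ?_ ?_
  · intro v hv hlt
    obtain ⟨t, ht1, ht2, rfl | ⟨i, w, hi, rfl⟩⟩ := exists_of_lt hlt
    · exact ⟨t, ht1, ht2, [], rfl, some_label hv⟩
    · exact ⟨t, ht1, ht2, i :: w, by simp [pieceVertex], by simp [leftAt, piece, pieceLab, hi]⟩
  · intro t ht1 ht2 u hu
    refine ⟨?_, ?_, length_le_pieceVertex _ _ _⟩
    · cases u with
      | nil => exact (some_label (hanc t)).symm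
      | cons i w =>
        simp only [leftAt, piece, pieceLab] at hu ⊢
        split_ifs at hu ⊢
        · rfl
        · simp at hu
    · cases u with
      | nil => exact anc_lt ht1 ht2
      | cons i w =>
        simp only [leftAt, piece, pieceLab] at hu
        split_ifs at hu with hi
        · exact anc_append_lt ht1 ht2 hi w
        · simp at hu

theorem forall_rightAt_iff {T : LTree} {m : ℤ} {q : List ℕ} (hq : (T.lab q).isSome) :
    (∀ t, 1 ≤ t → t ≤ q.length → T.rightAt q t ∈ labelsAbove m ∩ finiteTrees) ↔
      {v | (T.lab v).isSome ∧ RightOf q v}.Finite ∧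
        ∀ v, (T.lab v).isSome → RightOf q v → m < T.label v := by
  have hanc : ∀ t, (T.lab (anc q t)).isSome := fun t => by
    obtain ⟨w, hw⟩ := anc_prefix q t
    rw [← hw] at hq
    exact isSome_of_append hq
  refine forall_pieces_iff (g := fun t => pieceVertex (anc q t) (branchRank q t + 1)) ?_ ?_
  · intro v hv hlt
    obtain ⟨t, ht1, ht2, rfl | ⟨i, w, hi, rfl⟩⟩ := exists_of_rightOf hlt
    · exact ⟨t, ht1, ht2, [], rfl, some_label hv⟩
    · have hi' : branchRank q t + 1 + (i - (branchRank q t + 1)) = i := by omega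
      have hd : i < T.deg (anc q t) :=
        lt_deg_iff.2 (isSome_of_append (w := w) (by simpa using hv))
      exact ⟨t, ht1, ht2, (i - (branchRank q t + 1)) :: w, by simp [pieceVertex, hi'],
        by simp [rightAt, piece, pieceLab, hi', hd]⟩
  · intro t ht1 ht2 u hu
    refine ⟨?_, ?_, length_le_pieceVertex _ _ _⟩
    · cases u with
      | nil => exact (some_label (hanc t)).symm
      | cons i w =>
        simp only [rightAt, piece, pieceLab] at hu ⊢
        split_ifs at hu ⊢
        · rfl
        · simp at hu
    · cases u with
      | nil => exact rightOf_anc ht1 ht2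
      | cons i w => exact rightOf_anc_append ht1 ht2 (by omega) w

/-! ### Shifting the labels -/

theorem isSome_shift {T : LTree} {x : ℤ} {u : List ℕ} :
    ((T.shift x).lab u).isSome = (T.lab u).isSome := by simp [shift]

theorem label_shift {T : LTree} {x : ℤ} {u : List ℕ} (h : (T.lab u).isSome) :
    (T.shift x).label u = T.label u + x := by
  obtain ⟨y, hy⟩ := Option.isSome_iff_exists.1 h
  simp [label, shift, hy]

theorem deg_shift (T : LTree) (x : ℤ) (u : List ℕ) : (T.shift x).deg u = T.deg u :=
  deg_eq_of fun i => by rw [isSome_shift, lt_deg_iff]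

/-- Outside the tree the default root-label `0` of a piece would not be shifted, so `u` has to be a
vertex. -/
theorem piece_shift {T : LTree} {x : ℤ} {u : List ℕ} (h : (T.lab u).isSome) (lo hi : ℕ) :
    (T.shift x).piece u lo hi = (T.piece u lo hi).shift x := by
  ext1
  funext w
  cases w with
  | nil =>
    change some ((T.shift x).label u) = (some (T.label u)).map (· + x)
    rw [label_shift h]; rfl
  | cons i w =>
    simp only [piece, pieceLab, shift]
    split_ifs <;> rfl

theorem exists_of_mrca_length_lt {p q : List ℕ} (h1 : (mrca p q).length < p.length)
    (h2 : (mrca p q).length < q.length) : ∃ r i p' j q', mrca p q = r ∧ p = r ++ i :: p' ∧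
      q = r ++ j :: q' ∧ i ≠ j := by
  induction p generalizing q with
  | nil => simp at h1
  | cons i p ih =>
    cases q with
    | nil => simp at h2
    | cons j q =>
      by_cases hij : i = j
      · subst hij
        simp only [mrca, if_true, List.length_cons, Nat.add_lt_add_iff_right] at h1 h2
        obtain ⟨r, i', p', j', q', h3, h4, h5, h6⟩ := ih h1 h2
        refine ⟨i :: r, i', p', j', q', ?_, ?_, ?_, h6⟩
        · simp [mrca, h3]
        · rw [h4]; rfl
        · rw [h5]; rfl
      · exact ⟨[], i, p, j, q, by simp [mrca, hij], rfl, rfl, hij⟩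

theorem mrca_append (r : List ℕ) {i j : ℕ} (p q : List ℕ) (h : i ≠ j) :
    mrca (r ++ i :: p) (r ++ j :: q) = r := by
  induction r with
  | nil => simp [mrca, h]
  | cons k r ih => simp [mrca, ih]

/-! ### The event that the three branches are prescribed -/

/-- The branches to the vertices `r ++ i :: p` and `r ++ j :: q` of `S` have the given lengths and
labels, those vertices have labels `0` and `1`, the vertices on the left of the first branch have
positive labels, those on the right of the second one have labels greater than `1`, and there are
finitely many of them. -/
structure IsMarked (S : LTree) (a b c : ℕ) (lx ly : ℕ → ℤ) (r : List ℕ) (i : ℕ) (p : List ℕ) (j : ℕ)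
    (q : List ℕ) : Prop where
  length_r : r.length = c
  length_p : p.length + 1 = a
  length_q : q.length + 1 = b
  lt : i < j
  mem_p : (S.lab (r ++ i :: p)).isSome
  mem_q : (S.lab (r ++ j :: q)).isSome
  label_p : S.label (r ++ i :: p) = 0
  label_q : S.label (r ++ j :: q) = 1
  left : {v | (S.lab v).isSome ∧ v < r ++ i :: p}.Finite ∧
    ∀ v, (S.lab v).isSome → v < r ++ i :: p → 0 < S.label v
  right : {v | (S.lab v).isSome ∧ RightOf (r ++ j :: q) v}.Finite ∧
    ∀ v, (S.lab v).isSome → RightOf (r ++ j :: q) v → 1 < S.label v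
  label_anc_p : ∀ t, 1 ≤ t → t ≤ a + c → S.label (anc (r ++ i :: p) t) = lx t
  label_anc_q : ∀ t, 1 ≤ t → t ≤ b + c → S.label (anc (r ++ j :: q) t) = ly t

theorem IsMarked.ptE_eq {T : LTree} {k a b c : ℕ} {lx ly : ℕ → ℤ} {r p q : List ℕ} {i j : ℕ}
    (h : IsMarked (T.shift k) a b c lx ly r i p j q) : T.ptE k = r ++ i :: p := by
  have hp := h.mem_p
  have hl := h.label_p
  have hleft := h.left
  simp only [isSome_shift] at hp hleft
  rw [label_shift hp] at hl
  refine LTree.ptE_eq hp (by omega) hleft.1 fun v hv hlt => ?_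
  have := hleft.2 v hv hlt
  rw [label_shift hv] at this
  omega

theorem IsMarked.ptE'_eq {T : LTree} {k a b c : ℕ} {lx ly : ℕ → ℤ} {r p q : List ℕ} {i j : ℕ}
    (h : IsMarked (T.shift k) a b c lx ly r i p j q) : T.ptE' k = r ++ j :: q := by
  have hp := h.mem_q
  have hl := h.label_q
  have hright := h.right
  simp only [isSome_shift] at hp hright
  rw [label_shift hp] at hl
  refine LTree.ptE'_eq hp (by omega) hright.1 fun v hv hlt => ?_
  have := hright.2 v hv hlt
  rw [label_shift hv] at this
  omega

theorem IsMarked.ptV_eq {T : LTree} {k a b c : ℕ} {lx ly : ℕ → ℤ} {r p q : List ℕ} {i j : ℕ}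
    (h : IsMarked (T.shift k) a b c lx ly r i p j q) : T.ptV k = r := by
  rw [ptV, h.ptE_eq, h.ptE'_eq, mrca_append _ _ _ h.lt.ne]

theorem anc_append_cons_add (r : List ℕ) (i : ℕ) (p : List ℕ) (t : ℕ) :
    anc (r ++ i :: p) (p.length + 1 + t) = anc r t := anc_append_add r (i :: p) t

/-- The contour is eliminated here: being the first or last corner with a given label becomes a
lower bound on the labels on one side of a branch, together with finiteness of that side. -/
theorem mem_branchSet_iff {k a b c : ℕ} (ha : 1 ≤ a) (hb : 1 ≤ b) (hc : 1 ≤ c) (hk : 1 < k)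
    {x y z : ℕ → ℤ} (hxz : x a = z 0) (hz : z c = k) {T : LTree} :
    T ∈ branchSet k a b c x y z ↔ ∃ r i p j q, IsMarked (T.shift k) a b c
      (fun t => if t ≤ a then x t else z (t - a)) (fun t => if t ≤ b then y t else z (t - b))
      r i p j q := by
  constructor
  · rintro ⟨h1, h2, h3, hX, hY, hZ⟩
    simp only [Finset.mem_Icc, and_imp] at hX hY hZ
    have hlp : (mrca (T.ptE k) (T.ptE' k)).length < (T.ptE k).length := by
      rw [brA, ptV] at h1; omega
    have hlq : (mrca (T.ptE k) (T.ptE' k)).length < (T.ptE' k).length := by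
      rw [brB, ptV] at h2; omega
    obtain ⟨r, i, p, j, q, hr, hp, hq, hij⟩ := exists_of_mrca_length_lt hlp hlq
    have hV : T.ptV k = r := hr
    -- Since `a` and `b` are positive, neither point is the root, so the default values do not
    -- occur.
    obtain ⟨hpT, hpl, hpfin, hpne⟩ := ptE_spec (T := T) (k := k) (by rw [hp]; simp)
    obtain ⟨hqT, hql, hqfin, hqne⟩ := ptE'_spec (T := T) (k := k) (by rw [hq]; simp)
    simp only [brA, brB, brC, labX, labY, labZ, hV, hp, hq] at *
    simp only [List.length_append, List.length_cons] at h1 h2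
    -- The root is the `c`-th ancestor of `v_k`, and its shifted label is `z c = k`. With `1 < k`,
    -- it lies above both target labels.
    have hroot : T.label [] = 0 := by
      have := hZ c (by omega) le_rfl
      rw [← h3, anc_length, h3, hz] at this
      omega
    have hpgt := label_gt_of_ne (S := fun v => v < r ++ i :: p)
      (fun u m h => (lt_append_cons u m []).trans h) (by omega) hpne
    have hqgt := label_gt_of_ne (S := fun v => RightOf (r ++ j :: q) v)
      (fun u m h => rightOf_parent h) (by omega) hqne
    -- Otherwise `e_k` would be on the right of the branch to `e_{-k+1}`, where all labels exceed
    -- `-k + 1`.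
    have hlt : i < j := by
      by_contra hnot
      have hji : j < i := by omega
      have hright : RightOf (r ++ j :: q) (r ++ i :: p) := by
        refine Or.inr ⟨?_, ?_⟩
        · rw [append_lt_append_iff]
          exact List.cons_lt_cons_iff.2 (Or.inl hji)
        · rw [List.prefix_append_right_inj, List.cons_prefix_cons]
          omega
      have := hqgt _ hpT hright
      omega
    have hanc : ∀ {e : List ℕ}, (T.lab e).isSome → ∀ t, (T.lab (anc e t)).isSome := by
      intro e he t
      obtain ⟨w, hw⟩ := anc_prefix e t
      rw [← hw] at he
      exact isSome_of_append he
    refine ⟨r, i, p, j, q, h3, by omega, by omega, hlt, by rwa [isSome_shift],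
      by rwa [isSome_shift], by rw [label_shift hpT]; omega, by rw [label_shift hqT]; omega,
      ⟨by simpa only [isSome_shift] using hpfin, fun v hv h => ?_⟩,
      ⟨by simpa only [isSome_shift] using hqfin, fun v hv h => ?_⟩, ?_, ?_⟩
    · rw [isSome_shift] at hv
      rw [label_shift hv]
      have := hpgt v hv h
      omega
    · rw [isSome_shift] at hv
      rw [label_shift hv]
      have := hqgt v hv h
      omega
    · intro t ht1 ht2
      rw [label_shift (hanc hpT t)]
      split_ifs with hta
      · exact hX t ht1 hta
      · have e : t = p.length + 1 + (t - a) := by omega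
        have := hZ (t - a) (by omega) (by omega)
        rw [← anc_append_cons_add r i p, ← e] at this
        exact this
    · intro t ht1 ht2
      rw [label_shift (hanc hqT t)]
      split_ifs with hta
      · exact hY t ht1 hta
      · have e : t = q.length + 1 + (t - b) := by omega
        have := hZ (t - b) (by omega) (by omega)
        rw [← anc_append_cons_add r j q, ← e] at this
        exact this
  · rintro ⟨r, i, p, j, q, h⟩
    have hE := h.ptE_eq
    have hE' := h.ptE'_eq
    have hV := h.ptV_eq
    have hpT := h.mem_p
    have hqT := h.mem_q
    rw [isSome_shift] at hpT hqT
    have hanc : ∀ {e : List ℕ}, (T.lab e).isSome → ∀ t, (T.lab (anc e t)).isSome := by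
      intro e he t
      obtain ⟨w, hw⟩ := anc_prefix e t
      rw [← hw] at he
      exact isSome_of_append he
    have l1 := h.length_p
    have l2 := h.length_q
    have l3 := h.length_r
    refine ⟨?_, ?_, ?_, ?_, ?_, ?_⟩
    · rw [brA, hE, hV]; simp; omega
    · rw [brB, hE', hV]; simp; omega
    · rw [brC, hV, l3]
    · intro t ht
      rw [Finset.mem_Icc] at ht
      have := h.label_anc_p t ht.1 (by omega)
      rw [labX, hE, ← label_shift (hanc hpT t), this]
      exact if_pos ht.2
    · intro t ht
      rw [Finset.mem_Icc] at ht
      have := h.label_anc_q t ht.1 (by omega)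
      rw [labY, hE', ← label_shift (hanc hqT t), this]
      exact if_pos ht.2
    · intro t ht
      rw [Finset.mem_Icc] at ht
      have := h.label_anc_p (a + t) (by omega) (by omega)
      rw [← l1, anc_append_cons_add] at this
      rw [labZ, hV, ← label_shift (hanc (isSome_of_append hpT) t), this, l1]
      rcases Nat.eq_zero_or_pos t with rfl | ht0
      · simp [hxz]
      · rw [if_neg (by omega)]
        congr 1; omega

/-! ### The grafted subtrees as pieces of the shifted tree -/

theorem isSome_anc {T : LTree} {e : List ℕ} (he : (T.lab e).isSome) (t : ℕ) :
    (T.lab (anc e t)).isSome := by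
  obtain ⟨w, hw⟩ := anc_prefix e t
  rw [← hw] at he
  exact isSome_of_append he

theorem leftTree_eq {T : LTree} {k : ℕ} {e : List ℕ} (he : (T.lab e).isSome) (t : ℕ) :
    T.leftTree k e t = (T.shift k).leftAt e t := by
  rw [leftTree, leftAt, piece_shift (isSome_anc he t)]

theorem rightTree_eq {T : LTree} {k : ℕ} {e : List ℕ} (he : (T.lab e).isSome) (t : ℕ) :
    T.rightTree k e t = (T.shift k).rightAt e t := by
  rw [rightTree, rightAt, piece_shift (isSome_anc he t), deg_shift]

theorem descTree_eq {T : LTree} {k : ℕ} {e : List ℕ} (he : (T.lab e).isSome) :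
    T.descTree k e = (T.shift k).sub e := by
  rw [descTree, sub, piece_shift he, deg_shift]

section

variable {T : LTree} {k a b c : ℕ} {lx ly : ℕ → ℤ} {r p q : List ℕ} {i j : ℕ}

theorem IsMarked.tau_eq (h : IsMarked (T.shift k) a b c lx ly r i p j q) (t : ℕ) :
    T.tau k t = (T.shift k).leftAt (r ++ i :: p) t := by
  have hp := h.mem_p
  rw [isSome_shift] at hp
  rw [tau, h.ptE_eq, leftTree_eq hp]

theorem IsMarked.tau'_eq (h : IsMarked (T.shift k) a b c lx ly r i p j q) (t : ℕ) :
    T.tau' k t = (T.shift k).rightAt (r ++ j :: q) t := by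
  have hq := h.mem_q
  rw [isSome_shift] at hq
  rw [tau', h.ptE'_eq, rightTree_eq hq]

theorem IsMarked.brA_eq (h : IsMarked (T.shift k) a b c lx ly r i p j q) : T.brA k = a := by
  rw [brA, h.ptE_eq, h.ptV_eq, ← h.length_p]; simp

theorem IsMarked.brB_eq (h : IsMarked (T.shift k) a b c lx ly r i p j q) : T.brB k = b := by
  rw [brB, h.ptE'_eq, h.ptV_eq, ← h.length_q]; simp

theorem IsMarked.tauBar_zero (h : IsMarked (T.shift k) a b c lx ly r i p j q) :
    T.tauBar k 0 = (T.shift k).sub (r ++ i :: p) := by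
  have hp := h.mem_p
  rw [isSome_shift] at hp
  rw [tauBar, if_pos rfl, h.ptE_eq, descTree_eq hp]

theorem IsMarked.tauBar_of_lt (h : IsMarked (T.shift k) a b c lx ly r i p j q) {t : ℕ}
    (h1 : 1 ≤ t) (h2 : t < a) : T.tauBar k t = (T.shift k).rightAt (r ++ i :: p) t := by
  have hp := h.mem_p
  rw [isSome_shift] at hp
  rw [tauBar, if_neg (by omega), h.brA_eq, if_neg (by omega), h.ptE_eq, rightTree_eq hp]

theorem IsMarked.tauBar_last (h : IsMarked (T.shift k) a b c lx ly r i p j q) :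
    T.tauBar k a = (T.shift k).piece r (i + 1) j := by
  have hp := h.mem_p
  rw [isSome_shift] at hp
  have h1 : branchRank (r ++ i :: p) a = i := by
    rw [← h.length_p, branchRank_append_of_le (by simp), branchRank_cons_length]
  have h2 : branchRank (r ++ j :: q) b = j := by
    rw [← h.length_q, branchRank_append_of_le (by simp), branchRank_cons_length]
  have ha := h.length_p
  rw [tauBar, if_neg (by omega), if_pos h.brA_eq.symm, middleTree, h.ptV_eq, h.ptE_eq, h.ptE'_eq,
    h.brA_eq, h.brB_eq, h1, h2, piece_shift (isSome_of_append hp)]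

theorem IsMarked.tauBar'_zero (h : IsMarked (T.shift k) a b c lx ly r i p j q) :
    T.tauBar' k 0 = (T.shift k).sub (r ++ j :: q) := by
  have hq := h.mem_q
  rw [isSome_shift] at hq
  rw [tauBar', if_pos rfl, h.ptE'_eq, descTree_eq hq]

theorem IsMarked.tauBar'_of_pos (h : IsMarked (T.shift k) a b c lx ly r i p j q) {t : ℕ}
    (h1 : 1 ≤ t) : T.tauBar' k t = (T.shift k).leftAt (r ++ j :: q) t := by
  have hq := h.mem_q
  rw [isSome_shift] at hq
  rw [tauBar', if_neg (by omega), h.ptE'_eq, leftTree_eq hq]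

end

/-- The trees of `A` with root-label `y`, finitely many vertices, and all labels above `m`. -/
def aboveIn (m : ℤ) (A : Set LTree) (y : ℤ) : Set LTree :=
  A ∩ {T | T.label [] = y} ∩ (labelsAbove m ∩ finiteTrees)

/-- The trees of `A`, restricted to the root-label `y` if `t = 0`. -/
def baseIn (y : ℤ) (A : ℕ → Set LTree) (t : ℕ) : Set LTree :=
  A t ∩ {T | t = 0 → T.label [] = y}

/-- The trees with shifted labels for which the branches are prescribed and the grafted subtrees
belong to given sets. -/
theorem shift_mem_trunk_iff {k a b c : ℕ} (ha : 1 ≤ a) (hb : 1 ≤ b) (hc : 1 ≤ c) (hk : 1 < k)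
    {x y z lx ly : ℕ → ℤ} (hxz : x a = z 0) (hz : z c = k)
    (hlx : ∀ t, 1 ≤ t → lx t = if t ≤ a then x t else z (t - a))
    (hly : ∀ t, 1 ≤ t → ly t = if t ≤ b then y t else z (t - b))
    {A A' X Y : ℕ → Set LTree} {T : LTree} :
    T.shift k ∈ trunk (fun t => aboveIn 0 (A t) (lx t)) (fun t => aboveIn 1 (A' t) (ly t)) (baseIn 0 X) (baseIn 1 Y) a b c ↔
      T ∈ branchSet k a b c x y z ∧ (∀ t, 1 ≤ t → t ≤ a + c → T.tau k t ∈ A t) ∧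
        (∀ t, 1 ≤ t → t ≤ b + c → T.tau' k t ∈ A' t) ∧ (∀ t, t ≤ a → T.tauBar k t ∈ X t) ∧
        ∀ t, t < b → T.tauBar' k t ∈ Y t := by
  rw [mem_trunk ha hb, mem_branchSet_iff ha hb hc hk hxz hz]
  constructor
  · rintro ⟨r, i, p, j, q, hr, hp, hq, hij, hpT, hqT, hL, hR, hX0, hX, hXa, hY0, hY⟩
    have lp : (r ++ i :: p).length = a + c := by simp; omega
    have lq : (r ++ j :: q).length = b + c := by simp; omega
    have hM : IsMarked (T.shift k) a b c (fun t => if t ≤ a then x t else z (t - a))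
        (fun t => if t ≤ b then y t else z (t - b)) r i p j q :=
      { length_r := hr
        length_p := hp
        length_q := hq
        lt := hij
        mem_p := hpT
        mem_q := hqT
        label_p := hX0.2 rfl
        label_q := hY0.2 rfl
        left := (forall_leftAt_iff hpT).1 fun t h1 h2 => (hL t h1 (lp ▸ h2)).2
        right := (forall_rightAt_iff hqT).1 fun t h1 h2 => (hR t h1 (lq ▸ h2)).2
        label_anc_p := fun t h1 h2 => (hL t h1 h2).1.2.trans (hlx t h1)
        label_anc_q := fun t h1 h2 => (hR t h1 h2).1.2.trans (hly t h1) }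
    refine ⟨⟨r, i, p, j, q, hM⟩, fun t h1 h2 => ?_, fun t h1 h2 => ?_, fun t ht => ?_,
      fun t ht => ?_⟩
    · rw [hM.tau_eq]; exact (hL t h1 h2).1.1
    · rw [hM.tau'_eq]; exact (hR t h1 h2).1.1
    · rcases Nat.eq_zero_or_pos t with rfl | h0
      · rw [hM.tauBar_zero]; exact hX0.1
      · rcases ht.eq_or_lt with rfl | hlt
        · rw [hM.tauBar_last]; exact hXa.1
        · rw [hM.tauBar_of_lt h0 hlt]; exact (hX t h0 hlt).1
    · rcases Nat.eq_zero_or_pos t with rfl | h0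
      · rw [hM.tauBar'_zero]; exact hY0.1
      · rw [hM.tauBar'_of_pos h0]; exact (hY t h0 ht).1
  · rintro ⟨⟨r, i, p, j, q, hM⟩, hA, hA', hX, hY⟩
    have l1 := hM.length_p
    have l2 := hM.length_q
    have l3 := hM.length_r
    have lp : (r ++ i :: p).length = a + c := by simp; omega
    have lq : (r ++ j :: q).length = b + c := by simp; omega
    refine ⟨r, i, p, j, q, hM.length_r, hM.length_p, hM.length_q, hM.lt, hM.mem_p, hM.mem_q,
      fun t h1 h2 => ⟨⟨?_, (hM.label_anc_p t h1 h2).trans (hlx t h1).symm⟩,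
        (forall_leftAt_iff hM.mem_p).2 hM.left t h1 (lp.symm ▸ h2)⟩,
      fun t h1 h2 => ⟨⟨?_, (hM.label_anc_q t h1 h2).trans (hly t h1).symm⟩,
        (forall_rightAt_iff hM.mem_q).2 hM.right t h1 (lq.symm ▸ h2)⟩,
      ⟨?_, fun _ => hM.label_p⟩, fun t h1 h2 => ⟨?_, fun h => by omega⟩, ⟨?_, fun h => by omega⟩,
      ⟨?_, fun _ => hM.label_q⟩, fun t h1 h2 => ⟨?_, fun h => by omega⟩⟩
    · rw [← hM.tau_eq]; exact hA t h1 h2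
    · rw [← hM.tau'_eq]; exact hA' t h1 h2
    · rw [← hM.tauBar_zero]; exact hX 0 (by omega)
    · rw [← hM.tauBar_of_lt h1 h2]; exact hX t h2.le
    · rw [← hM.tauBar_last]; exact hX a le_rfl
    · rw [← hM.tauBar'_zero]; exact hY 0 (by omega)
    · rw [← hM.tauBar'_of_pos h1]; exact hY t h2

/-- The trees with a vertex of label `m`. -/
def hits (m : ℤ) : Set LTree := {T | ∃ u, T.lab u = some m}

theorem hits_of_label_nil {m : ℤ} {T : LTree} (h : T.label [] = m) : T ∈ hits m :=
  ⟨[], by rw [← h, some_label T.root_mem]⟩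

theorem split_subset_hits {A B C : Set LTree} {m : ℤ} (hB : B ⊆ hits m) :
    split A B C ⊆ hits m := by
  rintro T ⟨i, hi, -, h, -⟩
  obtain ⟨u, hu⟩ := hB h
  exact ⟨i :: u, by rw [← childTree_lab hi, hu]⟩

theorem split_subset_of_left {A B C : Set LTree} {y : ℤ} (hA : A ⊆ {T | T.label [] = y}) :
    split A B C ⊆ {T | T.label [] = y} := by
  rintro T ⟨i, hi, h, -, -⟩
  simpa using hA h

theorem split_subset_of_right {A B C : Set LTree} {y : ℤ} (hC : C ⊆ {T | T.label [] = y}) :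
    split A B C ⊆ {T | T.label [] = y} := by
  rintro T ⟨i, hi, -, -, h⟩
  simpa using hC h

/-- If two children split the tree, the subtree of the first one is contained in the left piece of
the second one. It has a vertex of label `m`, while that piece has labels above `m`. -/
theorem uniqueSplit_of_left {A B C : Set LTree} {m : ℤ} (hA : A ⊆ labelsAbove m)
    (hB : B ⊆ hits m) : UniqueSplit A B C := by
  intro T i j hij hj hi hj'
  obtain ⟨u, hu⟩ := hB hi.2.1
  rw [childTree_lab (hij.trans hj)] at hu
  exact lt_irrefl m (hA hj'.1 (i :: u) m (by rw [leftPiece_lab_cons, if_pos hij, hu]))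

/-- Symmetrically, the subtree of the later child would lie in the right piece of the earlier one.
-/
theorem uniqueSplit_of_right {A B C : Set LTree} {m : ℤ} (hC : C ⊆ labelsAbove m)
    (hB : B ⊆ hits m) : UniqueSplit A B C := by
  intro T i j hij hj hi hj'
  obtain ⟨u, hu⟩ := hB hj'.2.1
  rw [childTree_lab hj] at hu
  refine lt_irrefl m (hC hi.2.2 ((j - (i + 1)) :: u) m ?_)
  rw [rightPiece_lab_cons, show i + 1 + (j - (i + 1)) = j by omega, hu]

theorem chain_subset_hits {B : Set LTree} {L R : ℕ → Set LTree} {m : ℤ} (hB : B ⊆ hits m) (n : ℕ) :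
    chain B L R n ⊆ hits m := by
  induction n with
  | zero => exact hB
  | succ n ih => exact split_subset_hits ih

end LTree

/-! ### The product formula along branches -/

theorem dualLaw_chain {B : Set LTree} {L R : ℕ → Set LTree} (hB : MeasurableSet B)
    (hL : ∀ t, MeasurableSet (L t)) (hR : ∀ t, MeasurableSet (R t)) {l : ℕ → ℤ} {n : ℕ}
    (hl : ∀ t < n, |l (t + 1) - l t| ≤ 1)
    (huniq : ∀ t < n, UniqueSplit (L (t + 1)) (chain B L R t) (R (t + 1)))
    (hroot : ∀ t < n, chain B L R t ⊆ {T | T.label [] = l t}) :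
    dualLaw (l n) (chain B L R n) = TrivSqZeroExt.inl 3⁻¹ ^ n * dualLaw (l 0) B *
      (∏ t ∈ Finset.range n, dualLaw (l (t + 1)) (L (t + 1))) *
      ∏ t ∈ Finset.range n, dualLaw (l (t + 1)) (R (t + 1)) := by
  induction n with
  | zero => simp [chain]
  | succ n ih =>
    rw [chain, dualLaw_split (hL _) (measurableSet_chain hB hL hR n) (hR _)
      (huniq n n.lt_succ_self) (by rw [abs_sub_comm]; exact hl n n.lt_succ_self)
      (hroot n n.lt_succ_self),
      ih (fun t ht => hl t (by omega)) (fun t ht => huniq t (by omega))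
        (fun t ht => hroot t (by omega)), Finset.prod_range_succ, Finset.prod_range_succ, pow_succ]
    ring

/-- Each of the `a + b + c` edges gives a factor `1/3` and each grafted tree its dual law. The label
`0` makes the branch to `e_k` and the trunk unique through the trees on the left; the label `1` does
so for the branch to `e_{-k+1}` through the trees on the right. -/
theorem dualLaw_trunk {L R X Y : ℕ → Set LTree} (hL : ∀ t, MeasurableSet (L t))
    (hR : ∀ t, MeasurableSet (R t)) (hX : ∀ t, MeasurableSet (X t)) (hY : ∀ t, MeasurableSet (Y t))
    {a b c : ℕ} (ha : 1 ≤ a) (hb : 1 ≤ b) {lx ly : ℕ → ℤ} (hlx0 : lx 0 = 0) (hly0 : ly 0 = 1)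
    (hlxy : ∀ t ≤ c, lx (a + t) = ly (b + t)) (hlx : ∀ t < a + c, |lx (t + 1) - lx t| ≤ 1)
    (hly : ∀ t < b, |ly (t + 1) - ly t| ≤ 1)
    (hLabove : ∀ t, L t ⊆ labelsAbove 0) (hRabove : ∀ t, R t ⊆ labelsAbove 1)
    (hLroot : ∀ t, L t ⊆ {T | T.label [] = lx t}) (hRroot : ∀ t, R t ⊆ {T | T.label [] = ly t})
    (hX0 : X 0 ⊆ {T | T.label [] = 0}) (hY0 : Y 0 ⊆ {T | T.label [] = 1}) :
    dualLaw (lx (a + c)) (trunk L R X Y a b c) = TrivSqZeroExt.inl 3⁻¹ ^ (a + b + c) *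
      (∏ t ∈ Finset.range (a + c), dualLaw (lx (t + 1)) (L (t + 1))) *
      (∏ t ∈ Finset.range (b + c), dualLaw (ly (t + 1)) (R (t + 1))) *
      ((∏ t ∈ Finset.range (a + 1), dualLaw (lx t) (X t)) *
        ∏ t ∈ Finset.range b, dualLaw (ly t) (Y t)) := by
  obtain ⟨a, rfl⟩ : ∃ a', a = a' + 1 := ⟨a - 1, by omega⟩
  obtain ⟨b, rfl⟩ : ∃ b', b = b' + 1 := ⟨b - 1, by omega⟩
  have hXhits : ∀ n, chain (X 0) L X n ⊆ hits 0 := fun n =>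
    chain_subset_hits (fun T h => hits_of_label_nil (hX0 h)) n
  have hYhits : ∀ n, chain (Y 0) Y R n ⊆ hits 1 := fun n =>
    chain_subset_hits (fun T h => hits_of_label_nil (hY0 h)) n
  have hXroot : ∀ n, chain (X 0) L X n ⊆ {T | T.label [] = lx n} := by
    rintro (_ | n)
    · rw [hlx0]; exact hX0
    · exact split_subset_of_left (hLroot _)
  have hYroot : ∀ n, chain (Y 0) Y R n ⊆ {T | T.label [] = ly n} := by
    rintro (_ | n)
    · rw [hly0]; exact hY0
    · exact split_subset_of_right (hRroot _)
  have hXm : ∀ n, MeasurableSet (chain (X 0) L X n) := measurableSet_chain (hX 0) hL hX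
  have hYm : ∀ n, MeasurableSet (chain (Y 0) Y R n) := measurableSet_chain (hY 0) hY hR
  have hv : lx (a + 1) = ly (b + 1) := hlxy 0 (Nat.zero_le _)
  -- This is the inner splitting at the branch point: the left piece is the tree between the
  -- branches, the marked child carries the second branch.
  have hright : dualLaw (ly (b + 1)) (split (X (a + 1)) (chain (Y 0) Y R b) (R (b + 1))) =
      dualLaw (ly (b + 1)) (X (a + 1)) * (TrivSqZeroExt.inl 3⁻¹ *
        dualLaw (ly b) (chain (Y 0) Y R b)) * dualLaw (ly (b + 1)) (R (b + 1)) :=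
    dualLaw_split (hX _) (hYm _) (hR _) (uniqueSplit_of_right (hRabove _) (hYhits _))
      (by rw [abs_sub_comm]; exact hly b (by omega)) (hYroot _)
  have hrightm := measurableSet_split (hX (a + 1)) (hYm b) (hR (b + 1))
  have hfork : dualLaw (lx (a + 1)) (fork L R X Y (a + 1) (b + 1)) =
      dualLaw (lx (a + 1)) (L (a + 1)) * (TrivSqZeroExt.inl 3⁻¹ *
        dualLaw (lx a) (chain (X 0) L X a)) *
        (dualLaw (ly (b + 1)) (X (a + 1)) * (TrivSqZeroExt.inl 3⁻¹ *
        dualLaw (ly b) (chain (Y 0) Y R b)) * dualLaw (ly (b + 1)) (R (b + 1))) := by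
    rw [← hright, ← hv]
    exact dualLaw_split (hL _) (hXm _) hrightm (uniqueSplit_of_left (hLabove _) (hXhits _))
      (by rw [abs_sub_comm]; exact hlx a (by omega)) (hXroot _)
  have hforkm : MeasurableSet (fork L R X Y (a + 1) (b + 1)) :=
    measurableSet_split (hL _) (hXm _) hrightm
  have hforkhits : fork L R X Y (a + 1) (b + 1) ⊆ hits 0 := split_subset_hits (hXhits _)
  have htrunk := dualLaw_chain hforkm (L := fun t => L (a + 1 + t)) (R := fun t => R (b + 1 + t))
    (fun t => hL _) (fun t => hR _) (l := fun t => lx (a + 1 + t)) (n := c)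
    (fun t ht => hlx (a + 1 + t) (by omega))
    (fun t ht => uniqueSplit_of_left (hLabove _) (chain_subset_hits hforkhits t))
    (fun t ht => by
      rcases t with _ | t
      · exact split_subset_of_left (hLroot _)
      · exact split_subset_of_left (hLroot _))
  have hR' : ∏ t ∈ Finset.range c, dualLaw (lx (a + 1 + (t + 1))) (R (b + 1 + (t + 1))) =
      ∏ t ∈ Finset.range c, dualLaw (ly (b + 1 + t + 1)) (R (b + 1 + t + 1)) :=
    Finset.prod_congr rfl fun t ht => by
      rw [hlxy (t + 1) (by rw [Finset.mem_range] at ht; omega)]; rfl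
  rw [trunk, htrunk, hR', add_zero, hfork,
    dualLaw_chain (hX 0) hL hX (fun t ht => hlx t (by omega))
      (fun t _ => uniqueSplit_of_left (hLabove _) (hXhits t)) (fun t _ => hXroot t),
    dualLaw_chain (hY 0) hY hR (fun t ht => hly t (by omega))
      (fun t _ => uniqueSplit_of_right (hRabove _) (hYhits t)) (fun t _ => hYroot t),
    Finset.prod_range_add _ (a + 1) c, Finset.prod_range_add _ (b + 1) c,
    Finset.prod_range_succ' _ (a + 1), Finset.prod_range_succ' (fun t => dualLaw (ly t) (Y t)) b,
    Finset.prod_range_succ _ a, Finset.prod_range_succ _ a,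
    Finset.prod_range_succ (fun t => dualLaw (ly (t + 1)) (R (t + 1))) b, hv]
  simp only [pow_add, pow_one, ← add_assoc]
  ring

/-- The Leibniz rule for a product; the index `j` of the differentiated factor will be that of the
tree carrying the spine. -/
theorem snd_prod_trivSqZeroExt {ι : Type*} [DecidableEq ι] (s : Finset ι)
    (f : ι → TrivSqZeroExt ENNReal ENNReal) : (∏ i ∈ s, f i).snd =
      ∑ j ∈ s, ∏ i ∈ s, if i = j then (f i).snd else (f i).fst := by
  induction s using Finset.induction_on with
  | empty => simp
  | insert c s hc ih =>
    have hfst : (∏ i ∈ s, f i).fst = ∏ i ∈ s, (f i).fst :=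
      map_prod (TrivSqZeroExt.fstHom ENNReal ENNReal ENNReal) f s
    have h1 : ∏ i ∈ s, (if i = c then (f i).snd else (f i).fst) = ∏ i ∈ s, (f i).fst :=
      Finset.prod_congr rfl fun i hi => if_neg (ne_of_mem_of_not_mem hi hc)
    have h2 : ∀ j ∈ s, (∏ i ∈ insert c s, if i = j then (f i).snd else (f i).fst) =
        (f c).fst * ∏ i ∈ s, if i = j then (f i).snd else (f i).fst := fun j hj => by
      rw [Finset.prod_insert hc, if_neg (ne_of_mem_of_not_mem hj hc).symm]
    rw [Finset.prod_insert hc, Finset.sum_insert hc, Finset.sum_congr rfl h2,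
      Finset.prod_insert hc, if_pos rfl, h1, ← Finset.mul_sum, TrivSqZeroExt.snd_mul, ih, hfst,
      op_smul_eq_smul, smul_eq_mul, smul_eq_mul]
    ring

theorem prod_inl_trivSqZeroExt {ι : Type*} (s : Finset ι) (f : ι → ENNReal) :
    ∏ i ∈ s, (TrivSqZeroExt.inl (f i) : TrivSqZeroExt ENNReal ENNReal) =
      TrivSqZeroExt.inl (∏ i ∈ s, f i) :=
  (map_prod (TrivSqZeroExt.inlHom ENNReal ENNReal) f s).symm

/-! ### The dual laws of the grafted trees -/

theorem uit_label_nil (x : ℤ) : ∀ᵐ T ∂(uit x), T.label [] = x := by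
  rw [uit_eq_map, ae_map_iff (measurable_spineTreeFrom x).aemeasurable (measurableSet_label [] x)]
  exact Filter.Eventually.of_forall fun s => spineTreeFrom_label_nil x s

theorem measurableSet_aboveIn (m : ℤ) {A : Set LTree} (hA : MeasurableSet A) (y : ℤ) :
    MeasurableSet (aboveIn m A y) :=
  (hA.inter (measurableSet_label [] y)).inter
    ((measurableSet_labelsAbove m).inter measurableSet_finiteTrees)

theorem measurableSet_baseIn (y : ℤ) {A : ℕ → Set LTree} (hA : ∀ t, MeasurableSet (A t)) (t : ℕ) :
    MeasurableSet (baseIn y A t) := by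
  by_cases ht : t = 0
  · simpa [baseIn, ht] using (hA 0).inter (measurableSet_label [] y)
  · simpa [baseIn, ht] using hA t

/-- The root-label is almost surely `l t`: the restriction needed for uniqueness costs nothing. -/
theorem dualLaw_baseIn (A : ℕ → Set LTree) (l : ℕ → ℤ) (t : ℕ) :
    dualLaw (l t) (baseIn (l 0) A t) = dualLaw (l t) (A t) := by
  refine TrivSqZeroExt.ext (measure_congr ?_) (measure_congr ?_)
  · filter_upwards [gw_label_nil (l t)] with T hT
    exact propext ⟨fun h => h.1, fun h => ⟨h, fun h0 => by rw [hT, h0]⟩⟩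
  · filter_upwards [uit_label_nil (l t)] with T hT
    exact propext ⟨fun h => h.1, fun h => ⟨h, fun h0 => by rw [hT, h0]⟩⟩

theorem gw_labelsAbove_zero {x : ℤ} (hx : 1 ≤ x) :
    gw x (labelsAbove 0) = ENNReal.ofReal (w x) := by
  rw [← gw_real_labelsAbove_zero hx, ofReal_measureReal]

theorem isProbabilityMeasure_gwPos {x : ℤ} (hx : 1 ≤ x) : IsProbabilityMeasure (gwPos x) := by
  refine cond_isProbabilityMeasure ?_
  change gw x (labelsAbove 0) ≠ 0
  rw [gw_labelsAbove_zero hx]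
  simpa using w_pos hx

theorem gw_inter_labelsAbove_zero {x : ℤ} (hx : 1 ≤ x) (A : Set LTree) :
    gw x (A ∩ labelsAbove 0) = ENNReal.ofReal (w x) * gwPos x A := by
  have h : gwPos x A = (gw x (labelsAbove 0))⁻¹ * gw x (labelsAbove 0 ∩ A) :=
    cond_apply (measurableSet_labelsAbove 0) _ A
  rw [h, gw_labelsAbove_zero hx, ← mul_assoc, ENNReal.mul_inv_cancel
    (by simpa using w_pos hx) ENNReal.ofReal_ne_top, one_mul, Set.inter_comm]

/-- Finiteness is almost sure under `gw` and has probability zero under `uit`, so the outer trees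
cannot carry the spine and their `ε` part vanishes. -/
theorem dualLaw_aboveIn (m : ℤ) (A : Set LTree) (x : ℤ) :
    dualLaw x (aboveIn m A x) = TrivSqZeroExt.inl (gw x (A ∩ labelsAbove m)) := by
  refine TrivSqZeroExt.ext (measure_congr ?_) ?_
  · have hfin : ∀ᵐ T ∂(gw x), T ∈ finiteTrees :=
      (mem_ae_iff_prob_eq_one measurableSet_finiteTrees).2 (gw_finiteTrees x)
    filter_upwards [gw_label_nil x, hfin] with T hT hT'
    exact propext ⟨fun h => ⟨h.1.1, h.2.1⟩, fun h => ⟨⟨h.1, hT⟩, h.2, hT'⟩⟩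
  · exact measure_mono_null (fun T h => h.2.2) (uit_finiteTrees x)

theorem dualLaw_aboveIn_zero {x : ℤ} (hx : 1 ≤ x) (A : Set LTree) :
    dualLaw x (aboveIn 0 A x) = TrivSqZeroExt.inl (ENNReal.ofReal (w x) * gwPos x A) := by
  rw [dualLaw_aboveIn, gw_inter_labelsAbove_zero hx]

/-- Subtracting `1` from all labels reduces labels above `1` to positive labels. -/
theorem dualLaw_aboveIn_one {x : ℤ} (hx : 2 ≤ x) {A : Set LTree} (hA : MeasurableSet A) :
    dualLaw x (aboveIn 1 A x) =
      TrivSqZeroExt.inl (ENNReal.ofReal (w (x - 1)) * (gwPos (x - 1)).map (shift 1) A) := by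
  have hpre : shift 1 ⁻¹' (A ∩ labelsAbove 1) = shift 1 ⁻¹' A ∩ labelsAbove 0 := by
    ext T
    simp only [Set.mem_preimage, Set.mem_inter_iff, labelsAbove, Set.mem_ofPred_eq, shift,
      Option.map_eq_some_iff]
    refine and_congr_right fun _ => ⟨fun h u p hp => ?_, ?_⟩
    · have := h u (p + 1) ⟨p, hp, rfl⟩
      omega
    · rintro h u _ ⟨p, hp, rfl⟩
      have := h u p hp
      omega
  rw [dualLaw_aboveIn, Measure.map_apply (measurable_shift 1) hA,
    ← gw_inter_labelsAbove_zero (by omega), ← hpre,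
    ← Measure.map_apply (measurable_shift 1) (hA.inter (measurableSet_labelsAbove 1)),
    gw_map_shift, sub_add_cancel]

/-- The Leibniz sum over the tree carrying the spine is the unnormalized mixture defining
`forestLaw`. Its normalization is the source of the factor `a + b + 1`. -/
theorem forestLaw_pi {ι : Type} [Fintype ι] [DecidableEq ι] [Nonempty ι] (l : ι → ℤ)
    (S : ι → Set LTree) :
    (∏ i, dualLaw (l i) (S i)).snd = Fintype.card ι * forestLaw l (Set.univ.pi S) := by
  have hp : ∀ (j i : ι), IsProbabilityMeasure
      (if i = j then uniformInfiniteTree.map (LTree.shift (l i)) else gw (l i)) := fun j i => by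
    split_ifs
    · exact Measure.isProbabilityMeasure_map (measurable_shift _).aemeasurable
    · infer_instance
  rw [snd_prod_trivSqZeroExt, forestLaw, Measure.smul_apply, smul_eq_mul, ← mul_assoc,
    ENNReal.mul_inv_cancel (by simp) (by simp), one_mul, Measure.finsetSum_apply]
  refine Finset.sum_congr rfl fun j _ => ?_
  rw [Measure.pi_pi]
  refine Finset.prod_congr rfl fun i _ => ?_
  split_ifs <;> rfl

instance {ι : Type} [Fintype ι] [DecidableEq ι] [Nonempty ι] (l : ι → ℤ) :
    IsProbabilityMeasure (forestLaw l) := by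
  have hp : ∀ (j i : ι), IsProbabilityMeasure
      (if i = j then uniformInfiniteTree.map (LTree.shift (l i)) else gw (l i)) := fun j i => by
    split_ifs
    · exact Measure.isProbabilityMeasure_map (measurable_shift _).aemeasurable
    · infer_instance
  constructor
  rw [forestLaw, Measure.smul_apply, smul_eq_mul, Measure.finsetSum_apply]
  simp only [measure_univ, Finset.sum_const, Finset.card_univ, nsmul_eq_mul, mul_one]
  exact ENNReal.inv_mul_cancel (by simp) (by simp)

/-! ### The labels along a branch -/

/-- The label `s`, followed by the labels `x 1, …, x a`, then by `z 1, z 2, …`. -/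
def pathLabel (s : ℤ) (a : ℕ) (x z : ℕ → ℤ) (t : ℕ) : ℤ :=
  if t = 0 then s else if t ≤ a then x t else z (t - a)

@[simp] theorem pathLabel_zero (s : ℤ) (a : ℕ) (x z : ℕ → ℤ) : pathLabel s a x z 0 = s := rfl

theorem pathLabel_of_pos {s : ℤ} {a : ℕ} {x z : ℕ → ℤ} {t : ℕ} (ht : 1 ≤ t) :
    pathLabel s a x z t = if t ≤ a then x t else z (t - a) := if_neg (by omega)

theorem pathLabel_add {s : ℤ} {a : ℕ} {x z : ℕ → ℤ} (ha : 1 ≤ a) (h : x a = z 0) (t : ℕ) :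
    pathLabel s a x z (a + t) = z t := by
  rw [pathLabel_of_pos (by omega)]
  rcases Nat.eq_zero_or_pos t with rfl | ht
  · simp [h]
  · rw [if_neg (by omega)]; congr 1; omega

theorem lt_pathLabel {m m' s s' v v' : ℤ} {a c : ℕ} {x z : ℕ → ℤ} (hm : m ≤ m')
    (hx : IsWalkAbove m 1 a s' v x) (hz : IsWalkAbove m' 0 c v v' z) {t : ℕ} (h1 : 1 ≤ t)
    (h2 : t ≤ a + c) : m < pathLabel s a x z t := by
  rw [pathLabel_of_pos h1]
  split_ifs with h
  · exact hx.2.2.1 t h1 h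
  · exact hm.trans_lt (hz.2.2.1 (t - a) (by omega) (by omega))

theorem abs_pathLabel_le {m m' s s' v v' : ℤ} {a c : ℕ} {x z : ℕ → ℤ} (ha : 1 ≤ a)
    (hs : |s' - s| ≤ 1) (hx : IsWalkAbove m 1 a s' v x) (hz : IsWalkAbove m' 0 c v v' z) {t : ℕ}
    (ht : t < a + c) : |pathLabel s a x z (t + 1) - pathLabel s a x z t| ≤ 1 := by
  have hxz : x a = z 0 := hx.2.1.trans hz.1.symm
  rcases lt_or_ge t a with h | h
  · rw [pathLabel_of_pos (by omega), if_pos (by omega)]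
    rcases Nat.eq_zero_or_pos t with rfl | h0
    · rwa [pathLabel_zero, zero_add, hx.1]
    · rw [pathLabel_of_pos h0, if_pos h.le]
      exact hx.2.2.2 t h0 h
  · obtain ⟨t, rfl⟩ := Nat.exists_eq_add_of_le h
    rw [add_assoc, pathLabel_add ha hxz, pathLabel_add ha hxz]
    exact hz.2.2.2 t (Nat.zero_le _) (by omega)

/-! ### Rectangles -/

/-- The measurable rectangles of a finite product. -/
def rectangles (ι : Type*) (E : Type*) [MeasurableSpace E] : Set (Set (ι → E)) :=
  Set.univ.pi '' Set.univ.pi fun _ => {s | MeasurableSet s}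

theorem isPiSystem_rectangles (ι E : Type*) [MeasurableSpace E] : IsPiSystem (rectangles ι E) :=
  isPiSystem_pi

theorem generateFrom_rectangles (ι E : Type*) [Finite ι] [MeasurableSpace E] :
    MeasurableSpace.generateFrom (rectangles ι E) = MeasurableSpace.pi :=
  generateFrom_pi

theorem isCountablySpanning_of_univ_mem {α : Type*} {C : Set (Set α)} (h : Set.univ ∈ C) :
    IsCountablySpanning C :=
  ⟨fun _ => Set.univ, fun _ => h, Set.iUnion_const _⟩

theorem univ_mem_rectangles (ι E : Type*) [MeasurableSpace E] : Set.univ ∈ rectangles ι E :=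
  ⟨fun _ => Set.univ, fun _ _ => MeasurableSet.univ, Set.pi_univ _⟩

/-- The measurable rectangles of a product of three finite products. -/
def rectangles₃ (ι₁ ι₂ ι₃ E : Type*) [MeasurableSpace E] :
    Set (Set ((ι₁ → E) × (ι₂ → E) × (ι₃ → E))) :=
  Set.image2 (· ×ˢ ·) (rectangles ι₁ E) (Set.image2 (· ×ˢ ·) (rectangles ι₂ E) (rectangles ι₃ E))

theorem isPiSystem_rectangles₃ (ι₁ ι₂ ι₃ E : Type*) [MeasurableSpace E] :
    IsPiSystem (rectangles₃ ι₁ ι₂ ι₃ E) :=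
  (isPiSystem_rectangles ι₁ E).prod ((isPiSystem_rectangles ι₂ E).prod (isPiSystem_rectangles ι₃ E))

theorem generateFrom_rectangles₃ (ι₁ ι₂ ι₃ E : Type*) [Finite ι₁] [Finite ι₂] [Finite ι₃]
    [MeasurableSpace E] : MeasurableSpace.generateFrom (rectangles₃ ι₁ ι₂ ι₃ E) =
      Prod.instMeasurableSpace := by
  refine generateFrom_eq_prod (generateFrom_rectangles ι₁ E)
    (generateFrom_eq_prod (generateFrom_rectangles ι₂ E) (generateFrom_rectangles ι₃ E) ?_ ?_) ?_ ?_
  all_goals refine isCountablySpanning_of_univ_mem ?_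
  · exact univ_mem_rectangles _ E
  · exact univ_mem_rectangles _ E
  · exact univ_mem_rectangles _ E
  · exact ⟨_, univ_mem_rectangles _ E, _, univ_mem_rectangles _ E, Set.univ_prod_univ⟩

theorem mem_rectangles₃ {ι₁ ι₂ ι₃ E : Type*} [MeasurableSpace E]
    {s : Set ((ι₁ → E) × (ι₂ → E) × (ι₃ → E))} : s ∈ rectangles₃ ι₁ ι₂ ι₃ E ↔
      ∃ (A : ι₁ → Set E) (B : ι₂ → Set E) (C : ι₃ → Set E), (∀ i, MeasurableSet (A i)) ∧
        (∀ i, MeasurableSet (B i)) ∧ (∀ i, MeasurableSet (C i)) ∧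
        s = Set.univ.pi A ×ˢ (Set.univ.pi B ×ˢ Set.univ.pi C) := by
  constructor
  · rintro ⟨_, ⟨A, hA, rfl⟩, _, ⟨_, ⟨B, hB, rfl⟩, _, ⟨C, hC, rfl⟩, rfl⟩, rfl⟩
    exact ⟨A, B, C, fun i => hA i trivial, fun i => hB i trivial, fun i => hC i trivial, rfl⟩
  · rintro ⟨A, B, C, hA, hB, hC, rfl⟩
    exact ⟨_, ⟨A, fun i _ => hA i, rfl⟩, _, ⟨_, ⟨B, fun i _ => hB i, rfl⟩, _,
      ⟨C, fun i _ => hC i, rfl⟩, rfl⟩, rfl⟩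

/-- If the sets `E ∩ F ⁻¹' s` are measurable and their measures are proportional to `ν s`, for all
measurable rectangles `s`, then `F` has law `ν` conditionally on `E`. -/
theorem hasLaw_cond_of_rectangles₃ {α ι₁ ι₂ ι₃ D : Type*} [Finite ι₁] [Finite ι₂] [Finite ι₃]
    [MeasurableSpace α] [MeasurableSpace D] {μ : Measure α} [IsFiniteMeasure μ] {E : Set α}
    {F : α → (ι₁ → D) × (ι₂ → D) × (ι₃ → D)} {ν : Measure ((ι₁ → D) × (ι₂ → D) × (ι₃ → D))}
    [IsProbabilityMeasure ν] {m : ENNReal} (hm : m ≠ 0)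
    (h1 : ∀ s ∈ rectangles₃ ι₁ ι₂ ι₃ D, MeasurableSet (E ∩ F ⁻¹' s))
    (h2 : ∀ s ∈ rectangles₃ ι₁ ι₂ ι₃ D, μ (E ∩ F ⁻¹' s) = m * ν s) :
    μ E = m ∧ MeasurableSet E ∧ HasLaw F ν μ[|E] := by
  have huniv : Set.univ ∈ rectangles₃ ι₁ ι₂ ι₃ D :=
    mem_rectangles₃.2 ⟨fun _ => Set.univ, fun _ => Set.univ, fun _ => Set.univ, by simp, by simp,
      by simp, by simp⟩
  have hE : MeasurableSet E := by simpa using h1 _ huniv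
  have hμE : μ E = m := by simpa using h2 _ huniv
  -- No measurability of `F` outside `E` is needed: its restriction to `E` is tested on a generating
  -- family, and the conditional measure does not see the complement.
  have hFE : Measurable fun x : E => F x := by
    rw [← generateFrom_rectangles₃]
    refine measurable_generateFrom fun s hs => ?_
    have : (fun x : E => F x) ⁻¹' s = Subtype.val ⁻¹' (E ∩ F ⁻¹' s) := by ext x; simp
    rw [this]
    exact measurable_subtype_coe (h1 s hs)
  have hF : AEMeasurable F μ[|E] :=
    (aemeasurable_restrict_of_measurable_subtype hE hFE).smul_measure _
  have hprob : IsProbabilityMeasure μ[|E] := cond_isProbabilityMeasure (by rwa [hμE])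
  have hprob' : IsProbabilityMeasure (μ[|E].map F) := Measure.isProbabilityMeasure_map hF
  refine ⟨hμE, hE, hF, ext_of_generate_finite _ (generateFrom_rectangles₃ ι₁ ι₂ ι₃ D).symm
    (isPiSystem_rectangles₃ ι₁ ι₂ ι₃ D) (fun s hs => ?_) (by simp)⟩
  have hs' : MeasurableSet s := by
    rw [← generateFrom_rectangles₃]
    exact MeasurableSpace.measurableSet_generateFrom hs
  rw [Measure.map_apply_of_aemeasurable hF hs', cond_apply hE, h2 s hs, hμE, ← mul_assoc,
    ENNReal.inv_mul_cancel hm (by rw [← hμE]; exact measure_ne_top μ E), one_mul]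

/-- This transfers the result from the canonical law on trees to an arbitrary probability space. -/
theorem hasLaw_cond_preimage {Ω α : Type*} [MeasurableSpace Ω] [MeasurableSpace α] {P : Measure Ω}
    {μ : Measure α} {θ : Ω → α} (hθ : HasLaw θ μ P) {E : Set α} (hE : MeasurableSet E) :
    HasLaw θ μ[|E] (P[|θ ⁻¹' E]) := by
  refine ⟨hθ.aemeasurable.mono_ac cond_absolutelyContinuous, ?_⟩
  rw [ProbabilityTheory.cond, ProbabilityTheory.cond, Measure.map_smul, ← hθ.map_eq,
    Measure.restrict_map_of_aemeasurable hθ.aemeasurable hE,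
    Measure.map_apply_of_aemeasurable hθ.aemeasurable hE]

/-! ### The three forests -/

section

variable {k k' a b c : ℕ} {x y z : ℕ → ℤ}

/-- The weight of the branches with given labels. -/
noncomputable def branchWeight (a b c : ℕ) (lx ly : ℕ → ℤ) : ENNReal :=
  3⁻¹ ^ (a + b + c) * (∏ t ∈ Finset.range (a + c), ENNReal.ofReal (w (lx (t + 1)))) *
    (∏ t ∈ Finset.range (b + c), ENNReal.ofReal (w (ly (t + 1) - 1))) * (a + b + 1 : ℕ)

/-- The outer trees are numbered from `1` but indexed by `Fin` from `0`, whence `t - 1`. The outer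
sets at `t = 0`, and all values outside the ranges, are irrelevant to the trunk. -/
theorem shift_preimage_trunk (ha : 1 ≤ a) (hb : 1 ≤ b) (hc : 1 ≤ c)
    (hx : IsWalkAbove 0 1 a 1 k' x) (hz : IsWalkAbove 1 0 c k' k z)
    (A : Fin (a + c) → Set LTree) (A' : Fin (b + c) → Set LTree)
    (S : Fin (a + 1) ⊕ Fin b → Set LTree) :
    branchSet k a b c x y z ∩ (fun T => (forestTau k a c T, forestTau' k b c T, forestBar k a b T))
        ⁻¹' (Set.univ.pi A ×ˢ (Set.univ.pi A' ×ˢ Set.univ.pi S)) =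
      shift k ⁻¹' trunk
        (fun t => aboveIn 0 (if h : t - 1 < a + c then A ⟨t - 1, h⟩ else Set.univ)
          (pathLabel 0 a x z t))
        (fun t => aboveIn 1 (if h : t - 1 < b + c then A' ⟨t - 1, h⟩ else Set.univ)
          (pathLabel 1 b y z t))
        (baseIn 0 fun t => if h : t < a + 1 then S (Sum.inl ⟨t, h⟩) else Set.univ)
        (baseIn 1 fun t => if h : t < b then S (Sum.inr ⟨t, h⟩) else Set.univ) a b c := by
  -- The walk `z` stays above `1` and ends at `k`.
  have hk : 1 < k := by
    have := hz.2.2.1 c (Nat.zero_le _) le_rfl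
    rw [hz.2.1] at this
    omega
  ext T
  rw [Set.mem_preimage, shift_mem_trunk_iff ha hb hc hk (hx.2.1.trans hz.1.symm) hz.2.1
    (fun t ht => pathLabel_of_pos ht) (fun t ht => pathLabel_of_pos ht)]
  simp only [Set.mem_inter_iff, Set.mem_preimage, Set.mem_prod, Set.mem_univ_pi, forestTau,
    forestTau', forestBar]
  refine and_congr_right fun _ => and_congr ?_ (and_congr ?_ ?_)
  · constructor
    · intro h t h1 h2
      have := h ⟨t - 1, by omega⟩
      rw [dif_pos (by omega)]
      rwa [show t - 1 + 1 = t by omega] at this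
    · intro h i
      have := h (i + 1) (by omega) (by omega)
      simpa using this
  · constructor
    · intro h t h1 h2
      have := h ⟨t - 1, by omega⟩
      rw [dif_pos (by omega)]
      rwa [show t - 1 + 1 = t by omega] at this
    · intro h i
      have := h (i + 1) (by omega) (by omega)
      simpa using this
  · rw [Sum.forall]
    refine and_congr ?_ ?_
    · constructor
      · intro h t ht
        rw [dif_pos (by omega)]
        exact h ⟨t, by omega⟩
      · intro h i
        have := h i (by omega)
        rwa [dif_pos i.2] at this
    · constructor
      · intro h t ht
        rw [dif_pos ht]
        exact h ⟨t, ht⟩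
      · intro h i
        have := h i i.2
        rwa [dif_pos i.2] at this

theorem measure_branchSet_inter (ha : 1 ≤ a) (hb : 1 ≤ b) (hc : 1 ≤ c)
    (hx : IsWalkAbove 0 1 a 1 k' x) (hy : IsWalkAbove 1 1 b 2 k' y) (hz : IsWalkAbove 1 0 c k' k z)
    {A : Fin (a + c) → Set LTree} {A' : Fin (b + c) → Set LTree}
    {S : Fin (a + 1) ⊕ Fin b → Set LTree} (hA : ∀ i, MeasurableSet (A i))
    (hA' : ∀ i, MeasurableSet (A' i)) (hS : ∀ i, MeasurableSet (S i)) :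
    MeasurableSet (branchSet k a b c x y z ∩
      (fun T => (forestTau k a c T, forestTau' k b c T, forestBar k a b T)) ⁻¹'
        (Set.univ.pi A ×ˢ (Set.univ.pi A' ×ˢ Set.univ.pi S))) ∧
    uniformInfiniteTree (branchSet k a b c x y z ∩
      (fun T => (forestTau k a c T, forestTau' k b c T, forestBar k a b T)) ⁻¹'
        (Set.univ.pi A ×ˢ (Set.univ.pi A' ×ˢ Set.univ.pi S))) =
      branchWeight a b c (pathLabel 0 a x z) (pathLabel 1 b y z) *
        ((∏ i : Fin (a + c), gwPos (pathLabel 0 a x z (i + 1)) (A i)) *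
          ((∏ i : Fin (b + c),
            (gwPos (pathLabel 1 b y z (i + 1) - 1)).map (shift 1) (A' i)) *
          forestLaw (Sum.elim (fun i : Fin (a + 1) => pathLabel 0 a x z i)
            (fun i : Fin b => pathLabel 1 b y z i)) (Set.univ.pi S))) := by
  have hxz : x a = z 0 := hx.2.1.trans hz.1.symm
  have hyz : y b = z 0 := hy.2.1.trans hz.1.symm
  rw [shift_preimage_trunk ha hb hc hx hz]
  set lx := pathLabel 0 a x z with hlx
  set ly := pathLabel 1 b y z with hly
  set L : ℕ → Set LTree := fun t => if h : t - 1 < a + c then A ⟨t - 1, h⟩ else Set.univ with hL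
  set R : ℕ → Set LTree := fun t => if h : t - 1 < b + c then A' ⟨t - 1, h⟩ else Set.univ with hR
  set X : ℕ → Set LTree := fun t => if h : t < a + 1 then S (Sum.inl ⟨t, h⟩) else Set.univ with hX
  set Y : ℕ → Set LTree := fun t => if h : t < b then S (Sum.inr ⟨t, h⟩) else Set.univ with hY
  have mL : ∀ t, MeasurableSet (L t) := fun t => by
    simp only [hL]; split_ifs; exacts [hA _, MeasurableSet.univ]
  have mR : ∀ t, MeasurableSet (R t) := fun t => by
    simp only [hR]; split_ifs; exacts [hA' _, MeasurableSet.univ]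
  have mX : ∀ t, MeasurableSet (X t) := fun t => by
    simp only [hX]; split_ifs; exacts [hS _, MeasurableSet.univ]
  have mY : ∀ t, MeasurableSet (Y t) := fun t => by
    simp only [hY]; split_ifs; exacts [hS _, MeasurableSet.univ]
  have mL' : ∀ t, MeasurableSet (aboveIn 0 (L t) (lx t)) := fun t => measurableSet_aboveIn 0 (mL t) _
  have mR' : ∀ t, MeasurableSet (aboveIn 1 (R t) (ly t)) := fun t => measurableSet_aboveIn 1 (mR t) _
  have mX' : ∀ t, MeasurableSet (baseIn 0 X t) := measurableSet_baseIn 0 mX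
  have mY' : ∀ t, MeasurableSet (baseIn 1 Y t) := measurableSet_baseIn 1 mY
  have mtrunk : MeasurableSet (trunk (fun t => aboveIn 0 (L t) (lx t))
      (fun t => aboveIn 1 (R t) (ly t)) (baseIn 0 X) (baseIn 1 Y) a b c) :=
    measurableSet_chain (measurableSet_split (mL' _) (measurableSet_chain (mX' _) mL' mX' _)
      (measurableSet_split (mX' _) (measurableSet_chain (mY' _) mY' mR' _) (mR' _)))
      (fun t => mL' _) (fun t => mR' _) c
  refine ⟨measurable_shift k mtrunk, ?_⟩
  have hmain := dualLaw_trunk mL' mR' mX' mY' (c := c) ha hb (lx := lx) (ly := ly) rfl rfl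
    (fun t _ => by rw [hlx, hly, pathLabel_add ha hxz, pathLabel_add hb hyz])
    (fun t ht => abs_pathLabel_le ha (by norm_num) hx hz ht)
    (fun t ht => abs_pathLabel_le hb (by norm_num) hy hz (by omega))
    (fun t T h => h.2.1) (fun t T h => h.2.1) (fun t T h => h.1.2) (fun t T h => h.1.2)
    (fun T h => h.2 rfl) (fun T h => h.2 rfl)
  have h1 : ∏ t ∈ Finset.range (a + c), dualLaw (lx (t + 1)) (aboveIn 0 (L (t + 1)) (lx (t + 1))) =
      TrivSqZeroExt.inl ((∏ t ∈ Finset.range (a + c), ENNReal.ofReal (w (lx (t + 1)))) *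
        ∏ i : Fin (a + c), gwPos (lx (i + 1)) (A i)) := by
    rw [Finset.prod_range, Finset.prod_range, ← Finset.prod_mul_distrib, ← prod_inl_trivSqZeroExt]
    refine Finset.prod_congr rfl fun i _ => ?_
    rw [show L (i + 1) = A i by simp [hL]]
    exact dualLaw_aboveIn_zero (lt_pathLabel zero_le_one hx hz (by omega) (by omega)) _
  have h2 : ∏ t ∈ Finset.range (b + c), dualLaw (ly (t + 1)) (aboveIn 1 (R (t + 1)) (ly (t + 1))) =
      TrivSqZeroExt.inl ((∏ t ∈ Finset.range (b + c), ENNReal.ofReal (w (ly (t + 1) - 1))) *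
        ∏ i : Fin (b + c), (gwPos (ly (i + 1) - 1)).map (shift 1) (A' i)) := by
    rw [Finset.prod_range, Finset.prod_range, ← Finset.prod_mul_distrib, ← prod_inl_trivSqZeroExt]
    refine Finset.prod_congr rfl fun i _ => ?_
    rw [show R (i + 1) = A' i by simp [hR]]
    exact dualLaw_aboveIn_one (lt_pathLabel le_rfl hy hz (by omega) (by omega)) (hA' i)
  have h3 : (∏ t ∈ Finset.range (a + 1), dualLaw (lx t) (baseIn 0 X t)) *
      ∏ t ∈ Finset.range b, dualLaw (ly t) (baseIn 1 Y t) =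
      ∏ i, dualLaw (Sum.elim (fun i : Fin (a + 1) => lx i) (fun i : Fin b => ly i) i) (S i) := by
    rw [Finset.prod_range, Finset.prod_range, Fintype.prod_sum_type]
    congr 1
    · refine Finset.prod_congr rfl fun i _ => ?_
      rw [show (0 : ℤ) = lx 0 from rfl, dualLaw_baseIn,
        show X i = S (Sum.inl i) from dif_pos i.2]
      rfl
    · refine Finset.prod_congr rfl fun i _ => ?_
      rw [show (1 : ℤ) = ly 0 from rfl, dualLaw_baseIn,
        show Y i = S (Sum.inr i) from dif_pos i.2]
      rfl
  -- The shifted tree has root-label `k`, so the `ε` part of `hmain` is a probability under `uit k`.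
  have hlast : lx (a + c) = k := by rw [hlx, pathLabel_add ha hxz, hz.2.1]
  rw [h1, h2, h3, hlast, TrivSqZeroExt.inl_pow, ← TrivSqZeroExt.inl_mul, ← TrivSqZeroExt.inl_mul]
    at hmain
  -- The outer trees and the factors `1/3` are pure scalars, so the `ε` part of the product is this
  -- scalar times the `ε` part of the inner forest.
  have hsnd := congrArg TrivSqZeroExt.snd hmain
  rw [snd_dualLaw, TrivSqZeroExt.snd_mul, TrivSqZeroExt.fst_inl, TrivSqZeroExt.snd_inl, smul_zero,
    add_zero, smul_eq_mul, forestLaw_pi, uit, Measure.map_apply (measurable_shift k) mtrunk] at hsnd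
  rw [hsnd, branchWeight, Fintype.card_sum, Fintype.card_fin, Fintype.card_fin,
    show a + 1 + b = a + b + 1 by omega]
  ring

end

/-! ### The explicit weight and the conditional law -/

theorem prod_range_pathLabel (f : ℤ → ℝ) {s : ℤ} {a c : ℕ} {x z : ℕ → ℤ} (ha : 1 ≤ a)
    (h : x a = z 0) : ∏ t ∈ Finset.range (a + c), f (pathLabel s a x z (t + 1)) =
      (∏ i ∈ Finset.Icc 1 a, f (x i)) * ∏ i ∈ Finset.Icc 1 c, f (z i) := by
  have e : ∀ (n : ℕ) (g : ℕ → ℝ), ∏ i ∈ Finset.Icc 1 n, g i = ∏ t ∈ Finset.range n, g (t + 1) :=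
    fun n g => by
      rw [← Finset.Ico_add_one_right_eq_Icc, Finset.prod_Ico_eq_prod_range]
      exact Finset.prod_congr rfl fun t _ => by rw [add_comm]
  rw [Finset.prod_range_add, e, e]
  congr 1
  · refine Finset.prod_congr rfl fun t ht => ?_
    rw [Finset.mem_range] at ht
    rw [pathLabel_of_pos (by omega), if_pos (by omega)]
  · exact Finset.prod_congr rfl fun t _ => by rw [add_assoc, pathLabel_add ha h]

/-- Conditioning on the event requires positive probability, which comes from the positivity of `w`
at the labels of the walks. -/
theorem branchWeight_ne_zero {k k' : ℤ} {a b c : ℕ} {x y z : ℕ → ℤ}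
    (hx : IsWalkAbove 0 1 a 1 k' x) (hy : IsWalkAbove 1 1 b 2 k' y)
    (hz : IsWalkAbove 1 0 c k' k z) :
    branchWeight a b c (pathLabel 0 a x z) (pathLabel 1 b y z) ≠ 0 := by
  simp only [branchWeight, ne_eq, mul_eq_zero, not_or, Finset.prod_eq_zero_iff, not_exists, not_and,
    Finset.mem_range, ENNReal.ofReal_eq_zero, not_le]
  refine ⟨⟨⟨by simp, fun t ht => w_pos ?_⟩, fun t ht => w_pos ?_⟩, by simp⟩
  · exact lt_pathLabel zero_le_one hx hz (by omega) (by omega)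
  · have := lt_pathLabel (s := 1) le_rfl hy hz (t := t + 1) (by omega) (by omega)
    omega

theorem toReal_branchWeight {k k' : ℤ} {a b c : ℕ} (ha : 1 ≤ a) (hb : 1 ≤ b) {x y z : ℕ → ℤ}
    (hx : IsWalkAbove 0 1 a 1 k' x) (hy : IsWalkAbove 1 1 b 2 k' y)
    (hz : IsWalkAbove 1 0 c k' k z) :
    (branchWeight a b c (pathLabel 0 a x z) (pathLabel 1 b y z)).toReal =
      ((a : ℝ) + b + 1) / 3 ^ (a + b + c) * (∏ i ∈ Finset.Icc 1 a, w (x i)) *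
        (∏ i ∈ Finset.Icc 1 b, w (y i - 1)) *
        (∏ i ∈ Finset.Icc 1 c, w (z i) * w (z i - 1)) := by
  have h1 : ∏ t ∈ Finset.range (a + c), (ENNReal.ofReal (w (pathLabel 0 a x z (t + 1)))).toReal =
      (∏ i ∈ Finset.Icc 1 a, w (x i)) * ∏ i ∈ Finset.Icc 1 c, w (z i) := by
    rw [← prod_range_pathLabel w ha (hx.2.1.trans hz.1.symm)]
    refine Finset.prod_congr rfl fun t ht => ENNReal.toReal_ofReal (w_pos ?_).le
    rw [Finset.mem_range] at ht
    exact lt_pathLabel zero_le_one hx hz (by omega) (by omega)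
  have h2 : ∏ t ∈ Finset.range (b + c),
      (ENNReal.ofReal (w (pathLabel 1 b y z (t + 1) - 1))).toReal =
      (∏ i ∈ Finset.Icc 1 b, w (y i - 1)) * ∏ i ∈ Finset.Icc 1 c, w (z i - 1) := by
    rw [← prod_range_pathLabel (fun v => w (v - 1)) hb (hy.2.1.trans hz.1.symm)]
    refine Finset.prod_congr rfl fun t ht => ENNReal.toReal_ofReal (w_pos ?_).le
    rw [Finset.mem_range] at ht
    have := lt_pathLabel (s := 1) le_rfl hy hz (t := t + 1) (by omega) (by omega)
    omega
  rw [branchWeight, ENNReal.toReal_mul, ENNReal.toReal_mul, ENNReal.toReal_mul, ENNReal.toReal_prod,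
    ENNReal.toReal_prod, h1, h2, Finset.prod_mul_distrib]
  simp only [ENNReal.toReal_pow, ENNReal.toReal_inv, ENNReal.toReal_ofNat, ENNReal.toReal_natCast]
  push_cast
  rw [inv_pow]
  ring

/-- The probability that the branches are prescribed, and the law of the grafted subtrees. -/
theorem uniformInfiniteTree_branchSet {k k' a b c : ℕ} (ha : 1 ≤ a) (hb : 1 ≤ b) (hc : 1 ≤ c)
    {x y z : ℕ → ℤ} (hx : IsWalkAbove 0 1 a 1 k' x) (hy : IsWalkAbove 1 1 b 2 k' y)
    (hz : IsWalkAbove 1 0 c k' k z) :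
    uniformInfiniteTree (branchSet k a b c x y z) =
        branchWeight a b c (pathLabel 0 a x z) (pathLabel 1 b y z) ∧
      MeasurableSet (branchSet k a b c x y z) ∧
      HasLaw (fun T => (forestTau k a c T, forestTau' k b c T, forestBar k a b T))
        ((Measure.pi fun i : Fin (a + c) => gwPos (pathLabel 0 a x z (i + 1))).prod
          ((Measure.pi fun i : Fin (b + c) =>
              (gwPos (pathLabel 1 b y z (i + 1) - 1)).map (shift 1)).prod
            (forestLaw (Sum.elim (fun i : Fin (a + 1) => pathLabel 0 a x z i)
              (fun i : Fin b => pathLabel 1 b y z i)))))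
        uniformInfiniteTree[|branchSet k a b c x y z] := by
  have hp1 : ∀ i : Fin (a + c), IsProbabilityMeasure (gwPos (pathLabel 0 a x z (i + 1))) :=
    fun i => isProbabilityMeasure_gwPos (lt_pathLabel zero_le_one hx hz (by omega) (by omega))
  have hp2 : ∀ i : Fin (b + c), IsProbabilityMeasure
      ((gwPos (pathLabel 1 b y z (i + 1) - 1)).map (shift 1)) := fun i => by
    have h := lt_pathLabel (s := 1) le_rfl hy hz (t := i + 1) (by omega) (by omega)
    have := isProbabilityMeasure_gwPos (x := pathLabel 1 b y z (i + 1) - 1) (by omega)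
    exact Measure.isProbabilityMeasure_map (measurable_shift 1).aemeasurable
  refine hasLaw_cond_of_rectangles₃ (branchWeight_ne_zero hx hy hz) (fun s hs => ?_) fun s hs => ?_
  · obtain ⟨A, A', S, hA, hA', hS, rfl⟩ := mem_rectangles₃.1 hs
    exact (measure_branchSet_inter ha hb hc hx hy hz hA hA' hS).1
  · obtain ⟨A, A', S, hA, hA', hS, rfl⟩ := mem_rectangles₃.1 hs
    rw [(measure_branchSet_inter ha hb hc hx hy hz hA hA' hS).2, Measure.prod_prod,
      Measure.prod_prod, Measure.pi_pi, Measure.pi_pi]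

end UIPQ

theorem mainTheorem5 {Ω : Type*} [MeasurableSpace Ω] (P : Measure Ω) [IsProbabilityMeasure P]
    (θ : Ω → UIPQ.LTree) (hθ : HasLaw θ UIPQ.uniformInfiniteTree P)
    (k a b c k' : ℕ) (ha : 1 ≤ a) (hb : 1 ≤ b) (hc : 1 ≤ c) (hk' : 1 ≤ k')
    (x y z : ℕ → ℤ)
    (hx : UIPQ.IsWalkAbove 0 1 a 1 k' x)
    (hy : UIPQ.IsWalkAbove 1 1 b 2 k' y)
    (hz : UIPQ.IsWalkAbove 1 0 c k' k z) :
    P.real (θ ⁻¹' UIPQ.LTree.branchSet k a b c x y z) =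
      ((a : ℝ) + b + 1) / 3 ^ (a + b + c) *
        (∏ i ∈ Finset.Icc 1 a, UIPQ.w (x i)) *
        (∏ i ∈ Finset.Icc 1 b, UIPQ.w (y i - 1)) *
        (∏ i ∈ Finset.Icc 1 c, UIPQ.w (z i) * UIPQ.w (z i - 1)) ∧
    HasLaw
      (fun ω => (UIPQ.LTree.forestTau k a c (θ ω), UIPQ.LTree.forestTau' k b c (θ ω),
        UIPQ.LTree.forestBar k a b (θ ω)))
      ((Measure.pi fun i : Fin (a + c) =>
          UIPQ.gwPos (if (i : ℕ) + 1 ≤ a then x (i + 1) else z (i + 1 - a))).prod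
        ((Measure.pi fun i : Fin (b + c) =>
            (UIPQ.gwPos ((if (i : ℕ) + 1 ≤ b then y (i + 1) else z (i + 1 - b)) - 1)).map
              (UIPQ.LTree.shift 1)).prod
          (UIPQ.forestLaw (Sum.elim
            (fun i : Fin (a + 1) => if (i : ℕ) = 0 then 0 else x i)
            (fun i : Fin b => if (i : ℕ) = 0 then 1 else y i)))))
      (P[|θ ⁻¹' UIPQ.LTree.branchSet k a b c x y z]) := by
  obtain ⟨h1, h2, h3⟩ := UIPQ.uniformInfiniteTree_branchSet ha hb hc hx hy hz
  constructor
  · rw [measureReal_def, ← Measure.map_apply_of_aemeasurable hθ.aemeasurable h2, hθ.map_eq, h1,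
      UIPQ.toReal_branchWeight ha hb hx hy hz]
  · have e1 : ∀ i : Fin (a + c), (if (i : ℕ) + 1 ≤ a then x (i + 1) else z (i + 1 - a)) =
        UIPQ.pathLabel 0 a x z (i + 1) := fun i => (UIPQ.pathLabel_of_pos (by omega)).symm
    have e2 : ∀ i : Fin (b + c), (if (i : ℕ) + 1 ≤ b then y (i + 1) else z (i + 1 - b)) =
        UIPQ.pathLabel 1 b y z (i + 1) := fun i => (UIPQ.pathLabel_of_pos (by omega)).symm
    have e3 : ∀ i : Fin (a + 1), (if (i : ℕ) = 0 then 0 else x i) = UIPQ.pathLabel 0 a x z i :=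
      fun i => by rw [UIPQ.pathLabel, if_pos (show (i : ℕ) ≤ a by omega)]
    have e4 : ∀ i : Fin b, (if (i : ℕ) = 0 then 1 else y i) = UIPQ.pathLabel 1 b y z i :=
      fun i => by rw [UIPQ.pathLabel, if_pos (show (i : ℕ) ≤ b by omega)]
    simp only [e1, e2, e3, e4]
    exact h3.comp (UIPQ.hasLaw_cond_preimage hθ h2)
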